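/- For a finite undirected graph $G=(V,E)$ (loops and parallel edges allowed) with $n=|V|$ and $m=|E|$, let $$T(G;x,y)=\sum_{A\subseteq E}(x-1)^{k(A)-k(E)}\,(y-1)^{k(A)+|A|-|V|},$$ where $k(A)$ is the number of connected components of $(V,A)$ and $0^0=1$, and let $\mathrm{tw}(G)$ be the treewidth of $G$. There is a single algorithm that, given an arbitrary graph $G$ and an arbitrary point $(a,b)\in\mathbb{C}^2$, computes $T(G;a,b)$ in time $\mathrm{tw}(G)^{O(\mathrm{tw}(G))}(n+m)^{O(1)}$; for simple graphs this is $\mathrm{tw}(G)^{O(\mathrm{tw}(G))}n^{O(1)}$. (No tree decomposition is part of the input.) Precisely, there are a program $P$ and a constant $C\in\mathbb{N}$ such that for all $G$ and all $(a,b)\in\mathbb{C}^2$ the program $P$, given $n$, $m$, the list of the ends of the edges of $G$, and $a,b$, halts with output $T(G;a,b)$ after at most $C\cdot \mathrm{tw}(G)^{C\,\mathrm{tw}(G)}(n+m+1)^C$ steps, and, if $G$ is simple, after at most $C\cdot \mathrm{tw}(G)^{C\,\mathrm{tw}(G)}(n+1)^C$ steps (with $0^0=1$, and with the treewidth of the graph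 without vertices taken to be $0$). Programs run on a unit-cost random access machine with registers and arrays of natural numbers (used as counters and addresses, with addition, truncated subtraction and comparison) and registers and arrays of complex numbers (with $+,-,\cdot,/$ and the equality test, each taking constant time); the only constants in programs are natural numbers. -/

import Mathlib

noncomputable section

namespace TutteTW

/-! ### Graphs, the Tutte polynomial, treewidth -/

/-- A finite undirected graph with vertices `0, …, n - 1` and edges `0, …, m - 1`, the edge `e`
joining `src e` and `tgt e`. Loops and parallel edges are allowed; the order of the two ends of an
edge carries no meaning. -/
structure MGraph (n m : ℕ) where
  src : Fin m → Fin n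
  tgt : Fin m → Fin n

namespace MGraph

variable {n m : ℕ}

/-- No loops, and no two edges with the same pair of ends. -/
def IsSimple (G : MGraph n m) : Prop :=
  (∀ e, G.src e ≠ G.tgt e) ∧
    Function.Injective (fun e => s(G.src e, G.tgt e))

/-- The graph `(V, A)`, with loops and multiplicities forgotten (they do not influence
connectivity). -/
def spanning (G : MGraph n m) (A : Finset (Fin m)) : SimpleGraph (Fin n) :=
  SimpleGraph.fromRel (fun u v => ∃ e ∈ A, G.src e = u ∧ G.tgt e = v)

/-- `k(A)`, the number of connected components of `(V, A)`. -/
def numComp (G : MGraph n m) (A : Finset (Fin m)) : ℕ :=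
  Nat.card (G.spanning A).ConnectedComponent

/-- `T(G; x, y) = ∑_{A ⊆ E} (x - 1)^(k(A) - k(E)) (y - 1)^(k(A) + |A| - |V|)`, with `0 ^ 0 = 1`.
Both exponents are nonnegative integers, so that the subtractions in `ℕ` are exact. -/
def tutte (G : MGraph n m) (x y : ℂ) : ℂ :=
  ∑ A : Finset (Fin m),
    (x - 1) ^ (G.numComp A - G.numComp Finset.univ) * (y - 1) ^ (G.numComp A + A.card - n)

/-- A tree decomposition of `G`. -/
structure TreeDecomposition (G : MGraph n m) where
  numNodes : ℕ
  tree : SimpleGraph (Fin numNodes)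
  isTree : tree.IsTree
  bag : Fin numNodes → Finset (Fin n)
  vertex_mem : ∀ v, ∃ x, v ∈ bag x
  edge_mem : ∀ e, ∃ x, G.src e ∈ bag x ∧ G.tgt e ∈ bag x
  subtree : ∀ v, (tree.induce {x | v ∈ bag x}).Connected

/-- The width of a tree decomposition: the largest size of a bag, minus one
(and `0` if all bags are empty, which can only happen for `n = 0`). -/
def TreeDecomposition.width {G : MGraph n m} (D : G.TreeDecomposition) : ℕ :=
  (Finset.univ.sup fun x => (D.bag x).card) - 1

/-- The treewidth: the least width of a tree decomposition. (The set is never empty, as there is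
the decomposition with a single bag.) -/
def treewidth (G : MGraph n m) : ℕ :=
  sInf (Set.range fun D : G.TreeDecomposition => D.width)

end MGraph

/-! ### The machine model

A random access machine with two kinds of data: *words*, which are natural numbers and serve as
counters and addresses, and *numbers*, which are complex. A program uses finitely many registers
and finitely many arrays (unbounded, with random access) of either kind.
Every operation has unit cost. On numbers these are the four field operations and the test for
equality; numbers cannot be converted into words. On words these are addition, truncated
subtraction and comparison. Words are not bounded in size, but since there is no multiplication
(nor shift) of words, a word computed in `t` steps has `O(t)` bits more than the input words. -/

/-- Word expressions. `reg i` is a register and `get A e` is the cell `e` of the array `A`. -/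
inductive WExpr : Type
  | lit (k : ℕ)
  | reg (i : ℕ)
  | get (A : ℕ) (e : WExpr)
  | add (e f : WExpr)
  | sub (e f : WExpr)

/-- Number expressions. -/
inductive NExpr : Type
  | lit (k : ℕ)
  | reg (i : ℕ)
  | get (A : ℕ) (e : WExpr)
  | add (e f : NExpr)
  | sub (e f : NExpr)
  | mul (e f : NExpr)
  | div (e f : NExpr)

/-- Tests. -/
inductive Test : Type
  | le (e f : WExpr)
  | eq (e f : WExpr)
  | numEq (e f : NExpr)
  | not (c : Test)
  | and (c d : Test)

/-- Programs. -/
inductive Prog : Type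
  | skip
  | setW (i : ℕ) (e : WExpr)
  | putW (A : ℕ) (idx : WExpr) (e : WExpr)
  | setN (i : ℕ) (e : NExpr)
  | putN (A : ℕ) (idx : WExpr) (e : NExpr)
  | seq (p q : Prog)
  | ite (c : Test) (p q : Prog)
  | while (c : Test) (p : Prog)

/-- Memory contents: registers and arrays of words, registers and arrays of numbers. -/
structure State where
  wreg : ℕ → ℕ
  warr : ℕ → ℕ → ℕ
  nreg : ℕ → ℂ
  narr : ℕ → ℕ → ℂ

def WExpr.eval (s : State) : WExpr → ℕ
  | .lit k => k
  | .reg i => s.wreg i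
  | .get A e => s.warr A (e.eval s)
  | .add e f => e.eval s + f.eval s
  | .sub e f => e.eval s - f.eval s

/-- The time to evaluate an expression is the number of its constituents. -/
def WExpr.cost : WExpr → ℕ
  | .lit _ => 1
  | .reg _ => 1
  | .get _ e => e.cost + 1
  | .add e f => e.cost + f.cost + 1
  | .sub e f => e.cost + f.cost + 1

/-- Here `x / 0 = 0`, which a program could also arrange for by a test. -/
def NExpr.eval (s : State) : NExpr → ℂ
  | .lit k => (k : ℂ)
  | .reg i => s.nreg i
  | .get A e => s.narr A (e.eval s)
  | .add e f => e.eval s + f.eval s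
  | .sub e f => e.eval s - f.eval s
  | .mul e f => e.eval s * f.eval s
  | .div e f => e.eval s / f.eval s

def NExpr.cost : NExpr → ℕ
  | .lit _ => 1
  | .reg _ => 1
  | .get _ e => e.cost + 1
  | .add e f => e.cost + f.cost + 1
  | .sub e f => e.cost + f.cost + 1
  | .mul e f => e.cost + f.cost + 1
  | .div e f => e.cost + f.cost + 1

def Test.holds (s : State) : Test → Prop
  | .le e f => e.eval s ≤ f.eval s
  | .eq e f => e.eval s = f.eval s
  | .numEq e f => e.eval s = f.eval s
  | .not c => ¬ c.holds s
  | .and c d => c.holds s ∧ d.holds s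

def Test.cost : Test → ℕ
  | .le e f => e.cost + f.cost + 1
  | .eq e f => e.cost + f.cost + 1
  | .numEq e f => e.cost + f.cost + 1
  | .not c => c.cost + 1
  | .and c d => c.cost + d.cost + 1

def State.setW (s : State) (i v : ℕ) : State :=
  { s with wreg := Function.update s.wreg i v }

def State.putW (s : State) (A i v : ℕ) : State :=
  { s with warr := Function.update s.warr A (Function.update (s.warr A) i v) }

def State.setN (s : State) (i : ℕ) (z : ℂ) : State :=
  { s with nreg := Function.update s.nreg i z }

def State.putN (s : State) (A i : ℕ) (z : ℂ) : State :=
  { s with narr := Function.update s.narr A (Function.update (s.narr A) i z) }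

/-- `Exec p s t s'`: the program `p`, started in state `s`, halts in state `s'` after exactly `t`
steps. -/
inductive Exec : Prog → State → ℕ → State → Prop
  | skip (s : State) : Exec .skip s 1 s
  | setW (s : State) (i : ℕ) (e : WExpr) :
      Exec (.setW i e) s (e.cost + 1) (s.setW i (e.eval s))
  | putW (s : State) (A : ℕ) (idx e : WExpr) :
      Exec (.putW A idx e) s (idx.cost + e.cost + 1) (s.putW A (idx.eval s) (e.eval s))
  | setN (s : State) (i : ℕ) (e : NExpr) :
      Exec (.setN i e) s (e.cost + 1) (s.setN i (e.eval s))
  | putN (s : State) (A : ℕ) (idx : WExpr) (e : NExpr) :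
      Exec (.putN A idx e) s (idx.cost + e.cost + 1) (s.putN A (idx.eval s) (e.eval s))
  | seq {p q : Prog} {s s' s'' : State} {t t' : ℕ} :
      Exec p s t s' → Exec q s' t' s'' → Exec (.seq p q) s (t + t') s''
  | ite_true {c : Test} {p q : Prog} {s s' : State} {t : ℕ} :
      c.holds s → Exec p s t s' → Exec (.ite c p q) s (c.cost + t) s'
  | ite_false {c : Test} {p q : Prog} {s s' : State} {t : ℕ} :
      ¬ c.holds s → Exec q s t s' → Exec (.ite c p q) s (c.cost + t) s'
  | while_true {c : Test} {p : Prog} {s s' s'' : State} {t t' : ℕ} :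
      c.holds s → Exec p s t s' → Exec (.while c p) s' t' s'' →
        Exec (.while c p) s (c.cost + t + t') s''
  | while_false {c : Test} {p : Prog} {s : State} :
      ¬ c.holds s → Exec (.while c p) s c.cost s

/-- The initial memory on input `G` and `(a, b)`: the word registers `0` and `1` hold the numbers
of vertices and of edges, the word arrays `0` and `1` list the ends of the edges, the number
registers `0` and `1` hold `a` and `b`, and everything else is zero. -/
def initState {n m : ℕ} (G : MGraph n m) (a b : ℂ) : State where
  wreg i := if i = 0 then n else if i = 1 then m else 0
  warr A e :=
    if h : e < m then
      (if A = 0 then (G.src ⟨e, h⟩ : ℕ) else if A = 1 then (G.tgt ⟨e, h⟩ : ℕ) else 0)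
    else 0
  nreg i := if i = 0 then a else if i = 1 then b else 0
  narr _ _ := 0

/-- The program `p`, run on input `G` and `(a, b)`, halts after exactly `t` steps with the value `z`
in number register `0`. -/
def Outputs {n m : ℕ} (p : Prog) (G : MGraph n m) (a b : ℂ) (t : ℕ) (z : ℂ) : Prop :=
  ∃ s : State, Exec p (initState G a b) t s ∧ s.nreg 0 = z

end TutteTW

end

/-! Values. At a point (α+1, β+1) with positive integers α, β, the Tutte polynomial is, up to the
factor α^(-k(E)) β^(-n), a Potts partition function: the sum, over all colourings of the vertices
with q = αβ colours, of the product of 1+β over the monochromatic edges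
(`MGraph.tutte_eq_sum_colourings`). Since T(G; x, y) has degree at most n in x and at most m in y,
its values on a grid of (n+1)(m+1) such points determine it everywhere (`MGraph.tutte_eq_lagrange`).
The point (a, b) enters only through this interpolation, so no point is special.

Colourings. Let the vertices be summed out in decreasing order, and let N(i) be the set of the
vertices below i that are adjacent to the component of i among the vertices not below i. The message
sent by i depends only on the colours of N(i) (`msg_congr`), and the messages of the vertices with
N(i) empty multiply to the whole sum (`sum_prod_edgeWeight`). Messages are invariant under
permutations of the colours, so that only some p > |N(i)| colours need to be tried: all others
contribute the same as a colour that is unused on N(i) (`msg_eq_of_unused`). A message therefore has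
p^|N(i)| relevant values, however large q is.

Order. An order with |N(i)| ≤ 8 tw + 8 is built from its lower end. Each component C of the vertices
that are not yet placed has a neighbourhood W of at most 4 tw + 4 placed vertices. If this bound is
attained, a balanced bag of a tree decomposition provides a set A of at most half of W that cannot
be linked to the rest of W by disjoint paths through C (`MGraph.exists_unlinked`). All subsets A of
W are tried. The linkage is a bipartite matching problem between A ∪ C and C ∪ (W \ A) along "equal
or adjacent"; when it has no solution, a violation of Hall's condition yields a separator X in C,
and after X and one further vertex are placed no new component has a neighbourhood larger than W
(`card_nbF_le_of_violation`).

Time. `WP M p Q s` asserts a running time of at most M ^ `p.deg`, where M bounds the number of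
iterations of each loop. For the whole program M = 2(n+m+1)(8 tw + 10)^(8 tw + 10) is enough
(`tutteProg_spec`), and a fixed power of it has the required form (`pow_bound`). -/

noncomputable section

namespace TutteTW

/-! ### Program logic -/

namespace Prog

/-- The exponent `d` such that a run of `p` in which every loop makes at most `M` iterations takes
at most `M ^ d` steps. -/
def deg : Prog → ℕ
  | .skip => 1
  | .setW _ e => e.cost + 1
  | .putW _ i e => i.cost + e.cost + 1
  | .setN _ e => e.cost + 1
  | .putN _ i e => i.cost + e.cost + 1
  | .seq p q => p.deg + q.deg + 1
  | .ite c p q => c.cost + p.deg + q.deg + 1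
  | .while c p => c.cost + p.deg + 3

/-- `p` assigns only to the listed registers and arrays. -/
def within (ws was ns nas : List ℕ) : Prog → Bool
  | .skip => true
  | .setW i _ => decide (i ∈ ws)
  | .putW A _ _ => decide (A ∈ was)
  | .setN i _ => decide (i ∈ ns)
  | .putN A _ _ => decide (A ∈ nas)
  | .seq p q => p.within ws was ns nas && q.within ws was ns nas
  | .ite _ p q => p.within ws was ns nas && q.within ws was ns nas
  | .while _ p => p.within ws was ns nas

end Prog

/-- `s'` agrees with `s` outside of the listed registers and arrays. -/
structure Agree (ws was ns nas : List ℕ) (s s' : State) : Prop where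
  wreg : ∀ i, i ∉ ws → s'.wreg i = s.wreg i
  warr : ∀ A, A ∉ was → s'.warr A = s.warr A
  nreg : ∀ i, i ∉ ns → s'.nreg i = s.nreg i
  narr : ∀ A, A ∉ nas → s'.narr A = s.narr A

theorem Agree.refl {ws was ns nas : List ℕ} (s : State) : Agree ws was ns nas s s :=
  ⟨fun _ _ => rfl, fun _ _ => rfl, fun _ _ => rfl, fun _ _ => rfl⟩

theorem Agree.trans {ws was ns nas : List ℕ} {s s' s'' : State} (h : Agree ws was ns nas s s')
    (h' : Agree ws was ns nas s' s'') : Agree ws was ns nas s s'' :=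
  ⟨fun i hi => (h'.wreg i hi).trans (h.wreg i hi), fun i hi => (h'.warr i hi).trans (h.warr i hi),
    fun i hi => (h'.nreg i hi).trans (h.nreg i hi), fun i hi => (h'.narr i hi).trans (h.narr i hi)⟩

/-! ### Memory after a single assignment -/

section
variable (s : State) (i j A B v : ℕ) (z : ℂ)

@[simp] theorem setW_wreg : (s.setW i v).wreg j = if j = i then v else s.wreg j := by
  simp [State.setW, Function.update_apply]
@[simp] theorem setW_warr : (s.setW i v).warr = s.warr := rfl
@[simp] theorem setW_nreg : (s.setW i v).nreg = s.nreg := rfl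
@[simp] theorem setW_narr : (s.setW i v).narr = s.narr := rfl
@[simp] theorem putW_warr : (s.putW A i v).warr B =
    if B = A then Function.update (s.warr A) i v else s.warr B := by
  simp [State.putW, Function.update_apply]
@[simp] theorem putW_wreg : (s.putW A i v).wreg = s.wreg := rfl
@[simp] theorem putW_nreg : (s.putW A i v).nreg = s.nreg := rfl
@[simp] theorem putW_narr : (s.putW A i v).narr = s.narr := rfl
@[simp] theorem setN_nreg : (s.setN i z).nreg j = if j = i then z else s.nreg j := by
  simp [State.setN, Function.update_apply]
@[simp] theorem setN_wreg : (s.setN i z).wreg = s.wreg := rfl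
@[simp] theorem setN_warr : (s.setN i z).warr = s.warr := rfl
@[simp] theorem setN_narr : (s.setN i z).narr = s.narr := rfl
@[simp] theorem putN_narr : (s.putN A i z).narr B =
    if B = A then Function.update (s.narr A) i z else s.narr B := by
  simp [State.putN, Function.update_apply]
@[simp] theorem putN_wreg : (s.putN A i z).wreg = s.wreg := rfl
@[simp] theorem putN_warr : (s.putN A i z).warr = s.warr := rfl
@[simp] theorem putN_nreg : (s.putN A i z).nreg = s.nreg := rfl

end

attribute [simp] WExpr.eval NExpr.eval Test.holds

/-- The frame rule. The premise is a syntactic check, so that the survival of registers and arrays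
can be settled by `decide`. -/
theorem Exec.agree {ws was ns nas : List ℕ} {p : Prog} {s s' : State} {t : ℕ}
    (h : Exec p s t s') (hp : p.within ws was ns nas = true) : Agree ws was ns nas s s' := by
  induction h with
  | skip s => exact Agree.refl s
  | setW s i e =>
    simp only [Prog.within, decide_eq_true_eq] at hp
    refine ⟨fun j hj => ?_, fun _ _ => rfl, fun _ _ => rfl, fun _ _ => rfl⟩
    rw [setW_wreg, if_neg (by rintro rfl; exact hj hp)]
  | putW s A i e =>
    simp only [Prog.within, decide_eq_true_eq] at hp
    refine ⟨fun _ _ => rfl, fun j hj => ?_, fun _ _ => rfl, fun _ _ => rfl⟩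
    rw [putW_warr, if_neg (by rintro rfl; exact hj hp)]
  | setN s i e =>
    simp only [Prog.within, decide_eq_true_eq] at hp
    refine ⟨fun _ _ => rfl, fun _ _ => rfl, fun j hj => ?_, fun _ _ => rfl⟩
    rw [setN_nreg, if_neg (by rintro rfl; exact hj hp)]
  | putN s A i e =>
    simp only [Prog.within, decide_eq_true_eq] at hp
    refine ⟨fun _ _ => rfl, fun _ _ => rfl, fun _ _ => rfl, fun j hj => ?_⟩
    rw [putN_narr, if_neg (by rintro rfl; exact hj hp)]
  | seq _ _ ih1 ih2 =>
    simp only [Prog.within, Bool.and_eq_true] at hp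
    exact (ih1 hp.1).trans (ih2 hp.2)
  | ite_true _ _ ih =>
    simp only [Prog.within, Bool.and_eq_true] at hp
    exact ih hp.1
  | ite_false _ _ ih =>
    simp only [Prog.within, Bool.and_eq_true] at hp
    exact ih hp.2
  | while_true _ _ _ ih1 ih2 => exact (ih1 hp).trans (ih2 hp)
  | while_false _ => exact Agree.refl _

/-- Started in `s`, the program `p` halts within `M ^ p.deg` steps in a state satisfying `Q`. -/
def WP (M : ℕ) (p : Prog) (Q : State → Prop) (s : State) : Prop :=
  ∃ t s', Exec p s t s' ∧ t ≤ M ^ p.deg ∧ Q s'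

/-! ### Rules for termination, running time and outcome together -/

namespace WP

variable {M : ℕ} {p q : Prog} {Q Q' : State → Prop} {s : State}

theorem mono (h : WP M p Q s) (hQ : ∀ s', Q s' → Q' s') : WP M p Q' s := by
  obtain ⟨t, s', h1, h2, h3⟩ := h
  exact ⟨t, s', h1, h2, hQ s' h3⟩

theorem agree (ws was ns nas : List ℕ) (hp : p.within ws was ns nas = true) (h : WP M p Q s) :
    WP M p (fun s' => Agree ws was ns nas s s' ∧ Q s') s := by
  obtain ⟨t, s', h1, h2, h3⟩ := h
  exact ⟨t, s', h1, h2, h1.agree hp, h3⟩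

theorem le_pow_self' (hM : 2 ≤ M) (c : ℕ) : c ≤ M ^ c :=
  (Nat.lt_pow_self (by omega)).le

theorem skip (hM : 2 ≤ M) (h : Q s) : WP M .skip Q s :=
  ⟨1, s, .skip s, le_pow_self' hM 1, h⟩

theorem setW (hM : 2 ≤ M) {i : ℕ} {e : WExpr} (h : Q (s.setW i (e.eval s))) :
    WP M (.setW i e) Q s :=
  ⟨_, _, .setW s i e, le_pow_self' hM _, h⟩

theorem putW (hM : 2 ≤ M) {A : ℕ} {i e : WExpr} (h : Q (s.putW A (i.eval s) (e.eval s))) :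
    WP M (.putW A i e) Q s :=
  ⟨_, _, .putW s A i e, le_pow_self' hM _, h⟩

theorem setN (hM : 2 ≤ M) {i : ℕ} {e : NExpr} (h : Q (s.setN i (e.eval s))) :
    WP M (.setN i e) Q s :=
  ⟨_, _, .setN s i e, le_pow_self' hM _, h⟩

theorem putN (hM : 2 ≤ M) {A : ℕ} {i : WExpr} {e : NExpr}
    (h : Q (s.putN A (i.eval s) (e.eval s))) : WP M (.putN A i e) Q s :=
  ⟨_, _, .putN s A i e, le_pow_self' hM _, h⟩

theorem seq (hM : 2 ≤ M) (h : WP M p (fun s' => WP M q Q s') s) : WP M (.seq p q) Q s := by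
  obtain ⟨t, s', h1, h2, t', s'', h3, h4, h5⟩ := h
  refine ⟨t + t', s'', .seq h1 h3, ?_, h5⟩
  have e1 : M ^ p.deg ≤ M ^ (p.deg + q.deg) := Nat.pow_le_pow_right (by omega) (by omega)
  have e2 : M ^ q.deg ≤ M ^ (p.deg + q.deg) := Nat.pow_le_pow_right (by omega) (by omega)
  have e3 : M ^ (p.deg + q.deg) * 2 ≤ M ^ (p.deg + q.deg + 1) := by
    rw [pow_succ]; exact Nat.mul_le_mul_left _ hM
  simp only [Prog.deg]
  omega

theorem ite (hM : 2 ≤ M) {c : Test} (h1 : c.holds s → WP M p Q s)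
    (h2 : ¬ c.holds s → WP M q Q s) : WP M (.ite c p q) Q s := by
  have key : ∀ d t, d ≤ p.deg + q.deg → t ≤ M ^ d →
      c.cost + t ≤ M ^ (c.cost + p.deg + q.deg + 1) := by
    intro d t hd ht
    have e0 := le_pow_self' hM c.cost
    have e1 : M ^ c.cost ≤ M ^ (c.cost + p.deg + q.deg) :=
      Nat.pow_le_pow_right (by omega) (by omega)
    have e2 : M ^ d ≤ M ^ (c.cost + p.deg + q.deg) :=
      Nat.pow_le_pow_right (by omega) (by omega)
    have e3 : M ^ (c.cost + p.deg + q.deg) * 2 ≤ M ^ (c.cost + p.deg + q.deg + 1) := by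
      rw [pow_succ]; exact Nat.mul_le_mul_left _ hM
    omega
  by_cases hc : c.holds s
  · obtain ⟨t, s', a, b, d⟩ := h1 hc
    exact ⟨_, s', .ite_true hc a, key _ _ (by omega) b, d⟩
  · obtain ⟨t, s', a, b, d⟩ := h2 hc
    exact ⟨_, s', .ite_false hc a, key _ _ (by omega) b, d⟩

theorem while_aux {c : Test} {I : State → Prop} {μ : State → ℕ} {T : ℕ}
    (step : ∀ s', I s' → c.holds s' →
      ∃ t s'', Exec p s' t s'' ∧ t ≤ T ∧ I s'' ∧ μ s'' < μ s') :
    ∀ k s, μ s ≤ k → I s → ∃ t s', Exec (.while c p) s t s' ∧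
      t ≤ k * (c.cost + T) + c.cost ∧ I s' ∧ ¬ c.holds s' := by
  intro k
  induction k with
  | zero =>
    intro s hk hI
    by_cases hc : c.holds s
    · obtain ⟨t, s'', _, _, _, h⟩ := step s hI hc
      omega
    · exact ⟨_, s, .while_false hc, by omega, hI, hc⟩
  | succ k ih =>
    intro s hk hI
    by_cases hc : c.holds s
    · obtain ⟨t, s'', h1, h2, h3, h4⟩ := step s hI hc
      obtain ⟨t', s', g1, g2, g3, g4⟩ := ih s'' (by omega) h3
      refine ⟨_, s', .while_true hc h1 g1, ?_, g3, g4⟩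
      have : (k + 1) * (c.cost + T) = k * (c.cost + T) + (c.cost + T) := by ring
      omega
    · exact ⟨_, s, .while_false hc, by omega, hI, hc⟩

/-- The measure `μ` does double duty: its decrease gives termination, and its initial value, at most
`M`, bounds the number of iterations. The step may use that everything outside of the listed
registers and arrays is still as it was before the loop. -/
theorem whileDo (hM : 2 ≤ M) {c : Test} (ws was ns nas : List ℕ)
    (hp : p.within ws was ns nas = true) (I : State → Prop) (μ : State → ℕ) (hμ : μ s ≤ M)
    (h0 : I s)
    (step : ∀ s', Agree ws was ns nas s s' → I s' → c.holds s' →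
      WP M p (fun s'' => I s'' ∧ μ s'' < μ s') s')
    (hQ : ∀ s', Agree ws was ns nas s s' → I s' → ¬ c.holds s' → Q s') :
    WP M (.while c p) Q s := by
  obtain ⟨t, s', h1, h2, h3, h4⟩ := while_aux (p := p) (c := c)
    (I := fun s' => Agree ws was ns nas s s' ∧ I s') (μ := μ) (T := M ^ p.deg)
    (fun s' hI hc => by
      obtain ⟨t, s'', a1, a2, a3, a4⟩ := step s' hI.1 hI.2 hc
      exact ⟨t, s'', a1, a2, ⟨hI.1.trans (a1.agree hp), a3⟩, a4⟩)
    M s hμ ⟨Agree.refl s, h0⟩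
  refine ⟨t, s', h1, h2.trans ?_, hQ s' h3.1 h3.2 h4⟩
  have e0 := le_pow_self' hM c.cost
  have e1 : M ^ c.cost ≤ M ^ (c.cost + p.deg) :=
    Nat.pow_le_pow_right (by omega) (by omega)
  have e2 : M ^ p.deg ≤ M ^ (c.cost + p.deg) :=
    Nat.pow_le_pow_right (by omega) (by omega)
  have e3 : M ^ (c.cost + p.deg) * 2 ≤ M ^ (c.cost + p.deg + 1) := by
    rw [pow_succ]; exact Nat.mul_le_mul_left _ hM
  -- The three additional powers of `M` in the degree of a loop pay for adding the costs of test and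
  -- body, for the `M` iterations, and for the last test, which fails.
  have e4 : M * (c.cost + M ^ p.deg) ≤ M ^ (c.cost + p.deg + 2) := by
    rw [pow_succ, mul_comm _ M]; exact Nat.mul_le_mul_left _ (by omega)
  have e5 : M ^ (c.cost + p.deg + 2) * 2 ≤ M ^ (c.cost + p.deg + 3) := by
    rw [pow_succ]; exact Nat.mul_le_mul_left _ hM
  have e6 : M ^ c.cost ≤ M ^ (c.cost + p.deg + 2) :=
    Nat.pow_le_pow_right (by omega) (by omega)
  simp only [Prog.deg]
  omega

end WP

/-- `for i := 0, …, e - 1 do body` -/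
def Prog.forUp (i : ℕ) (e : WExpr) (body : Prog) : Prog :=
  .seq (.setW i (.lit 0))
    (.while (.not (.le e (.reg i))) (.seq body (.setW i (.add (.reg i) (.lit 1)))))

theorem Prog.within_forUp {ws was ns nas : List ℕ} {i : ℕ} {e : WExpr} {body : Prog} :
    (Prog.forUp i e body).within ws was ns nas =
      (decide (i ∈ ws) && body.within ws was ns nas) := by
  simp only [forUp, within]
  cases decide (i ∈ ws) <;> simp

theorem Prog.within_mono {ws was ns nas ws' was' ns' nas' : List ℕ} (h1 : ws ⊆ ws')
    (h2 : was ⊆ was') (h3 : ns ⊆ ns') (h4 : nas ⊆ nas') {p : Prog}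
    (h : p.within ws was ns nas = true) : p.within ws' was' ns' nas' = true := by
  induction p with
  | skip => rfl
  | setW i e => simp only [within, decide_eq_true_eq] at *; exact h1 h
  | putW i e => simp only [within, decide_eq_true_eq] at *; exact h2 h
  | setN i e => simp only [within, decide_eq_true_eq] at *; exact h3 h
  | putN i e => simp only [within, decide_eq_true_eq] at *; exact h4 h
  | seq p q ihp ihq => simp only [within, Bool.and_eq_true] at *; exact ⟨ihp h.1, ihq h.2⟩
  | ite c p q ihp ihq => simp only [within, Bool.and_eq_true] at *; exact ⟨ihp h.1, ihq h.2⟩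
  | _ c p ih => exact ih h

/-- The bound `e` is evaluated anew in every test, hence `he` for all states that the body can
produce. The invariant for `j + 1` refers to the state after the counter has been increased. -/
theorem WP.forUp {M : ℕ} (hM : 2 ≤ M) {i : ℕ} {e : WExpr} {body : Prog} {Q : State → Prop}
    {s : State} (ws was ns nas : List ℕ)
    (hb : body.within ws was ns nas = true ∧ i ∉ ws) (N : ℕ) (hN : N ≤ M)
    (he : ∀ s', Agree (i :: ws) was ns nas s s' → e.eval s' = N)
    (I : ℕ → State → Prop) (h0 : I 0 (s.setW i 0))
    (hs : ∀ j s', j < N → Agree (i :: ws) was ns nas s s' → s'.wreg i = j → I j s' →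
      WP M body (fun s'' => I (j + 1) (s''.setW i (j + 1))) s')
    (hQ : ∀ s', Agree (i :: ws) was ns nas s s' → I N s' → Q s') :
    WP M (.forUp i e body) Q s := by
  refine WP.seq hM (WP.setW hM ?_)
  have hA0 : Agree (i :: ws) was ns nas s (s.setW i 0) :=
    ⟨fun j hj => by rw [setW_wreg, if_neg (fun h => hj (by simp [h]))],
      fun _ _ => rfl, fun _ _ => rfl, fun _ _ => rfl⟩
  have hw : body.within (i :: ws) was ns nas = true :=
    Prog.within_mono (List.subset_cons_self i ws) (List.Subset.refl _) (List.Subset.refl _)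
      (List.Subset.refl _) hb.1
  refine WP.whileDo hM (i :: ws) was ns nas (by simp [Prog.within, hw])
    (fun s' => I (s'.wreg i) s' ∧ s'.wreg i ≤ N) (fun s' => N - s'.wreg i) (by simp [hN])
    (by simpa using h0) ?_ ?_
  · rintro s' hA ⟨hI, hle⟩ hc
    have hA' := hA0.trans hA
    simp only [Test.holds, WExpr.eval, he s' hA', not_le] at hc
    refine WP.seq hM (((hs _ s' hc hA' rfl hI).agree ws was ns nas hb.1).mono ?_)
    rintro s'' ⟨hA'', hI'⟩
    refine WP.setW hM ?_
    have : s''.wreg i = s'.wreg i := hA''.wreg i hb.2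
    simp only [WExpr.eval, setW_wreg, if_true, this]
    exact ⟨⟨hI', hc⟩, by omega⟩
  · rintro s' hA ⟨hI, hle⟩ hc
    have hA' := hA0.trans hA
    simp only [Test.holds, WExpr.eval, he s' hA', not_not] at hc
    have : s'.wreg i = N := le_antisymm hle hc
    exact hQ s' hA' (this ▸ hI)

end TutteTW

end

noncomputable section

namespace TutteTW

open Relation

/-! ### Components and their neighbourhoods -/

/-- `R` is a reflexive and symmetric relation on `{0, …, n - 1}`. -/
structure IsAdj (n : ℕ) (R : ℕ → ℕ → Prop) : Prop where
  lt : ∀ {u v}, R u v → u < n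
  symm : ∀ {u v}, R u v → R v u
  refl : ∀ {v}, v < n → R v v

/-- `v` can be reached from `r` by a path that avoids `P` after its start. -/
def Conn (R : ℕ → ℕ → Prop) (P : Set ℕ) (r v : ℕ) : Prop :=
  ReflTransGen (fun u v => R u v ∧ v ∉ P) r v

/-- The neighbours in `P` of the component of `r` outside of `P`. -/
def nb (R : ℕ → ℕ → Prop) (P : Set ℕ) (r : ℕ) : Set ℕ :=
  {u | u ∈ P ∧ ∃ c, Conn R P r c ∧ R c u}

theorem Conn.lt {n : ℕ} {R : ℕ → ℕ → Prop} (hR : IsAdj n R) {P : Set ℕ} {r v : ℕ} (hr : r < n)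
    (h : Conn R P r v) : v < n := by
  cases h with
  | refl => exact hr
  | tail _ h => exact hR.lt (hR.symm h.1)

/-- The arcs of `R` are listed in the word arrays `2` and `3`. -/
structure HasArcs (R : ℕ → ℕ → Prop) (n L : ℕ) (s : State) : Prop where
  n_eq : s.wreg 0 = n
  L_eq : s.wreg 2 = L
  iff : ∀ u v, R u v ↔ ∃ e < L, s.warr 2 e = u ∧ s.warr 3 e = v

theorem HasArcs.of_agree {R : ℕ → ℕ → Prop} {n L : ℕ} {s s' : State} (h : HasArcs R n L s)
    {ws was ns nas : List ℕ} (hA : Agree ws was ns nas s s')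
    (hk : (0 ∉ ws ∧ 2 ∉ ws) ∧ 2 ∉ was ∧ 3 ∉ was) : HasArcs R n L s' := by
  refine ⟨(hA.wreg 0 hk.1.1).trans h.n_eq, (hA.wreg 2 hk.1.2).trans h.L_eq, ?_⟩
  rw [hA.warr 2 hk.2.1, hA.warr 3 hk.2.2]
  exact h.iff

theorem HasArcs.rel {R : ℕ → ℕ → Prop} {n L : ℕ} {s : State} (h : HasArcs R n L s) {e : ℕ}
    (he : e < L) : R (s.warr 2 e) (s.warr 3 e) :=
  (h.iff _ _).2 ⟨e, he, rfl, rfl⟩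

/-- The number of zeros among the first `n` values of `f`. -/
def zeros (n : ℕ) (f : ℕ → ℕ) : ℕ := ((Finset.range n).filter fun v => f v = 0).card

theorem zeros_le (n : ℕ) (f : ℕ → ℕ) : zeros n f ≤ n :=
  (Finset.card_filter_le _ _).trans (by simp)

/-- The source of termination for the loops that let a set of marked vertices grow. -/
theorem zeros_update_lt {n : ℕ} {f : ℕ → ℕ} {v w : ℕ} (hv : v < n) (hf : f v = 0) (hw : w ≠ 0) :
    zeros n (Function.update f v w) < zeros n f := by
  refine Finset.card_lt_card (Finset.ssubset_iff_of_subset ?_ |>.2 ⟨v, by simp [hv, hf], by simp [hw]⟩)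
  intro u hu
  simp only [Finset.mem_filter, Finset.mem_range, Function.update_apply] at hu ⊢
  split_ifs at hu with h
  · exact absurd hu.2 hw
  · exact hu

/-- Marks in the arrays `5` and `6` the component of the vertex in register `12` outside of the
vertices marked in array `4`, and its neighbourhood. -/
def compProg : Prog :=
  .seq (.forUp 3 (.reg 0) (.seq (.putW 5 (.reg 3) (.lit 0)) (.putW 6 (.reg 3) (.lit 0)))) <|
  .seq (.putW 5 (.reg 12) (.lit 1)) <|
  .seq (.setW 10 (.lit 1)) <|
  .seq (.while (.eq (.reg 10) (.lit 1)) (.seq (.setW 10 (.lit 0)) (.forUp 3 (.reg 2)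
    (.ite (.and (.not (.eq (.get 5 (.get 2 (.reg 3))) (.lit 0)))
        (.and (.eq (.get 4 (.get 3 (.reg 3))) (.lit 0))
          (.eq (.get 5 (.get 3 (.reg 3))) (.lit 0))))
      (.seq (.putW 5 (.get 3 (.reg 3)) (.lit 1)) (.setW 10 (.lit 1))) .skip)))) <|
  .forUp 3 (.reg 2)
    (.ite (.and (.not (.eq (.get 5 (.get 2 (.reg 3))) (.lit 0)))
        (.not (.eq (.get 4 (.get 3 (.reg 3))) (.lit 0))))
      (.putW 6 (.get 3 (.reg 3)) (.lit 1)) .skip)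

/-- All arcs are scanned again and again until a scan marks nothing new. The marked set then
contains `r`, consists of reachable vertices and is closed under the admissible arcs, so it is the
whole component. -/
theorem compProg_spec {M n L r : ℕ} {R : ℕ → ℕ → Prop} {s : State} (hM : n + L + 2 ≤ M)
    (hR : IsAdj n R) (hs : HasArcs R n L s) (hr : s.wreg 12 = r) (_ : r < n) :
    WP M compProg (fun s' => Agree [3, 10] [5, 6] [] [] s s' ∧
      (∀ v < n, s'.warr 5 v ≠ 0 ↔ Conn R {u | s.warr 4 u ≠ 0} r v) ∧
      (∀ v < n, s'.warr 6 v ≠ 0 ↔ v ∈ nb R {u | s.warr 4 u ≠ 0} r)) s := by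
  have hM2 : 2 ≤ M := by omega
  refine WP.agree _ _ _ _ (by decide) ?_
  set P : Set ℕ := {u | s.warr 4 u ≠ 0} with hP
  refine WP.seq hM2 ?_
  refine WP.forUp hM2 [] [5, 6] [] [] (by decide) n (by omega)
    (fun s' h => by simp [h.wreg, hs.n_eq])
    (fun j s' => ∀ v < j, s'.warr 5 v = 0 ∧ s'.warr 6 v = 0) (by simp) ?_ ?_
  · intro j s' hj hA hi hI
    refine WP.seq hM2 (WP.putW hM2 (WP.putW hM2 ?_))
    intro v hv
    rcases Nat.lt_succ_iff_lt_or_eq.1 hv with h | h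
    · simp [hi, h.ne, hI v h]
    · simp [hi, h]
  intro s1 hA1 hI1
  have hs1 := hs.of_agree hA1 (by decide)
  refine WP.seq hM2 (WP.putW hM2 (WP.seq hM2 (WP.setW hM2 (WP.seq hM2 ?_))))
  simp only [WExpr.eval, hA1.wreg 12 (by decide), hr]
  set s2 := (s1.putW 5 r 1).setW 10 1 with hs2
  have hA2 : Agree [3, 10] [5, 6] [] [] s s2 := by
    constructor <;> intro i hi <;> simp only [List.mem_cons, List.not_mem_nil, not_or] at hi
    · simp [hs2, hi, hA1.wreg]
    · simp [hs2, hi, hA1.warr]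
    · simp [hs2, hA1.nreg]
    · simp [hs2, hA1.narr]
  refine WP.whileDo hM2 [3, 10] [5] [] [] (by decide)
    (fun s' => (∀ v < n, s'.warr 5 v ≠ 0 → Conn R P r v) ∧ s'.warr 5 r ≠ 0 ∧ s'.wreg 10 ≤ 1 ∧
      (s'.wreg 10 = 0 → ∀ e < L, s'.warr 5 (s.warr 2 e) ≠ 0 → s.warr 4 (s.warr 3 e) = 0 →
        s'.warr 5 (s.warr 3 e) ≠ 0))
    -- Register `10` is `1` at the start of every scan. A scan either marks a vertex, which lowers
    -- `zeros`, or leaves the register at `0`, so the sum drops in both cases.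
    (fun s' => zeros n (s'.warr 5) + s'.wreg 10) ?_ ?_ ?_ ?_
  · have := zeros_le n (s2.warr 5)
    simp only [hs2, setW_wreg, if_true] at this ⊢
    omega
  · refine ⟨?_, by simp [hs2], by simp [hs2], by simp [hs2]⟩
    intro v hv hne
    by_cases hvr : v = r
    · rw [hvr]; exact ReflTransGen.refl
    · simp [hs2, hvr, (hI1 v hv).1] at hne
  · rintro s3 hA3 ⟨h1, h2, h3, -⟩ hc
    simp only [Test.holds, WExpr.eval] at hc
    refine WP.seq hM2 (WP.setW hM2 ?_)
    refine WP.forUp hM2 [10] [5] [] [] (by decide) L (by omega)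
      (fun s' h => by simp [h.wreg, hA3.wreg, hA2.wreg, hs.L_eq])
      (fun j s' => (∀ v < n, s'.warr 5 v ≠ 0 → Conn R P r v) ∧ s'.warr 5 r ≠ 0 ∧ s'.wreg 10 ≤ 1 ∧
      (s'.wreg 10 = 0 → ∀ e < j, s'.warr 5 (s.warr 2 e) ≠ 0 → s.warr 4 (s.warr 3 e) = 0 →
        s'.warr 5 (s.warr 3 e) ≠ 0) ∧
      zeros n (s'.warr 5) + s'.wreg 10 ≤ zeros n (s3.warr 5)) ?_ ?_ ?_
    · exact ⟨h1, h2, by simp, by simp, by simp⟩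
    · rintro j s4 hj hA4 hi ⟨i1, i2, i3, i4, i5⟩
      have e2 : s4.warr 2 = s.warr 2 := by simp [hA4.warr, hA3.warr, hA2.warr]
      have e3 : s4.warr 3 = s.warr 3 := by simp [hA4.warr, hA3.warr, hA2.warr]
      have e4 : s4.warr 4 = s.warr 4 := by simp [hA4.warr, hA3.warr, hA2.warr]
      refine WP.ite hM2 ?_ ?_
      · intro hc
        simp only [Test.holds, WExpr.eval, e2, e3, e4, hi] at hc
        refine WP.seq hM2 (WP.putW hM2 (WP.setW hM2 ?_))
        have hrel := hs.rel hj
        have hz := zeros_update_lt (hR.lt (hR.symm hrel)) hc.2.2 one_ne_zero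
        simp only [WExpr.eval, setW_warr, putW_warr, setW_wreg, e3, hi, if_true,
          Function.update_apply]
        refine ⟨?_, ?_, by simp, by simp, by simp; omega⟩
        · intro v hv hne
          split_ifs at hne with h
          · rw [h]
            exact (i1 _ (hR.lt hrel) hc.1).tail ⟨hrel, by simp [hP, hc.2.1]⟩
          · exact i1 v hv hne
        · split_ifs
          · simp
          · exact i2
      · intro hc
        simp only [Test.holds, WExpr.eval, e2, e3, e4, hi] at hc
        refine WP.skip hM2 ⟨i1, i2, by simpa using i3, ?_, by simpa using i5⟩
        simp only [setW_wreg, setW_warr]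
        intro h0 e he
        rcases Nat.lt_succ_iff_lt_or_eq.1 he with h | h
        · exact i4 (by simpa using h0) e h
        · subst h
          intro ha hb hcc
          exact hc ⟨ha, hb, hcc⟩
    · rintro s' hA' ⟨i1, i2, i3, i4, i5⟩
      exact ⟨⟨i1, i2, i3, i4⟩, by omega⟩
  rintro s3 hA3 ⟨h1, h2, h3, h4⟩ hc
  simp only [Test.holds, WExpr.eval] at hc
  replace h4 := h4 (by omega)
  have hA3' := hA2.trans (ws := [3, 10]) (was := [5, 6])
    ⟨hA3.wreg, fun A hA => hA3.warr A (fun h => hA (by simp at h; simp [h])), hA3.nreg, hA3.narr⟩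
  have hcomp : ∀ v < n, s3.warr 5 v ≠ 0 ↔ Conn R P r v := by
    intro v hv
    refine ⟨h1 v hv, fun h => ?_⟩
    induction h with
    | refl => exact h2
    | tail _ h ih =>
      obtain ⟨e, he, rfl, rfl⟩ := (hs.iff _ _).1 h.1
      exact h4 e he (ih (hR.lt h.1)) (by simpa [hP] using h.2)
  refine WP.forUp hM2 [] [6] [] [] (by decide) L (by omega)
    (fun s' h => by simp [h.wreg, hA3'.wreg, hs.L_eq])
    (fun j s' => ∀ v < n, s'.warr 6 v ≠ 0 ↔ ∃ e < j, s.warr 3 e = v ∧ v ∈ P ∧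
      Conn R P r (s.warr 2 e)) ?_ ?_ ?_
  · intro v hv
    have : s3.warr 6 = s1.warr 6 := by rw [hA3.warr 6 (by decide)]; simp [hs2]
    simp [this, (hI1 v hv).2]
  · intro j s4 hj hA4 hi hI
    have e2 : s4.warr 2 = s.warr 2 := by simp [hA4.warr, hA3'.warr]
    have e3 : s4.warr 3 = s.warr 3 := by simp [hA4.warr, hA3'.warr]
    have e4 : s4.warr 4 = s.warr 4 := by simp [hA4.warr, hA3'.warr]
    have e5 : s4.warr 5 = s3.warr 5 := by simp [hA4.warr]
    have hrel := hs.rel hj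
    refine WP.ite hM2 ?_ ?_
    · intro hc
      simp only [Test.holds, WExpr.eval, e2, e3, e4, e5, hi] at hc
      refine WP.putW hM2 ?_
      simp only [WExpr.eval, setW_warr, putW_warr, if_true, e3, hi, Function.update_apply]
      intro v hv
      split_ifs with h
      · simp only [ne_eq, one_ne_zero, not_false_eq_true, true_iff]
        exact ⟨j, by omega, h.symm, by rw [h]; exact hc.2, (hcomp _ (hR.lt hrel)).1 hc.1⟩
      · rw [hI v hv]
        constructor
        · rintro ⟨e, he, h⟩; exact ⟨e, by omega, h⟩
        · rintro ⟨e, he, h'⟩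
          refine ⟨e, ?_, h'⟩
          rcases Nat.lt_succ_iff_lt_or_eq.1 he with h'' | rfl
          · exact h''
          · exact absurd h'.1.symm h
    · intro hc
      simp only [Test.holds, WExpr.eval, e2, e3, e4, e5, hi] at hc
      refine WP.skip hM2 ?_
      intro v hv
      simp only [setW_warr]
      rw [hI v hv]
      constructor
      · rintro ⟨e, he, h⟩; exact ⟨e, by omega, h⟩
      · rintro ⟨e, he, h'⟩
        refine ⟨e, ?_, h'⟩
        rcases Nat.lt_succ_iff_lt_or_eq.1 he with h'' | rfl
        · exact h''
        · refine absurd ⟨(hcomp _ (hR.lt hrel)).2 h'.2.2, ?_⟩ hc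
          have := h'.2.1
          rw [← h'.1] at this
          exact this
  · intro s4 hA4 hI
    have e5 : s4.warr 5 = s3.warr 5 := by simp [hA4.warr]
    rw [e5]
    refine ⟨hcomp, fun v hv => ?_⟩
    rw [hI v hv]
    constructor
    · rintro ⟨e, he, h1, h2, h3⟩
      exact ⟨h2, _, h3, h1 ▸ hs.rel he⟩
    · rintro ⟨h1, c, h2, h3⟩
      obtain ⟨e, he, rfl, rfl⟩ := (hs.iff _ _).1 h3
      exact ⟨e, he, rfl, h1, h2⟩

end TutteTW

end

noncomputable section

namespace TutteTW

/-! ### Lists, powers and digits -/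

/-- `l` enumerates without repetitions the `v < n` with `W v ≠ 0`, and `k` is their number. -/
structure IsEnum (n : ℕ) (W l : ℕ → ℕ) (k : ℕ) : Prop where
  lt : ∀ t < k, l t < n
  mem : ∀ t < k, W (l t) ≠ 0
  inj : ∀ t < k, ∀ t' < k, l t = l t' → t = t'
  surj : ∀ v < n, W v ≠ 0 → ∃ t < k, l t = v

theorem IsEnum.card_eq {n : ℕ} {W l : ℕ → ℕ} {k : ℕ} (h : IsEnum n W l k) :
    k = ((Finset.range n).filter fun v => W v ≠ 0).card := by
  rw [← Finset.card_range k]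
  refine Finset.card_bij (fun t _ => l t) ?_ ?_ ?_
  · intro t ht
    rw [Finset.mem_range] at ht
    simp [h.lt t ht, h.mem t ht]
  · intro t ht t' ht' he
    exact h.inj t (Finset.mem_range.1 ht) t' (Finset.mem_range.1 ht') he
  · intro v hv
    simp only [Finset.mem_filter, Finset.mem_range] at hv
    obtain ⟨t, ht, h'⟩ := h.surj v hv.1 hv.2
    exact ⟨t, Finset.mem_range.2 ht, h'⟩

/-- Lists in array `7` the vertices marked in array `6`; their number goes to register `13`. -/
def listProg : Prog :=
  .seq (.setW 13 (.lit 0)) <|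
  .forUp 3 (.reg 0) (.ite (.eq (.get 6 (.reg 3)) (.lit 0)) .skip
    (.seq (.putW 7 (.reg 13) (.reg 3)) (.setW 13 (.add (.reg 13) (.lit 1)))))

theorem listProg_spec {M n : ℕ} {s : State} (hM : n + 2 ≤ M) (hn : s.wreg 0 = n) :
    WP M listProg (fun s' => Agree [3, 13] [7] [] [] s s' ∧
      IsEnum n (s.warr 6) (s'.warr 7) (s'.wreg 13)) s := by
  have hM2 : 2 ≤ M := by omega
  refine WP.agree _ _ _ _ (by decide) ?_
  refine WP.seq hM2 (WP.setW hM2 ?_)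
  refine WP.forUp hM2 [13] [7] [] [] (by decide) n (by omega)
    (fun s' h => by simp [h.wreg, hn])
    (fun j s' => IsEnum j (s.warr 6) (s'.warr 7) (s'.wreg 13)) ?_ ?_ ?_
  · constructor <;> simp
  · intro j s' hj hA hi hI
    have e6 : s'.warr 6 = s.warr 6 := by simp [hA.warr]
    refine WP.ite hM2 ?_ ?_
    · intro hc
      simp only [Test.holds, WExpr.eval, e6, hi] at hc
      refine WP.skip hM2 ?_
      simp only [setW_warr, setW_wreg]
      refine ⟨fun t ht => ?_, fun t ht => hI.mem t (by simpa using ht),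
        fun t ht t' ht' => hI.inj t (by simpa using ht) t' (by simpa using ht'), ?_⟩
      · have := hI.lt t (by simpa using ht)
        omega
      · intro v hv hne
        rcases Nat.lt_succ_iff_lt_or_eq.1 hv with h | h
        · simpa using hI.surj v h hne
        · exact absurd (h ▸ hc) hne
    · intro hc
      simp only [Test.holds, WExpr.eval, e6, hi] at hc
      refine WP.seq hM2 (WP.putW hM2 (WP.setW hM2 ?_))
      simp only [setW_warr, setW_wreg, putW_warr, WExpr.eval, hi, putW_wreg, if_true,
        Nat.reduceEqDiff, reduceIte]
      set k := s'.wreg 13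
      refine ⟨?_, ?_, ?_, ?_⟩ <;> simp only [Function.update_apply]
      · intro t ht
        split_ifs with h
        · omega
        · have := hI.lt t (by omega)
          omega
      · intro t ht
        split_ifs with h
        · exact hc
        · exact hI.mem t (by omega)
      · intro t ht t' ht'
        split_ifs with h h' h'
        · omega
        · have := hI.lt t' (by omega)
          omega
        · have := hI.lt t (by omega)
          omega
        · exact hI.inj t (by omega) t' (by omega)
      · intro v hv hne
        rcases Nat.lt_succ_iff_lt_or_eq.1 hv with h | h
        · obtain ⟨t, ht, rfl⟩ := hI.surj v h hne
          exact ⟨t, by omega, by rw [if_neg (by omega)]⟩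
        · exact ⟨k, by omega, by simp [h]⟩
  · intro s' hA hI
    exact hI

/-- Computes in register `15` the power of register `14` by register `13`. -/
def powProg : Prog :=
  .seq (.setW 15 (.lit 1)) <|
  .forUp 3 (.reg 13) (.seq (.setW 17 (.lit 0)) (.seq
    (.forUp 4 (.reg 14) (.setW 17 (.add (.reg 17) (.reg 15)))) (.setW 15 (.reg 17))))

/-- Words cannot be multiplied, so each factor `p` is realised by `p` additions. Only `k` and `p`
have to be at most `M`, not the power itself. -/
theorem powProg_spec {M k p : ℕ} {s : State} (hM2 : 2 ≤ M) (hk : k ≤ M) (hp : p ≤ M)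
    (hsk : s.wreg 13 = k) (hsp : s.wreg 14 = p) :
    WP M powProg (fun s' => Agree [3, 4, 15, 17] [] [] [] s s' ∧ s'.wreg 15 = p ^ k) s := by
  refine WP.agree _ _ _ _ (by decide) ?_
  refine WP.seq hM2 (WP.setW hM2 ?_)
  refine WP.forUp hM2 [4, 15, 17] [] [] [] (by decide) k hk
    (fun s' h => by simp [h.wreg, hsk])
    (fun j s' => s'.wreg 15 = p ^ j) (by simp) ?_ (fun _ _ h => h)
  intro j s' hj hA hi hI
  refine WP.seq hM2 (WP.setW hM2 (WP.seq hM2 ?_))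
  refine WP.forUp hM2 [17] [] [] [] (by decide) p hp
    (fun s' h => by simp [h.wreg, hA.wreg, hsp])
    (fun j' s'' => s''.wreg 17 = j' * p ^ j) (by simp) ?_ ?_
  · intro j' s'' hj' hA' hi' hI'
    refine WP.setW hM2 ?_
    simp [hI', hA'.wreg, hI]
    ring
  · intro s'' hA' hI'
    refine WP.setW hM2 ?_
    simp [hI', pow_succ, mul_comm]

/-- Writes the digits in base `p` of register `16` to the entries of array `8` listed in
array `7`, where `p` is in register `14`. -/
def digitsProg : Prog :=
  .seq (.setW 17 (.reg 16)) <|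
  .forUp 3 (.reg 13) <| .seq (.setW 4 (.lit 0)) <|
  .seq (.while (.le (.reg 14) (.reg 17)) (.seq (.setW 17 (.sub (.reg 17) (.reg 14)))
    (.setW 4 (.add (.reg 4) (.lit 1))))) <|
  .seq (.putW 8 (.get 7 (.reg 3)) (.reg 17)) (.setW 17 (.reg 4))

theorem digitsProg_spec {M k p x : ℕ} {s : State} (hM2 : 2 ≤ M) (hk : k ≤ M) (hx : x ≤ M)
    (hp : 0 < p) (hsk : s.wreg 13 = k) (hsp : s.wreg 14 = p) (hsx : s.wreg 16 = x)
    (hinj : ∀ t < k, ∀ t' < k, s.warr 7 t = s.warr 7 t' → t = t') :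
    WP M digitsProg (fun s' => Agree [3, 4, 17] [8] [] [] s s' ∧
      ∀ t < k, s'.warr 8 (s.warr 7 t) = x / p ^ t % p) s := by
  refine WP.agree _ _ _ _ (by decide) ?_
  refine WP.seq hM2 (WP.setW hM2 ?_)
  refine WP.forUp hM2 [4, 17] [8] [] [] (by decide) k hk
    (fun s' h => by simp [h.wreg, hsk])
    (fun j s' => s'.wreg 17 = x / p ^ j ∧ ∀ t < j, s'.warr 8 (s.warr 7 t) = x / p ^ t % p)
    (by simp [hsx]) ?_ (fun _ _ h => h.2)
  rintro j s' hj hA hi ⟨hI1, hI2⟩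
  refine WP.seq hM2 (WP.setW hM2 (WP.seq hM2 ?_))
  have hxj : x / p ^ j ≤ M := (Nat.div_le_self _ _).trans hx
  -- Division with remainder by repeated subtraction: register `4` collects the quotient, and
  -- register `17` shrinks to the remainder, which is the next digit.
  refine WP.whileDo hM2 [4, 17] [] [] [] (by decide)
    (fun s'' => s''.wreg 17 + p * s''.wreg 4 = x / p ^ j) (fun s'' => s''.wreg 17) (by simp [hI1, hxj])
    (by simp [hI1]) ?_ ?_
  · intro s'' hA' hI' hc
    simp [hA'.wreg, hA.wreg, hsp] at hc
    refine WP.seq hM2 (WP.setW hM2 (WP.setW hM2 ?_))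
    simp [hA'.wreg, hA.wreg, hsp]
    refine ⟨?_, by omega, hp⟩
    rw [← hI', mul_add]
    omega
  · intro s'' hA' hI' hc
    simp [hA'.wreg, hA.wreg, hsp] at hc
    refine WP.seq hM2 (WP.putW hM2 (WP.setW hM2 ?_))
    have h1 : s''.wreg 17 = x / p ^ j % p := by
      rw [← hI', Nat.add_mul_mod_self_left, Nat.mod_eq_of_lt hc]
    have h2 : s''.wreg 4 = x / p ^ (j + 1) := by
      rw [pow_succ, ← Nat.div_div_eq_div_mul, ← hI', Nat.add_mul_div_left _ _ hp,
        Nat.div_eq_of_lt hc, zero_add]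
    simp only [setW_warr, setW_wreg, putW_warr, WExpr.eval, putW_wreg, if_true,
        Nat.reduceEqDiff, reduceIte, Function.update_apply]
    have e7 : s''.warr 7 = s.warr 7 := by simp [hA'.warr, hA.warr]
    have e8 : s''.warr 8 = s'.warr 8 := by simp [hA'.warr]
    have e3 : s''.wreg 3 = j := by simp [hA'.wreg, hi]
    rw [e7, e8, e3]
    refine ⟨h2, fun t ht => ?_⟩
    split_ifs with h
    · rw [hinj t (by omega) j (by omega) h, h1]
    · refine hI2 t ?_
      rcases Nat.lt_succ_iff_lt_or_eq.1 ht with h' | rfl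
      · exact h'
      · exact absurd rfl h

/-- Every sequence of digits is spelled by some counter value below `p ^ k`. This makes a counting
loop an enumeration of all subsets (`p = 2`) or of all colourings of a list of vertices. -/
theorem exists_digits {p : ℕ} (hp : 0 < p) (k : ℕ) (f : ℕ → ℕ) (hf : ∀ t < k, f t < p) :
    ∃ x < p ^ k, ∀ t < k, x / p ^ t % p = f t := by
  induction k generalizing f with
  | zero => exact ⟨0, by simp, by simp⟩
  | succ k ih =>
    obtain ⟨x, hx, h⟩ := ih (fun t => f (t + 1)) (fun t ht => hf _ (by omega))
    have h0 := hf 0 (by omega)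
    refine ⟨p * x + f 0, ?_, ?_⟩
    · rw [pow_succ]
      calc p * x + f 0 < p * x + p := by omega
        _ = p * (x + 1) := by ring
        _ ≤ p * p ^ k := Nat.mul_le_mul_left _ hx
        _ = _ := by ring
    · intro t ht
      rcases t with _ | t
      · simp [Nat.mod_eq_of_lt h0]
      · rw [pow_succ', ← Nat.div_div_eq_div_mul, Nat.mul_add_div hp, Nat.div_eq_of_lt h0, add_zero]
        exact h t (by omega)

end TutteTW

end

noncomputable section

namespace TutteTW

/-! ### Bipartite matching -/

/-- `ml` and `mt` describe a matching along `R` between vertices marked by `LS` and vertices marked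
by `RS`; the value `0` means unmatched, and `v + 1` matched to `v`. -/
structure IsMatch (n : ℕ) (R : ℕ → ℕ → Prop) (LS RS ml mt : ℕ → ℕ) : Prop where
  left : ∀ x y, x < n → ml x = y + 1 → LS x ≠ 0 ∧ RS y ≠ 0 ∧ R x y ∧ mt y = x + 1
  right : ∀ y x, y < n → mt y = x + 1 → x < n ∧ ml x = y + 1

/-- The state of a search for an augmenting path: `RL` and `RR` mark the vertices on the left and on
the right that were reached, `pr` points to predecessors, `rk` bounds the distances. -/
structure IsSearch (n : ℕ) (R : ℕ → ℕ → Prop) (LS RS ml mt RL RR pr rk : ℕ → ℕ) (endp : ℕ) :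
    Prop where
  right : ∀ v < n, RR v ≠ 0 → RS v ≠ 0 ∧ pr v < n ∧ RL (pr v) ≠ 0 ∧ R (pr v) v ∧
    rk v + zeros n RR < n
  pred : ∀ v < n, RR v ≠ 0 → ml (pr v) = 0 ∨
    ∃ w < n, ml (pr v) = w + 1 ∧ RR w ≠ 0 ∧ rk w < rk v
  left : ∀ x < n, RL x ≠ 0 → LS x ≠ 0 ∧ (ml x = 0 ∨ ∃ w < n, ml x = w + 1 ∧ RR w ≠ 0)
  free : ∀ x < n, LS x ≠ 0 → ml x = 0 → RL x ≠ 0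
  mate : ∀ v < n, RR v ≠ 0 → ∀ x, mt v = x + 1 → RL x ≠ 0
  unmatched : ∀ v < n, RR v ≠ 0 → mt v = 0 → endp ≠ 0
  endp_spec : ∀ z, endp = z + 1 → z < n ∧ RR z ≠ 0 ∧ mt z = 0

/-- Search for an augmenting path; register `19` becomes `0`, or its end plus one. -/
def searchProg : Prog :=
  .seq (.forUp 3 (.reg 0) (.seq
    (.ite (.and (.not (.eq (.get 9 (.reg 3)) (.lit 0))) (.eq (.get 11 (.reg 3)) (.lit 0)))
      (.putW 13 (.reg 3) (.lit 1)) (.putW 13 (.reg 3) (.lit 0)))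
    (.putW 14 (.reg 3) (.lit 0)))) <|
  .seq (.setW 19 (.lit 0)) <|
  .seq (.setW 10 (.lit 1)) <|
  .while (.eq (.reg 10) (.lit 1)) (.seq (.setW 10 (.lit 0)) (.forUp 3 (.reg 2)
    (.ite (.and (.not (.eq (.get 13 (.get 2 (.reg 3))) (.lit 0)))
        (.and (.not (.eq (.get 10 (.get 3 (.reg 3))) (.lit 0)))
          (.eq (.get 14 (.get 3 (.reg 3))) (.lit 0))))
      (.seq (.setW 10 (.lit 1)) (.seq (.putW 15 (.get 3 (.reg 3)) (.get 2 (.reg 3)))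
        (.seq (.putW 14 (.get 3 (.reg 3)) (.lit 1))
          (.ite (.eq (.get 12 (.get 3 (.reg 3))) (.lit 0))
            (.setW 19 (.add (.get 3 (.reg 3)) (.lit 1)))
            (.putW 13 (.sub (.get 12 (.get 3 (.reg 3))) (.lit 1)) (.lit 1)))))) .skip)))

/-- Reaching `v` on the right also reaches its mate on the left. The new rank is `0` if `u` is free,
and one more than the rank of the mate of `u` otherwise. Since the number of unreached right
vertices falls at the same time, rank plus this number stays below `n`. Ranks are not computed by
the program; they serve to prove that augmentation terminates. -/
theorem IsSearch.extend {n : ℕ} {R : ℕ → ℕ → Prop} (hR : IsAdj n R)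
    {LS RS ml mt RL RR pr rk : ℕ → ℕ} {endp : ℕ} (hm : IsMatch n R LS RS ml mt)
    (h : IsSearch n R LS RS ml mt RL RR pr rk endp) {u v : ℕ} (huv : R u v) (hu : RL u ≠ 0)
    (hv : RS v ≠ 0) (hRR : RR v = 0) :
    ∃ rk', IsSearch n R LS RS ml mt
      (if mt v = 0 then RL else Function.update RL (mt v - 1) 1)
      (Function.update RR v 1) (Function.update pr v u) rk'
      (if mt v = 0 then v + 1 else endp) := by
  have hun := hR.lt huv
  have hvn := hR.lt (hR.symm huv)
  have hz := zeros_update_lt hvn hRR one_ne_zero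
  have hzn := zeros_le n RR
  have hRL : ∀ x, RL x ≠ 0 → (if mt v = 0 then RL else Function.update RL (mt v - 1) 1) x ≠ 0 := by
    intro x hx
    split_ifs
    · exact hx
    · rw [Function.update_apply]; split_ifs <;> simp [hx]
  have hRR' : ∀ w, RR w ≠ 0 → Function.update RR v 1 w ≠ 0 ∧ w ≠ v := by
    intro w hw
    have : w ≠ v := by rintro rfl; exact hw hRR
    simp [this, hw]
  have huL := (h.left u hun hu).2
  obtain ⟨d, hd, hd'⟩ : ∃ d, d + zeros n (Function.update RR v 1) < n ∧
      (ml u = 0 ∨ ∃ w < n, ml u = w + 1 ∧ RR w ≠ 0 ∧ rk w < d) := by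
    rcases huL with h0 | ⟨w, hw, h1, h2⟩
    · exact ⟨0, by omega, Or.inl h0⟩
    · have := (h.right w hw h2).2.2.2.2
      exact ⟨rk w + 1, by omega, Or.inr ⟨w, hw, h1, h2, by omega⟩⟩
  refine ⟨Function.update rk v d, ?_, ?_, ?_, ?_, ?_, ?_, ?_⟩
  · intro w hw hne
    by_cases hwv : w = v
    · subst hwv
      simp only [Function.update_self]
      exact ⟨hv, hun, hRL u hu, huv, hd⟩
    · simp only [Function.update_of_ne hwv] at hne ⊢
      obtain ⟨a, b, c, d, e⟩ := h.right w hw hne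
      exact ⟨a, b, hRL _ c, d, by omega⟩
  · intro w hw hne
    by_cases hwv : w = v
    · subst hwv
      simp only [Function.update_self]
      rcases hd' with h0 | ⟨y, hy, h1, h2, h3⟩
      · exact Or.inl h0
      · have := hRR' y h2
        refine Or.inr ⟨y, hy, h1, this.1, ?_⟩
        rwa [Function.update_of_ne this.2]
    · simp only [Function.update_of_ne hwv] at hne ⊢
      rcases h.pred w hw hne with h0 | ⟨y, hy, h1, h2, h3⟩
      · exact Or.inl h0
      · have := hRR' y h2
        refine Or.inr ⟨y, hy, h1, this.1, ?_⟩
        rwa [Function.update_of_ne this.2]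
  · intro x hx hne
    by_cases hxR : RL x ≠ 0
    · obtain ⟨a, b⟩ := h.left x hx hxR
      refine ⟨a, b.imp_right ?_⟩
      rintro ⟨w, hw, h1, h2⟩
      exact ⟨w, hw, h1, (hRR' w h2).1⟩
    · split_ifs at hne with hmt
      · exact absurd hne hxR
      · have hxe : x = mt v - 1 := by
          by_contra hcon
          rw [Function.update_of_ne hcon] at hne
          exact hxR hne
        have h2 := hm.right v x hvn (by omega)
        refine ⟨(hm.left x v hx h2.2).1, Or.inr ⟨v, hvn, h2.2, by simp⟩⟩
  · exact fun x hx h1 h2 => hRL x (h.free x hx h1 h2)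
  · intro w hw hne x hx
    by_cases hwv : w = v
    · subst hwv
      simp [hx]
    · rw [Function.update_of_ne hwv] at hne
      exact hRL x (h.mate w hw hne x hx)
  · intro w hw hne hmt
    by_cases hwv : w = v
    · subst hwv
      simp [hmt]
    · rw [Function.update_of_ne hwv] at hne
      have := h.unmatched w hw hne hmt
      split_ifs <;> simp [this]
  · intro z hz
    split_ifs at hz with hmt
    · obtain rfl : z = v := by omega
      exact ⟨hvn, by simp, hmt⟩
    · obtain ⟨a, b, c⟩ := h.endp_spec z hz
      exact ⟨a, (hRR' z b).1, c⟩

/-- The search is not stopped at the first free vertex on the right but saturates. The resulting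
closure, the last conclusion, is what turns an unsuccessful search into a violation of Hall's
condition. -/
theorem searchProg_spec {M n L : ℕ} {R : ℕ → ℕ → Prop} {s : State} (hM : n + L + 2 ≤ M)
    (hR : IsAdj n R) (hs : HasArcs R n L s)
    (hm : IsMatch n R (s.warr 9) (s.warr 10) (s.warr 11) (s.warr 12)) :
    WP M searchProg (fun s' => Agree [3, 10, 19] [13, 14, 15] [] [] s s' ∧
      (∃ rk, IsSearch n R (s.warr 9) (s.warr 10) (s.warr 11) (s.warr 12) (s'.warr 13) (s'.warr 14)
        (s'.warr 15) rk (s'.wreg 19)) ∧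
      ∀ u v, R u v → s'.warr 13 u ≠ 0 → s.warr 10 v ≠ 0 → s'.warr 14 v ≠ 0) s := by
  have hM2 : 2 ≤ M := by omega
  refine WP.agree _ _ _ _ (by decide) ?_
  refine WP.seq hM2 ?_
  refine WP.forUp hM2 [] [13, 14] [] [] (by decide) n (by omega)
    (fun s' h => by simp [h.wreg, hs.n_eq])
    (fun j s' => ∀ v < j, s'.warr 13 v = (if s.warr 9 v ≠ 0 ∧ s.warr 11 v = 0 then 1 else 0) ∧
      s'.warr 14 v = 0) (by simp) ?_ ?_
  · intro j s' hj hA hi hI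
    refine WP.seq hM2 (WP.ite hM2 ?_ ?_) <;> intro hc <;>
      simp only [Test.holds, WExpr.eval, hi, hA.warr 9 (by decide), hA.warr 11 (by decide)] at hc <;>
      refine WP.putW hM2 (WP.putW hM2 ?_) <;> intro v hv <;>
      rcases Nat.lt_succ_iff_lt_or_eq.1 hv with h | h
    · simp [hi, h.ne, hI v h]
    · subst h; simp [hi, hc]
    · simp [hi, h.ne, hI v h]
    · subst h
      rw [if_neg hc]
      simp [hi]
  intro s1 hA1 hI1
  refine WP.seq hM2 (WP.setW hM2 (WP.seq hM2 (WP.setW hM2 ?_)))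
  simp only [WExpr.eval]
  set s2 := (s1.setW 19 0).setW 10 1 with hs2
  have hA2 : Agree [3, 10, 19] [13, 14, 15] [] [] s s2 := by
    constructor <;> intro i hi <;> simp only [List.mem_cons, List.not_mem_nil, not_or] at hi
    · simp [hs2, hi, hA1.wreg]
    · simp [hs2, hi, hA1.warr]
    · simp [hs2, hA1.nreg]
    · simp [hs2, hA1.narr]
  let J : State → Prop := fun s' => s'.wreg 10 ≤ 1 ∧
    ∃ rk, IsSearch n R (s.warr 9) (s.warr 10) (s.warr 11) (s.warr 12) (s'.warr 13) (s'.warr 14)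
      (s'.warr 15) rk (s'.wreg 19)
  refine WP.whileDo hM2 [3, 10, 19] [13, 14, 15] [] [] (by decide)
    (fun s' => J s' ∧
      (s'.wreg 10 = 0 → ∀ e < L, s'.warr 13 (s.warr 2 e) ≠ 0 → s.warr 10 (s.warr 3 e) ≠ 0 →
        s'.warr 14 (s.warr 3 e) ≠ 0))
    (fun s' => zeros n (s'.warr 14) + s'.wreg 10) ?_ ?_ ?_ ?_
  · have := zeros_le n (s2.warr 14)
    simp only [hs2, setW_wreg, if_true] at this ⊢
    omega
  · refine ⟨⟨by simp [hs2], fun _ => 0, ?_⟩, by simp [hs2]⟩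
    simp only [hs2, setW_warr, setW_wreg]
    have h14 : ∀ v < n, s1.warr 14 v = 0 := fun v hv => (hI1 v hv).2
    have h13 : ∀ v < n, s1.warr 13 v ≠ 0 ↔ (s.warr 9 v ≠ 0 ∧ s.warr 11 v = 0) := by
      intro v hv
      rw [(hI1 v hv).1]
      split_ifs with h <;> simp [h]
    refine ⟨?_, ?_, ?_, ?_, ?_, ?_, ?_⟩
    · exact fun v hv h => absurd (h14 v hv) h
    · exact fun v hv h => absurd (h14 v hv) h
    · intro x hx h
      have := (h13 x hx).1 h
      exact ⟨this.1, Or.inl this.2⟩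
    · exact fun x hx h1 h2 => (h13 x hx).2 ⟨h1, h2⟩
    · exact fun v hv h => absurd (h14 v hv) h
    · exact fun v hv h => absurd (h14 v hv) h
    · simp
  · rintro s3 hA3 ⟨⟨h1, h2⟩, -⟩ hc
    simp only [Test.holds, WExpr.eval] at hc
    refine WP.seq hM2 (WP.setW hM2 ?_)
    refine WP.forUp hM2 [10, 19] [13, 14, 15] [] [] (by decide) L (by omega)
      (fun s' h => by simp [h.wreg, hA3.wreg, hA2.wreg, hs.L_eq])
      (fun j s' => J s' ∧
      (s'.wreg 10 = 0 → ∀ e < j, s'.warr 13 (s.warr 2 e) ≠ 0 → s.warr 10 (s.warr 3 e) ≠ 0 →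
        s'.warr 14 (s.warr 3 e) ≠ 0) ∧
      zeros n (s'.warr 14) + s'.wreg 10 ≤ zeros n (s3.warr 14)) ?_ ?_ ?_
    · exact ⟨⟨by simp, by simpa using h2⟩, by simp, by simp⟩
    · rintro j s4 hj hA4 hi ⟨⟨i1, rk, i2⟩, i3, i4⟩
      have e2 : s4.warr 2 = s.warr 2 := by simp [hA4.warr, hA3.warr, hA2.warr]
      have e3 : s4.warr 3 = s.warr 3 := by simp [hA4.warr, hA3.warr, hA2.warr]
      have e10 : s4.warr 10 = s.warr 10 := by simp [hA4.warr, hA3.warr, hA2.warr]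
      have e12 : s4.warr 12 = s.warr 12 := by simp [hA4.warr, hA3.warr, hA2.warr]
      refine WP.ite hM2 ?_ ?_
      · intro hc
        simp only [Test.holds, WExpr.eval, e2, e3, e10, hi] at hc
        have hrel := hs.rel hj
        have hz := zeros_update_lt (hR.lt (hR.symm hrel)) hc.2.2 one_ne_zero
        obtain ⟨rk', hrk⟩ := i2.extend hR hm hrel hc.1 hc.2.1 hc.2.2
        refine WP.seq hM2 (WP.setW hM2 (WP.seq hM2 (WP.putW hM2 (WP.seq hM2 (WP.putW hM2 ?_)))))
        refine WP.ite hM2 ?_ ?_ <;> intro hc' <;>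
          simp [hi, e12, e3] at hc' <;> simp only [hc', if_true, if_false] at hrk
        · refine WP.setW hM2 ⟨⟨by simp, rk', ?_⟩, by simp, ?_⟩
          · simpa [hi, e2, e3] using hrk
          · simp [hi, e3]; omega
        · refine WP.putW hM2 ⟨⟨by simp, rk', ?_⟩, by simp, ?_⟩
          · simpa [hi, e2, e3, e12] using hrk
          · simp [hi, e3]; omega
      · intro hc
        simp only [Test.holds, WExpr.eval, e2, e3, e10, hi] at hc
        refine WP.skip hM2 ⟨⟨by simpa using i1, rk, by simpa using i2⟩, ?_, by simpa using i4⟩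
        simp only [setW_wreg, setW_warr]
        intro h0 e he
        rcases Nat.lt_succ_iff_lt_or_eq.1 he with h | h
        · exact i3 (by simpa using h0) e h
        · subst h
          intro ha hb hcc
          exact hc ⟨ha, hb, hcc⟩
    · rintro s' hA' ⟨i1, i2, i3⟩
      exact ⟨⟨i1, i2⟩, by omega⟩
  · rintro s3 hA3 ⟨⟨h1, h2⟩, h3⟩ hc
    simp only [Test.holds, WExpr.eval] at hc
    refine ⟨h2, fun u v huv => ?_⟩
    obtain ⟨e, he, rfl, rfl⟩ := (hs.iff _ _).1 huv
    exact h3 (by omega) e he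

/-- Augments the matching along the path that ends in the vertex given by register `19`. -/
def augmentProg : Prog :=
  .seq (.setW 20 (.reg 19)) <|
  .while (.not (.eq (.reg 20) (.lit 0))) <|
    .seq (.setW 21 (.sub (.reg 20) (.lit 1))) <|
    .seq (.setW 22 (.get 15 (.reg 21))) <|
    .seq (.setW 20 (.get 11 (.reg 22))) <|
    .seq (.putW 11 (.reg 22) (.add (.reg 21) (.lit 1))) <|
    .putW 12 (.reg 21) (.add (.reg 22) (.lit 1))

/-- The invariant of the augmentation, where `y` is the vertex on the right that lost its mate. -/
structure IsPartial (n : ℕ) (R : ℕ → ℕ → Prop) (LS RS RR pr rk ml mt : ℕ → ℕ) (y : ℕ) : Prop where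
  lt : y < n
  mem : RR y ≠ 0
  free : ∀ x < n, ml x ≠ y + 1
  left : ∀ x w, x < n → ml x = w + 1 → LS x ≠ 0 ∧ RS w ≠ 0 ∧ R x w ∧ mt w = x + 1
  right : ∀ w x, w < n → w ≠ y → mt w = x + 1 → x < n ∧ ml x = w + 1
  pred : ∀ w < n, RR w ≠ 0 → rk w ≤ rk y → ml (pr w) = 0 ∨
    ∃ w' < n, ml (pr w) = w' + 1 ∧ RR w' ≠ 0 ∧ rk w' < rk w

/-! ### One step along an augmenting path -/

section
variable {n : ℕ} {R : ℕ → ℕ → Prop} {LS RS RR pr rk ml mt : ℕ → ℕ} {y : ℕ}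

theorem IsPartial.step_left (h : IsPartial n R LS RS RR pr rk ml mt y)
    (hp : LS (pr y) ≠ 0 ∧ RS y ≠ 0 ∧ R (pr y) y) (x w : ℕ) (hx : x < n)
    (he : Function.update ml (pr y) (y + 1) x = w + 1) :
    LS x ≠ 0 ∧ RS w ≠ 0 ∧ R x w ∧ Function.update mt y (pr y + 1) w = x + 1 := by
  rw [Function.update_apply] at he
  split_ifs at he with hxe
  · obtain rfl : y = w := by omega
    rw [hxe]
    exact ⟨hp.1, hp.2.1, hp.2.2, by simp⟩
  · obtain ⟨a, b, c, d⟩ := h.left x w hx he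
    have : w ≠ y := by rintro rfl; exact h.free x hx he
    exact ⟨a, b, c, by rw [Function.update_of_ne this, d]⟩

theorem IsPartial.step_last (h : IsPartial n R LS RS RR pr rk ml mt y)
    (hp : LS (pr y) ≠ 0 ∧ RS y ≠ 0 ∧ R (pr y) y) (hpn : pr y < n) (h0 : ml (pr y) = 0) :
    IsMatch n R LS RS (Function.update ml (pr y) (y + 1)) (Function.update mt y (pr y + 1)) := by
  refine ⟨h.step_left hp, fun w x hw he => ?_⟩
  rw [Function.update_apply] at he
  split_ifs at he with hwe
  · obtain rfl : pr y = x := by omega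
    exact ⟨hpn, by simp [hwe]⟩
  · obtain ⟨a, b⟩ := h.right w x hw hwe he
    have : x ≠ pr y := by rintro rfl; omega
    exact ⟨a, by rw [Function.update_of_ne this, b]⟩

/-- The vertex `y` takes over `pr y`, whose former mate `y'` becomes the vertex without a mate. The
rank drops strictly, so the walk back along the path ends, and only predecessors of vertices of rank
at most that of `y'` still matter. -/
theorem IsPartial.step (h : IsPartial n R LS RS RR pr rk ml mt y)
    (hp : LS (pr y) ≠ 0 ∧ RS y ≠ 0 ∧ R (pr y) y) (hpn : pr y < n) {y' : ℕ}
    (h0 : ml (pr y) = y' + 1) :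
    IsPartial n R LS RS RR pr rk (Function.update ml (pr y) (y + 1))
      (Function.update mt y (pr y + 1)) y' ∧ rk y' < rk y := by
  obtain ⟨hy', hRR, hrk⟩ : y' < n ∧ RR y' ≠ 0 ∧ rk y' < rk y := by
    rcases h.pred y h.lt h.mem le_rfl with h1 | ⟨w, h1, h2, h3, h4⟩
    · omega
    · obtain rfl : w = y' := by omega
      exact ⟨h1, h3, h4⟩
  have hyy : y ≠ y' := by rintro rfl; omega
  refine ⟨⟨hy', hRR, ?_, h.step_left hp, ?_, ?_⟩, hrk⟩
  · intro x hx he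
    rw [Function.update_apply] at he
    split_ifs at he with hxe
    · omega
    · have h1 := (h.left x y' hx he).2.2.2
      have h2 := (h.left _ y' hpn h0).2.2.2
      omega
  · intro w x hw hwy he
    rw [Function.update_apply] at he
    split_ifs at he with hwe
    · obtain rfl : pr y = x := by omega
      exact ⟨hpn, by simp [hwe]⟩
    · obtain ⟨a, b⟩ := h.right w x hw hwe he
      have : x ≠ pr y := by rintro rfl; omega
      exact ⟨a, by rw [Function.update_of_ne this, b]⟩
  · intro w hw hRw hrw
    have hold := h.pred w hw hRw (by omega)
    -- Otherwise the mate `y'` of `pr y` would have smaller rank than `w`, although the rank of `w`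
    -- is at most that of `y'`. Hence the change at `pr y` does not affect the predecessor of `w`.
    have : pr w ≠ pr y := by
      intro he
      rw [he] at hold
      rcases hold with h1 | ⟨w', h1, h2, h3, h4⟩
      · omega
      · obtain rfl : w' = y' := by omega
        omega
    rwa [Function.update_of_ne this]

end

/-- The last two conclusions make the number of free vertices on the left fall: none becomes free,
and the start of the path, which was free, is matched. -/
theorem augmentProg_spec {M n : ℕ} {R : ℕ → ℕ → Prop} {rk : ℕ → ℕ} {s : State} (hM : n + 2 ≤ M)
    (hm : IsMatch n R (s.warr 9) (s.warr 10) (s.warr 11) (s.warr 12))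
    (hsr : IsSearch n R (s.warr 9) (s.warr 10) (s.warr 11) (s.warr 12) (s.warr 13) (s.warr 14)
        (s.warr 15) rk (s.wreg 19)) (hend : s.wreg 19 ≠ 0) :
    WP M augmentProg (fun s' => Agree [20, 21, 22] [11, 12] [] [] s s' ∧
      IsMatch n R (s.warr 9) (s.warr 10) (s'.warr 11) (s'.warr 12) ∧
      (∀ x, s'.warr 11 x = 0 → s.warr 11 x = 0) ∧
      ∃ x < n, s.warr 9 x ≠ 0 ∧ s.warr 11 x = 0 ∧ s'.warr 11 x ≠ 0) s := by
  have hM2 : 2 ≤ M := by omega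
  refine WP.agree _ _ _ _ (by decide) ?_
  refine WP.seq hM2 (WP.setW hM2 ?_)
  obtain ⟨y0, hy0⟩ := Nat.exists_eq_succ_of_ne_zero hend
  obtain ⟨hy0n, hy0R, hy0m⟩ := hsr.endp_spec y0 hy0
  refine WP.whileDo hM2 [20, 21, 22] [11, 12] [] [] (by decide)
    (fun s' => (∀ x, s'.warr 11 x = 0 → s.warr 11 x = 0) ∧
      (∀ y, s'.wreg 20 = y + 1 → IsPartial n R (s.warr 9) (s.warr 10) (s.warr 14) (s.warr 15) rk
        (s'.warr 11) (s'.warr 12) y) ∧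
      (s'.wreg 20 = 0 → IsMatch n R (s.warr 9) (s.warr 10) (s'.warr 11) (s'.warr 12) ∧
        ∃ x < n, s.warr 9 x ≠ 0 ∧ s.warr 11 x = 0 ∧ s'.warr 11 x ≠ 0))
    -- Register `20` holds the vertex without a mate plus one, and `0` when the path is finished;
    -- the shift by one in the rank separates these cases.
    (fun s' => if s'.wreg 20 = 0 then 0 else rk (s'.wreg 20 - 1) + 1) ?_ ?_ ?_ ?_
  · have := (hsr.right y0 hy0n hy0R).2.2.2.2
    simp [hy0]
    omega
  · refine ⟨by simp, ?_, by simp [hy0]⟩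
    intro y hy
    obtain rfl : y0 = y := by simp [hy0] at hy; exact hy
    exact ⟨hy0n, hy0R, fun x hx he => by have := (hm.left x _ hx he).2.2.2; omega,
      fun x w hx he => hm.left x w hx he, fun w x hw _ he => hm.right w x hw he,
      fun w hw hRw _ => hsr.pred w hw hRw⟩
  · rintro s1 hA1 ⟨h1, h2, h3⟩ hc
    simp only [Test.holds, WExpr.eval] at hc
    obtain ⟨y, hy⟩ := Nat.exists_eq_succ_of_ne_zero hc
    have hP := h2 y hy
    have e15 : s1.warr 15 = s.warr 15 := by simp [hA1.warr]
    obtain ⟨a1, a2, a3, a4, a5⟩ := hsr.right y hP.lt hP.mem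
    have hp : s.warr 9 (s.warr 15 y) ≠ 0 ∧ s.warr 10 y ≠ 0 ∧ R (s.warr 15 y) y :=
      ⟨(hsr.left _ a2 a3).1, a1, a4⟩
    refine WP.seq hM2 (WP.setW hM2 (WP.seq hM2 (WP.setW hM2 (WP.seq hM2 (WP.setW hM2
      (WP.seq hM2 (WP.putW hM2 (WP.putW hM2 ?_))))))))
    simp only [setW_warr, setW_wreg, putW_warr, WExpr.eval, putW_wreg, reduceIte, hy, Nat.reduceEqDiff,
      Nat.succ_eq_add_one, Nat.add_sub_cancel, e15]
    refine ⟨⟨?_, ?_, ?_⟩, ?_⟩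
    · intro x hx
      rw [Function.update_apply] at hx
      split_ifs at hx with hxe
      exact h1 x hx
    · intro y' hy'
      exact (hP.step hp a2 hy').1
    · intro h0
      exact ⟨hP.step_last hp a2 h0, _, a2, hp.1, h1 _ h0, by simp⟩
    · split_ifs with h0
      · omega
      · obtain ⟨y', hy'⟩ := Nat.exists_eq_succ_of_ne_zero h0
        have := (hP.step hp a2 hy').2
        rw [hy']
        simpa using this
  · rintro s1 hA1 ⟨h1, h2, h3⟩ hc
    simp only [Test.holds, WExpr.eval, not_not] at hc
    exact ⟨(h3 hc).1, h1, (h3 hc).2⟩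

/-- Finds a maximum matching. Register `23` becomes `0` if it covers the left side; otherwise the
last search exhibits a violation of Hall's condition. -/
def matchProg : Prog :=
  .seq (.setW 18 (.lit 1)) <|
  .seq (.while (.eq (.reg 18) (.lit 1)) (.seq searchProg
    (.ite (.eq (.reg 19) (.lit 0)) (.setW 18 (.lit 0)) augmentProg))) <|
  .seq (.setW 23 (.lit 0)) <|
  .forUp 3 (.reg 0) (.ite
    (.and (.not (.eq (.get 9 (.reg 3)) (.lit 0))) (.eq (.get 11 (.reg 3)) (.lit 0)))
    (.setW 23 (.lit 1)) .skip)

/-- The vertices `v < n` marked by `f`. -/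
def marked (n : ℕ) (f : ℕ → ℕ) : Finset ℕ := (Finset.range n).filter fun v => f v ≠ 0

theorem mem_marked {n : ℕ} {f : ℕ → ℕ} {v : ℕ} : v ∈ marked n f ↔ v < n ∧ f v ≠ 0 := by
  simp [marked]

/-- If the last search finds no free vertex on the right, then all reached right vertices are
matched, to distinct reached left vertices. As a free left vertex is reached too, more vertices are
reached on the left than on the right, while the right ones are all the neighbours of the left ones
in the right side. -/
theorem matchProg_spec {M n L : ℕ} {R : ℕ → ℕ → Prop} {s : State} (hM : n + L + 2 ≤ M)
    (hR : IsAdj n R) (hs : HasArcs R n L s)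
    (hm : IsMatch n R (s.warr 9) (s.warr 10) (s.warr 11) (s.warr 12)) :
    WP M matchProg (fun s' => Agree [3, 10, 18, 19, 20, 21, 22, 23] [11, 12, 13, 14, 15] [] [] s s' ∧
      (s'.wreg 23 = 0 → ∃ f : ℕ → ℕ, (∀ x ∈ marked n (s.warr 9), f x ∈ marked n (s.warr 10) ∧
        R x (f x)) ∧ Set.InjOn f (marked n (s.warr 9))) ∧
      (s'.wreg 23 ≠ 0 → s'.wreg 23 = 1 ∧ marked n (s'.warr 13) ⊆ marked n (s.warr 9) ∧
        (∀ v, v ∈ marked n (s'.warr 14) ↔ v ∈ marked n (s.warr 10) ∧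
          ∃ u ∈ marked n (s'.warr 13), R u v) ∧
        (marked n (s'.warr 14)).card < (marked n (s'.warr 13)).card)) s := by
  have hM2 : 2 ≤ M := by omega
  refine WP.agree _ _ _ _ (by decide) ?_
  refine WP.seq hM2 (WP.setW hM2 (WP.seq hM2 ?_))
  let fr : State → ℕ := fun s' =>
    ((Finset.range n).filter fun x => s.warr 9 x ≠ 0 ∧ s'.warr 11 x = 0).card
  refine WP.whileDo hM2 [3, 10, 18, 19, 20, 21, 22] [11, 12, 13, 14, 15] [] [] (by decide)
    (fun s' => IsMatch n R (s.warr 9) (s.warr 10) (s'.warr 11) (s'.warr 12) ∧ s'.wreg 18 ≤ 1 ∧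
      (s'.wreg 18 = 0 → s'.wreg 19 = 0 ∧
      (∃ rk, IsSearch n R (s.warr 9) (s.warr 10) (s'.warr 11) (s'.warr 12) (s'.warr 13) (s'.warr 14)
        (s'.warr 15) rk (s'.wreg 19)) ∧
      ∀ u v, R u v → s'.warr 13 u ≠ 0 → s.warr 10 v ≠ 0 → s'.warr 14 v ≠ 0))
    -- An augmentation lowers the number `fr` of free left vertices, and an unsuccessful search
    -- clears register `18`.
    (fun s' => fr s' + s'.wreg 18) ?_ ?_ ?_ ?_
  · have : fr (s.setW 18 1) ≤ n := (Finset.card_filter_le _ _).trans (by simp)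
    simp only [WExpr.eval, setW_wreg, if_true]
    omega
  · exact ⟨hm, by simp, by simp⟩
  · rintro s1 hA1 ⟨h1, h2, -⟩ hc
    simp only [Test.holds, WExpr.eval] at hc
    have e9 : s1.warr 9 = s.warr 9 := by simp [hA1.warr]
    have e10 : s1.warr 10 = s.warr 10 := by simp [hA1.warr]
    have hs1 : HasArcs R n L s1 :=
      ⟨by simp [hA1.wreg, hs.n_eq], by simp [hA1.wreg, hs.L_eq], by simpa [hA1.warr] using hs.iff⟩
    refine WP.seq hM2 ((searchProg_spec hM hR hs1 (by rw [e9, e10]; exact h1)).mono ?_)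
    rintro s2 ⟨hA2, ⟨rk, h3⟩, h4⟩
    have f9 : s2.warr 9 = s1.warr 9 := by simp [hA2.warr]
    have f10 : s2.warr 10 = s1.warr 10 := by simp [hA2.warr]
    have f11 : s2.warr 11 = s1.warr 11 := by simp [hA2.warr]
    have f12 : s2.warr 12 = s1.warr 12 := by simp [hA2.warr]
    refine WP.ite hM2 ?_ ?_ <;> intro hc' <;> simp only [Test.holds, WExpr.eval] at hc'
    · refine WP.setW hM2 ⟨⟨by simpa [f11, f12] using h1, by simp, fun _ => ⟨by simpa using hc', ?_⟩⟩, ?_⟩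
      · simp only [setW_warr, setW_wreg, f11, f12, reduceIte, Nat.reduceEqDiff]
        rw [e9, e10] at h3
        rw [e10] at h4
        exact ⟨⟨rk, h3⟩, h4⟩
      · simp [fr, f11, hc]
    · refine (augmentProg_spec (M := M) (n := n) (R := R) (by omega) (by rw [f9, f10, f11, f12, e9, e10]; exact h1)
        (by rw [f9, f10, f11, f12]; exact h3) hc').mono ?_
      rintro s3 ⟨hA3, g1, g2, x, hx, g3, g4, g5⟩
      rw [f9, e9] at g1 g3
      rw [f10, e10] at g1
      rw [f11] at g2 g4
      have e18 : s3.wreg 18 = 1 := by rw [hA3.wreg 18 (by decide), hA2.wreg 18 (by decide), hc]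
      refine ⟨⟨g1, by omega, by omega⟩, ?_⟩
      rw [e18, hc, Nat.add_lt_add_iff_right]
      refine Finset.card_lt_card (Finset.ssubset_iff_of_subset ?_ |>.2 ⟨x, ?_, ?_⟩)
      · intro z hz
        simp only [Finset.mem_filter] at hz ⊢
        exact ⟨hz.1, hz.2.1, g2 z hz.2.2⟩
      · simp [hx, g3, g4]
      · simp [g5]
  rintro s1 hA1 ⟨h1, h2, h3⟩ hc
  simp only [Test.holds, WExpr.eval] at hc
  obtain ⟨h4, ⟨rk, h5⟩, h6⟩ := h3 (by omega)
  have e9 : s1.warr 9 = s.warr 9 := by simp [hA1.warr]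
  refine WP.seq hM2 (WP.setW hM2 ?_)
  refine WP.forUp hM2 [23] [] [] [] (by decide) n (by omega)
    (fun s' h => by simp [h.wreg, hA1.wreg, hs.n_eq])
    (fun j s' => s'.wreg 23 ≤ 1 ∧
      (s'.wreg 23 = 0 ↔ ∀ x < j, s.warr 9 x ≠ 0 → s1.warr 11 x ≠ 0)) (by simp) ?_ ?_
  · rintro j s2 hj hA2 hi ⟨i1, i2⟩
    have f9 : s2.warr 9 = s.warr 9 := by simp [hA2.warr, e9]
    have f11 : s2.warr 11 = s1.warr 11 := by simp [hA2.warr]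
    refine WP.ite hM2 ?_ ?_ <;> intro hc' <;> simp only [Test.holds, WExpr.eval, hi, f9, f11] at hc'
    · refine WP.setW hM2 ⟨by simp, ?_⟩
      simp only [WExpr.eval, setW_wreg, Nat.reduceEqDiff, reduceIte, one_ne_zero, false_iff]
      exact fun h => h j (by omega) hc'.1 hc'.2
    · refine WP.skip hM2 ⟨by simpa using i1, ?_⟩
      simp only [setW_wreg, Nat.reduceEqDiff, reduceIte]
      rw [i2]
      constructor
      · intro h x hx h9
        rcases Nat.lt_succ_iff_lt_or_eq.1 hx with h' | rfl
        · exact h x h' h9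
        · exact fun h0 => hc' ⟨h9, h0⟩
      · exact fun h x hx => h x (by omega)
  rintro s2 hA2 ⟨i1, i2⟩
  have e13 : s2.warr 13 = s1.warr 13 := by simp [hA2.warr]
  have e14 : s2.warr 14 = s1.warr 14 := by simp [hA2.warr]
  rw [e13, e14]
  constructor
  · intro h0
    rw [i2] at h0
    have hf : ∀ x ∈ marked n (s.warr 9), x < n ∧ s1.warr 11 x = (s1.warr 11 x - 1) + 1 := by
      intro x hx
      rw [mem_marked] at hx
      have := h0 x hx.1 hx.2
      exact ⟨hx.1, by omega⟩
    refine ⟨fun x => s1.warr 11 x - 1, fun x hx => ?_, fun x hx x' hx' he => ?_⟩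
    · obtain ⟨a, b, c, d⟩ := h1.left x _ (hf x hx).1 (hf x hx).2
      exact ⟨mem_marked.2 ⟨hR.lt (hR.symm c), b⟩, c⟩
    · obtain ⟨a, b, c, d⟩ := h1.left x _ (hf x hx).1 (hf x hx).2
      obtain ⟨a', b', c', d'⟩ := h1.left x' _ (hf x' hx').1 (hf x' hx').2
      simp only at he
      rw [he] at d
      omega
  · intro h0
    refine ⟨by omega, ?_, ?_, ?_⟩
    · intro v hv
      rw [mem_marked] at hv ⊢
      exact ⟨hv.1, (h5.left v hv.1 hv.2).1⟩
    · intro v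
      simp only [mem_marked]
      constructor
      · rintro ⟨hv, hv'⟩
        obtain ⟨a, b, c, d, -⟩ := h5.right v hv hv'
        exact ⟨⟨hv, a⟩, _, ⟨b, c⟩, d⟩
      · rintro ⟨⟨hv, hv'⟩, u, ⟨hu, hu'⟩, huv⟩
        exact ⟨hv, h6 u v huv hu' hv'⟩
    · have h0' := mt i2.2 h0
      push Not at h0'
      obtain ⟨x, hx, hx9, hx11⟩ := h0'
      have hmt : ∀ v ∈ marked n (s1.warr 14), v < n ∧ s1.warr 12 v = (s1.warr 12 v - 1) + 1 := by
        intro v hv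
        rw [mem_marked] at hv
        have : s1.warr 12 v ≠ 0 := fun h => h5.unmatched v hv.1 hv.2 h h4
        exact ⟨hv.1, by omega⟩
      -- Mates are distinct, and the free vertex `x` is nobody's mate.
      have hcard : (marked n (s1.warr 14)).card ≤ ((marked n (s1.warr 13)).erase x).card := by
        refine Finset.card_le_card_of_injOn (fun v => s1.warr 12 v - 1) ?_ ?_
        · intro v hv
          have h := h1.right v _ (hmt v hv).1 (hmt v hv).2
          have h' := (mem_marked.1 hv).2
          simp only [Finset.mem_coe, Finset.mem_erase, mem_marked]
          refine ⟨?_, h.1, h5.mate v (hmt v hv).1 h' _ (hmt v hv).2⟩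
          intro he
          simp only [he] at h
          have := h.2
          omega
        · intro v hv v' hv' he
          simp only at he
          have h := h1.right v _ (hmt v hv).1 (hmt v hv).2
          have h' := h1.right v' _ (hmt v' hv').1 (hmt v' hv').2
          rw [he] at h
          omega
      have hxm : x ∈ marked n (s1.warr 13) := mem_marked.2 ⟨hx, h5.free x hx hx9 hx11⟩
      have := Finset.card_erase_lt_of_mem hxm
      omega

end TutteTW

end

noncomputable section

namespace TutteTW

open Relation

/-! ### Balanced separators in tree decompositions -/

/-! ### The sides of an edge of a tree -/

section Tree

variable {N : ℕ} {T : SimpleGraph (Fin N)}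

/-- The nodes on the side of `y` of the edge `xy`. -/
def treeSide (T : SimpleGraph (Fin N)) (x y : Fin N) : Set (Fin N) :=
  {z | ReflTransGen (fun a b => T.Adj a b ∧ s(a, b) ≠ s(x, y)) y z}

/-- Every edge of a tree is a bridge. -/
theorem notMem_treeSide (hT : T.IsTree) {x y : Fin N} (h : T.Adj x y) : x ∉ treeSide T x y := by
  intro hx
  have hb := SimpleGraph.isAcyclic_iff_forall_adj_isBridge.1 hT.isAcyclic h
  rw [SimpleGraph.isBridge_iff] at hb
  refine hb (SimpleGraph.Reachable.symm ?_)
  rw [SimpleGraph.reachable_iff_reflTransGen]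
  refine ReflTransGen.mono (fun a b h' => ?_) _ _ hx
  rw [SimpleGraph.deleteEdges_adj, Set.mem_singleton_iff]
  exact h'

theorem treeSide_step {x y z z' : Fin N} (hT : T.IsTree) (h : T.Adj x y)
    (hz : z ∈ treeSide T x y) (hzz : T.Adj z z') : z' ∈ treeSide T x y ∨ z' = x := by
  by_cases he : s(z, z') = s(x, y)
  · rcases Sym2.eq_iff.1 he with ⟨rfl, rfl⟩ | ⟨rfl, rfl⟩
    · exact absurd hz (notMem_treeSide hT h)
    · exact Or.inr rfl
  · exact Or.inl (ReflTransGen.tail hz ⟨hzz, he⟩)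

/-- The only exit from the side of `y` is through `x` (`treeSide_step`), and `K` avoids `x`. Applied
to the nodes whose bags contain a given vertex, this puts all bags of a vertex outside of the bag of
`x` on one side. -/
theorem subset_treeSide {x y : Fin N} (hT : T.IsTree) (h : T.Adj x y) {K : Set (Fin N)}
    (hK : (T.induce K).Connected) (hx : x ∉ K) {z z' : Fin N} (hz : z ∈ K) (hz' : z' ∈ K)
    (hzs : z ∈ treeSide T x y) : z' ∈ treeSide T x y := by
  have := hK.preconnected ⟨z, hz⟩ ⟨z', hz'⟩
  rw [SimpleGraph.reachable_iff_reflTransGen] at this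
  have key : ∀ a : K, ReflTransGen (T.induce K).Adj ⟨z, hz⟩ a → (a : Fin N) ∈ treeSide T x y := by
    intro a ha
    induction ha with
    | refl => exact hzs
    | @tail b c _ hbc ih =>
      rcases treeSide_step hT h ih hbc with h1 | h1
      · exact h1
      · exact absurd (h1 ▸ c.2) hx
  exact key _ this

theorem treeSide_subset {x x' y : Fin N} (hT : T.IsTree) (h : T.Adj x x') (h' : T.Adj x' y)
    (hy : y ≠ x) : treeSide T x' y ⊆ treeSide T x x' := by
  intro z hz
  have hx' := notMem_treeSide hT h'
  induction hz with
  | refl =>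
    refine ReflTransGen.single ⟨h', ?_⟩
    intro he
    rcases Sym2.eq_iff.1 he with ⟨rfl, rfl⟩ | ⟨_, rfl⟩
    · exact h.ne rfl
    · exact hy rfl
  | @tail b c hb hbc ih =>
    refine ReflTransGen.tail ih ⟨hbc.1, ?_⟩
    intro he
    rcases Sym2.eq_iff.1 he with ⟨_, rfl⟩ | ⟨rfl, _⟩
    · exact hx' (hb.tail hbc)
    · exact hx' hb

theorem exists_treeSide (hT : T.IsTree) (x z : Fin N) :
    z = x ∨ ∃ y, T.Adj x y ∧ z ∈ treeSide T x y := by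
  have := hT.connected.preconnected x z
  rw [SimpleGraph.reachable_iff_reflTransGen] at this
  induction this with
  | refl => exact Or.inl rfl
  | @tail b c _ hbc ih =>
    rcases ih with rfl | ⟨y, hy, hb⟩
    · exact Or.inr ⟨c, hbc, ReflTransGen.refl⟩
    · rcases treeSide_step hT hy hb hbc with h1 | h1
      · exact Or.inr ⟨y, hy, h1⟩
      · exact Or.inl h1

theorem disjoint_treeSide (hT : T.IsTree) {x y z : Fin N} (h : T.Adj x y)
    (hz : z ∈ treeSide T x y) (hz' : z ∈ treeSide T y x) : False := by
  refine notMem_treeSide hT h ?_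
  refine ReflTransGen.trans hz ?_
  have hs : Std.Symm (fun a b => T.Adj a b ∧ s(a, b) ≠ s(x, y)) :=
    ⟨fun a b hab => ⟨hab.1.symm, by rw [Sym2.eq_swap]; exact hab.2⟩⟩
  refine ReflTransGen.stdSymm.symm _ _ ?_
  unfold treeSide at hz'
  rw [Sym2.eq_swap] at hz'
  exact hz'

end Tree

/-! ### Balanced bags and separations -/

namespace MGraph

variable {n m : ℕ} {G : MGraph n m}

open Classical in
/-- The vertices outside of the bag of `x` with a bag on the side of `y` of the edge `xy`. -/
def TreeDecomposition.part (D : G.TreeDecomposition) (x y : Fin D.numNodes) : Finset (Fin n) :=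
  Finset.univ.filter fun v => v ∉ D.bag x ∧ ∃ z ∈ treeSide D.tree x y, v ∈ D.bag z

theorem TreeDecomposition.mem_part {D : G.TreeDecomposition} {x y : Fin D.numNodes} {v : Fin n} :
    v ∈ D.part x y ↔ v ∉ D.bag x ∧ ∃ z ∈ treeSide D.tree x y, v ∈ D.bag z := by
  simp [part]

theorem TreeDecomposition.mem_treeSide {D : G.TreeDecomposition} {x y z : Fin D.numNodes}
    {v : Fin n} (h : D.tree.Adj x y) (hv : v ∈ D.part x y) (hz : v ∈ D.bag z) :
    z ∈ treeSide D.tree x y := by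
  obtain ⟨h1, z', h2, h3⟩ := mem_part.1 hv
  exact subset_treeSide D.isTree h (D.subtree v) h1 h3 hz h2

/-- Otherwise every node has an edge towards a part with more than half of `W`. Among all such
directed edges let `xy` have the smallest side, and follow a heavy edge `yz`. If `z ≠ x`, the side
of `z` is strictly smaller; if `z = x`, two disjoint parts would each contain more than half of `W`.
-/
theorem TreeDecomposition.exists_balanced (D : G.TreeDecomposition) (W : Finset (Fin n)) :
    ∃ x, ∀ y, D.tree.Adj x y → 2 * (W ∩ D.part x y).card ≤ W.card := by
  classical
  by_contra! hcon
  have hne : (Finset.univ.filter fun xy : Fin D.numNodes × Fin D.numNodes =>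
      D.tree.Adj xy.1 xy.2 ∧ W.card < 2 * (W ∩ D.part xy.1 xy.2).card).Nonempty := by
    obtain ⟨x⟩ := D.isTree.connected.nonempty
    obtain ⟨y, h1, h2⟩ := hcon x
    exact ⟨(x, y), by simp [h1, h2]⟩
  obtain ⟨⟨x, y⟩, hxy, hmin⟩ := Finset.exists_min_image _
    (fun xy => (treeSide D.tree xy.1 xy.2).ncard) hne
  simp only [Finset.mem_filter, Finset.mem_univ, true_and] at hxy hmin
  obtain ⟨z, h1, h2⟩ := hcon y
  by_cases hzx : z = x
  · subst hzx
    have hd : Disjoint (W ∩ D.part z y) (W ∩ D.part y z) := by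
      rw [Finset.disjoint_left]
      intro v hv hv'
      rw [Finset.mem_inter] at hv hv'
      obtain ⟨_, t, ht, hvt⟩ := mem_part.1 hv'.2
      exact disjoint_treeSide D.isTree hxy.1 (mem_treeSide hxy.1 hv.2 hvt) ht
    have := Finset.card_union_of_disjoint hd
    have h3 : (W ∩ D.part z y ∪ W ∩ D.part y z).card ≤ W.card :=
      Finset.card_le_card (by rw [← Finset.inter_union_distrib_left]; exact Finset.inter_subset_left)
    omega
  · have := hmin (y, z) ⟨h1, h2⟩
    have hlt : (treeSide D.tree y z).ncard < (treeSide D.tree x y).ncard := by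
      refine Set.ncard_lt_ncard ?_ (Set.toFinite _)
      refine (Set.ssubset_iff_of_subset (treeSide_subset D.isTree hxy.1 h1 hzx)).2 ⟨y, ?_, ?_⟩
      · exact ReflTransGen.refl
      · exact notMem_treeSide D.isTree h1
    simp only at this
    omega

theorem TreeDecomposition.card_bag_le (D : G.TreeDecomposition) (x : Fin D.numNodes) :
    (D.bag x).card ≤ D.width + 1 := by
  have := Finset.le_sup (f := fun x => (D.bag x).card) (Finset.mem_univ x)
  unfold width
  omega

/-- `S` is a balanced bag and `A` the union of a smallest family of parts with at least `k + 2`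
vertices of `W`, where `k` is the width. If one part in the family is that large by itself, the
family consists of it, and balance gives the upper bound. Otherwise a part and, by minimality, the
union of the others have at most `k + 1` vertices of `W` each, in total at most `2 * k + 2`, which
is where `4 * k + 4` comes from. -/
theorem TreeDecomposition.exists_separation (D : G.TreeDecomposition) (W : Finset (Fin n))
    (hW : 4 * D.width + 4 ≤ W.card) :
    ∃ S A : Finset (Fin n), S.card ≤ D.width + 1 ∧ Disjoint A S ∧
      (∀ e, G.src e ∈ A → G.tgt e ∈ A ∪ S) ∧ (∀ e, G.tgt e ∈ A → G.src e ∈ A ∪ S) ∧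
      D.width + 2 ≤ (W ∩ A).card ∧ 2 * (W ∩ A).card ≤ W.card := by
  classical
  obtain ⟨x, hx⟩ := D.exists_balanced W
  set k := D.width
  have hbag := D.card_bag_le x
  let N : Finset (Fin D.numNodes) := Finset.univ.filter fun y => D.tree.Adj x y
  have hall : W \ D.bag x ⊆ W ∩ N.biUnion (D.part x) := by
    intro v hv
    rw [Finset.mem_sdiff] at hv
    obtain ⟨z, hz⟩ := D.vertex_mem v
    rcases exists_treeSide D.isTree x z with rfl | ⟨y, hy, hzy⟩
    · exact absurd hz hv.2
    · simp only [Finset.mem_inter, Finset.mem_biUnion]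
      exact ⟨hv.1, y, by simp [N, hy], mem_part.2 ⟨hv.2, z, hzy, hz⟩⟩
  have hne : (N.powerset.filter fun Y => k + 2 ≤ (W ∩ Y.biUnion (D.part x)).card).Nonempty := by
    refine ⟨N, ?_⟩
    simp only [Finset.mem_filter, Finset.mem_powerset, Finset.Subset.refl, true_and]
    have h1 := Finset.card_le_card hall
    have h2 := Finset.le_card_sdiff (D.bag x) W
    omega
  obtain ⟨Y, hY, hmin⟩ := Finset.exists_min_image _ Finset.card hne
  simp only [Finset.mem_filter, Finset.mem_powerset] at hY hmin
  have hadj : ∀ y ∈ Y, D.tree.Adj x y := fun y hy => by simpa [N] using hY.1 hy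
  have hclosed : ∀ u v z, u ∈ D.bag z → v ∈ D.bag z → u ∈ Y.biUnion (D.part x) →
      v ∈ Y.biUnion (D.part x) ∪ D.bag x := by
    intro u v z hu hv hm
    rw [Finset.mem_union]
    by_cases hvx : v ∈ D.bag x
    · exact Or.inr hvx
    · left
      obtain ⟨y, hy, hm⟩ := Finset.mem_biUnion.1 hm
      exact Finset.mem_biUnion.2 ⟨y, hy, mem_part.2 ⟨hvx, z, mem_treeSide (hadj y hy) hm hu, hv⟩⟩
  refine ⟨D.bag x, Y.biUnion (D.part x), hbag, ?_, ?_, ?_, hY.2, ?_⟩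
  · rw [Finset.disjoint_left]
    intro v hv
    obtain ⟨y, -, hm⟩ := Finset.mem_biUnion.1 hv
    exact (mem_part.1 hm).1
  · intro e
    obtain ⟨z, h1, h2⟩ := D.edge_mem e
    exact hclosed _ _ z h1 h2
  · intro e
    obtain ⟨z, h1, h2⟩ := D.edge_mem e
    exact hclosed _ _ z h2 h1
  · have hYne : Y.Nonempty := by
      rw [Finset.nonempty_iff_ne_empty]
      rintro rfl
      simp at hY
    obtain ⟨y, hy⟩ := hYne
    by_cases hbig : k + 2 ≤ (W ∩ D.part x y).card
    · have hone := hmin {y} ⟨by simpa using hY.1 hy, by simpa using hbig⟩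
      have : Y = {y} := by
        refine (Finset.eq_of_subset_of_card_le (by simpa using hy) hone).symm
      rw [this]
      simpa using hx y (hadj y hy)
    · have h1 : (W ∩ (Y.erase y).biUnion (D.part x)).card < k + 2 := by
        by_contra! hcon
        have := hmin (Y.erase y) ⟨(Finset.erase_subset _ _).trans hY.1, hcon⟩
        have := Finset.card_erase_lt_of_mem hy
        omega
      have h2 : W ∩ Y.biUnion (D.part x) ⊆
          (W ∩ D.part x y) ∪ (W ∩ (Y.erase y).biUnion (D.part x)) := by
        rw [← Finset.inter_union_distrib_left, ← Finset.biUnion_insert, Finset.insert_erase hy]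
      have h3 := (Finset.card_le_card h2).trans (Finset.card_union_le _ _)
      omega

theorem exists_width_eq (G : MGraph n m) : ∃ D : G.TreeDecomposition, D.width = G.treewidth := by
  have hne : (Set.range fun D : G.TreeDecomposition => D.width).Nonempty := by
    refine ⟨_, ⟨⟨1, ⊥, ?_, fun _ => Finset.univ, ?_, ?_, ?_⟩, rfl⟩⟩
    · exact SimpleGraph.IsTree.of_subsingleton
    · exact fun v => ⟨0, Finset.mem_univ _⟩
    · exact fun e => ⟨0, Finset.mem_univ _, Finset.mem_univ _⟩
    · intro v
      have : Nonempty {x : Fin 1 | v ∈ (Finset.univ : Finset (Fin n))} := ⟨⟨0, by simp⟩⟩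
      exact SimpleGraph.Connected.mk (fun a b => by
        rw [Subsingleton.elim a b])
  exact Nat.sInf_mem hne

/-- Equality or adjacency of vertices, which are given by numbers. -/
def nadj (G : MGraph n m) (u v : ℕ) : Prop :=
  u < n ∧ v < n ∧ (u = v ∨ ∃ e, ((G.src e : ℕ) = u ∧ (G.tgt e : ℕ) = v) ∨
    ((G.src e : ℕ) = v ∧ (G.tgt e : ℕ) = u))

theorem isAdj_nadj (G : MGraph n m) : IsAdj n G.nadj where
  lt h := h.1
  symm h := ⟨h.2.1, h.1, h.2.2.imp Eq.symm (Exists.imp fun _ => Or.symm)⟩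
  refl h := ⟨h, h, Or.inl rfl⟩

/-- If `W` is large in comparison with the treewidth, then it has a subset `A` of at most half of
its size that cannot be linked to the rest of `W`. -/
theorem exists_unlinked (G : MGraph n m) (W C : Finset ℕ) (hW : ∀ v ∈ W, v < n)
    (hcard : 4 * G.treewidth + 4 ≤ W.card) :
    ∃ A ⊆ W, 2 * A.card ≤ W.card ∧ ¬ ∃ f : ℕ → ℕ,
      (∀ x ∈ A ∪ C, f x ∈ C ∪ (W \ A) ∧ G.nadj x (f x)) ∧
        Set.InjOn f (A ∪ C : Finset ℕ) ∧ Disjoint C W := by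
  classical
  obtain ⟨D, hD⟩ := G.exists_width_eq
  have hmap : ∀ Z : Finset ℕ, (Z ∩ W).card = 
      ((Z.preimage (Fin.val : Fin n → ℕ) Fin.val_injective.injOn) ∩
        (W.preimage (Fin.val : Fin n → ℕ) Fin.val_injective.injOn)).card := by
    intro Z
    rw [← Finset.card_image_of_injective _ (Fin.val_injective (n := n))]
    congr 1
    ext v
    simp only [Finset.mem_inter, Finset.mem_image, Finset.mem_preimage]
    constructor
    · intro h
      exact ⟨⟨v, hW v h.2⟩, h, rfl⟩
    · rintro ⟨a, h, rfl⟩; exact h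
  have hmapW := hmap W
  rw [Finset.inter_self, Finset.inter_self] at hmapW
  obtain ⟨S, A, h1, h2, h3, h4, h5, h6⟩ := D.exists_separation
    (W.preimage (Fin.val : Fin n → ℕ) Fin.val_injective.injOn) (by rw [hD, ← hmapW]; exact hcard)
  rw [hD] at h1 h5
  rw [← hmapW] at h6
  set W' := W.preimage (Fin.val : Fin n → ℕ) Fin.val_injective.injOn
  let A0 : Finset ℕ := A.image Fin.val
  let S0 : Finset ℕ := S.image Fin.val
  have hA0 : (W ∩ A0).card = (W' ∩ A).card := by
    rw [← Finset.card_image_of_injective _ (Fin.val_injective (n := n))]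
    congr 1
    ext v
    simp only [Finset.mem_inter, Finset.mem_image, A0, W', Finset.mem_preimage]
    constructor
    · rintro ⟨h, a, ha, rfl⟩
      exact ⟨a, ⟨h, ha⟩, rfl⟩
    · rintro ⟨a, h, rfl⟩
      exact ⟨h.1, a, h.2, rfl⟩
  have hS0 : S0.card ≤ G.treewidth + 1 := Finset.card_image_le.trans h1
  have hstep : ∀ u v, u ∈ A0 → G.nadj u v → v ∈ A0 ∨ v ∈ S0 := by
    rintro u v hu ⟨-, -, huv⟩
    obtain ⟨a, ha, rfl⟩ := Finset.mem_image.1 hu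
    rcases huv with rfl | ⟨e, ⟨he1, he2⟩ | ⟨he1, he2⟩⟩
    · exact Or.inl hu
    · have := h3 e (by rwa [Fin.val_injective he1])
      rw [← he2]
      exact (Finset.mem_union.1 this).imp (Finset.mem_image_of_mem _) (Finset.mem_image_of_mem _)
    · have := h4 e (by rwa [Fin.val_injective he2])
      rw [← he1]
      exact (Finset.mem_union.1 this).imp (Finset.mem_image_of_mem _) (Finset.mem_image_of_mem _)
  refine ⟨W ∩ A0, Finset.inter_subset_left, by omega, ?_⟩
  rintro ⟨f, hf, hinj, hdisj⟩
  -- A linkage cannot leave `A0` except into `S0`, and inside of `A0` its values lie in `C`. By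
  -- injectivity the vertices of `W ∩ A0` would number at most those of `S0`, but there are at least
  -- `treewidth + 2` of the former and at most `treewidth + 1` of the latter.
  have hmaps : ((A0 ∩ C) ∪ (W ∩ A0)).card ≤ ((A0 ∩ C) ∪ S0).card := by
    refine Finset.card_le_card_of_injOn f ?_ (hinj.mono ?_)
    · intro y hy
      have hyA : y ∈ A0 := by
        simp only [Finset.coe_union, Set.mem_union, Finset.mem_coe, Finset.mem_inter] at hy
        tauto
      have hy' : y ∈ W ∩ A0 ∪ C := by
        simp only [Finset.coe_union, Set.mem_union, Finset.mem_coe, Finset.mem_inter] at hy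
        simp only [Finset.mem_union, Finset.mem_inter]
        tauto
      obtain ⟨g1, g2⟩ := hf y hy'
      have g3 := hstep _ _ hyA g2
      simp only [Finset.mem_union, Finset.mem_inter, Finset.mem_sdiff, Finset.coe_union,
        Set.mem_union, Finset.mem_coe] at g1 ⊢
      tauto
    · intro y hy
      simp only [Finset.coe_union, Set.mem_union, Finset.mem_coe, Finset.mem_inter] at hy ⊢
      tauto
  have hd : Disjoint (A0 ∩ C) (W ∩ A0) := by
    rw [Finset.disjoint_left] at hdisj ⊢
    intro v hv hv'
    exact hdisj (Finset.mem_inter.1 hv).2 (Finset.mem_inter.1 hv').1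
  rw [Finset.card_union_of_disjoint hd] at hmaps
  have := Finset.card_union_le (A0 ∩ C) S0
  omega

end MGraph

/-! ### Elimination of vertices -/

section Conn

variable {n : ℕ} {R : ℕ → ℕ → Prop} {P P' : Set ℕ} {r u v : ℕ}

theorem Conn.trans {w : ℕ} (h : Conn R P u v) (h' : Conn R P v w) : Conn R P u w :=
  ReflTransGen.trans h h'

theorem Conn.notMem (h : Conn R P r v) (hr : r ∉ P) : v ∉ P := by
  cases h with
  | refl => exact hr
  | tail _ h => exact h.2

theorem Conn.mono (h : Conn R P' r v) (hP : P ⊆ P') : Conn R P r v :=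
  ReflTransGen.mono (fun _ _ h => ⟨h.1, fun hp => h.2 (hP hp)⟩) _ _ h

theorem Conn.symm (hR : IsAdj n R) (h : Conn R P r v) (hr : r ∉ P) : Conn R P v r := by
  induction h with
  | refl => exact ReflTransGen.refl
  | @tail b c hb hbc ih =>
    exact (ReflTransGen.single ⟨hR.symm hbc.1, Conn.notMem hb hr⟩).trans ih

open Classical in
/-- The set `nb R P r` as a finite set. -/
def nbF (n : ℕ) (R : ℕ → ℕ → Prop) (P : Set ℕ) (r : ℕ) : Finset ℕ :=
  (Finset.range n).filter fun v => v ∈ nb R P r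

theorem mem_nbF (hR : IsAdj n R) : u ∈ nbF n R P r ↔ u ∈ P ∧ ∃ c, Conn R P r c ∧ R c u := by
  classical
  unfold nbF
  rw [Finset.mem_filter, Finset.mem_range]
  refine ⟨fun h => h.2, fun h => ⟨?_, h⟩⟩
  obtain ⟨-, c, -, hc⟩ := h
  exact hR.lt (hR.symm hc)

theorem nbF_subset_union (hR : IsAdj n R) (hP : P ⊆ P') {X : Finset ℕ}
    (hX : ∀ v ∈ P', v ∈ P ∨ v ∈ X) : nbF n R P' v ⊆ nbF n R P v ∪ X := by
  intro u hu
  obtain ⟨h1, c, h2, h3⟩ := (mem_nbF hR).1 hu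
  rw [Finset.mem_union]
  exact (hX u h1).imp (fun h => (mem_nbF hR).2 ⟨h, c, h2.mono hP, h3⟩) id

/-- Placing vertices in the component of `r` does not enlarge the neighbourhood of any other
component: a new neighbour would connect `v` to `r`. -/
theorem nbF_subset_of_not_conn (hR : IsAdj n R) (hP : P ⊆ P')
    (hX : ∀ v ∈ P', v ∈ P ∨ Conn R P r v) (hv : v ∉ P) (hc : ¬ Conn R P r v) :
    nbF n R P' v ⊆ nbF n R P v := by
  intro u hu
  obtain ⟨h1, c, h2, h3⟩ := (mem_nbF hR).1 hu
  rcases hX u h1 with h | h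
  · exact (mem_nbF hR).2 ⟨h, c, h2.mono hP, h3⟩
  · refine absurd (h.trans (ReflTransGen.trans (b := c) (ReflTransGen.single ?_) ?_)) hc
    · exact ⟨hR.symm h3, Conn.notMem (h2.mono hP) hv⟩
    · exact Conn.symm hR (h2.mono hP) hv

theorem nbF_conn_subset (hR : IsAdj n R) (hP : P ⊆ P') (hc : Conn R P r v) :
    ∀ u ∈ nbF n R P' v, u ∈ P → u ∈ nbF n R P r := by
  intro u hu hP'
  obtain ⟨h1, c, h2, h3⟩ := (mem_nbF hR).1 hu
  exact (mem_nbF hR).2 ⟨hP', c, hc.trans (h2.mono hP), h3⟩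

/-- The effect of the elimination of a separator given by a violation of Hall's condition. -/
theorem card_nbF_le_of_violation (hR : IsAdj n R) (hrn : r < n) (hr : r ∉ P) {A Y NY X : Finset ℕ}
    (hA2 : 2 * A.card ≤ (nbF n R P r).card)
    (hY : ∀ v ∈ Y, Conn R P r v ∨ v ∈ A) (hA : A ⊆ nbF n R P r)
    (hNY : ∀ v, v ∈ NY ↔ (Conn R P r v ∨ v ∈ nbF n R P r \ A) ∧ ∃ u ∈ Y, R u v)
    (hlt : NY.card < Y.card) (hX : ∀ v, v ∈ X ↔ v ∈ NY ∧ Conn R P r v ∧ v ∉ Y)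
    (hP' : ∀ v, v ∈ P' ↔ v ∈ P ∨ v ∈ X ∨ v = r) :
    X.card ≤ (nbF n R P r).card ∧
      ∀ v, v ∉ P' → Conn R P r v → (nbF n R P' v).card ≤ (nbF n R P r).card := by
  classical
  set W := nbF n R P r with hW
  have hPP : P ⊆ P' := fun v hv => (hP' v).2 (Or.inl hv)
  -- The relation is reflexive, so the vertices of `Y` in the component are among their own
  -- neighbours.
  have hYn : ∀ v ∈ Y, Conn R P r v → v ∈ NY := fun v hv hc =>
    (hNY v).2 ⟨Or.inl hc, v, hv, hR.refl (hc.lt hR hrn)⟩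
  have h1 : Y.card ≤ (Y.filter (Conn R P r)).card + (Y ∩ A).card := by
    refine (Finset.card_le_card fun v hv => ?_).trans (Finset.card_union_le _ _)
    rw [Finset.mem_union, Finset.mem_filter, Finset.mem_inter]
    exact (hY v hv).imp (fun h => ⟨hv, h⟩) (fun h => ⟨hv, h⟩)
  -- `NY` contains, disjointly, the part of `Y` in the component, the separator `X`, and the
  -- vertices of `W \ A` next to `Y`. Comparison with `NY.card < Y.card` and `h1` gives |X| + |NY ∩
  -- (W \ A)| < |Y ∩ A|. The strictness makes room for `r` in both cases below.
  have h2 : (Y.filter (Conn R P r)).card + X.card + (NY ∩ (W \ A)).card ≤ NY.card := by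
    rw [← Finset.card_union_of_disjoint, ← Finset.card_union_of_disjoint]
    · refine Finset.card_le_card fun v hv => ?_
      simp only [Finset.mem_union, Finset.mem_filter, Finset.mem_inter] at hv
      rcases hv with (hv | hv) | hv
      · exact hYn v hv.1 hv.2
      · exact ((hX v).1 hv).1
      · exact hv.1
    · rw [Finset.disjoint_left]
      intro v hv hv'
      have hvc : Conn R P r v := by
        rcases Finset.mem_union.1 hv with h | h
        · exact (Finset.mem_filter.1 h).2
        · exact ((hX v).1 h).2.1
      exact hvc.notMem hr ((mem_nbF hR).1 (Finset.mem_sdiff.1 (Finset.mem_inter.1 hv').2).1).1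
    · rw [Finset.disjoint_left]
      intro v hv hv'
      exact ((hX v).1 hv').2.2 (Finset.mem_filter.1 hv).1
  have h3 : (Y ∩ A).card ≤ A.card := Finset.card_le_card Finset.inter_subset_right
  refine ⟨by omega, fun v hv hc => ?_⟩
  have hsub : ∀ u ∈ nbF n R P' v, u ∈ W ∨ u ∈ insert r X := by
    intro u hu
    rcases (hP' u).1 ((mem_nbF hR).1 hu).1 with h | h | h
    · exact Or.inl (nbF_conn_subset hR hPP hc u hu h)
    · exact Or.inr (Finset.mem_insert_of_mem h)
    · exact Or.inr (by simp [h])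
  have hins : (insert r X).card ≤ X.card + 1 := Finset.card_insert_le _ _
  -- `X` separates the part of the component in `Y` from the rest. A new component next to `Y ∩ A`
  -- lies inside `Y`, so outside of `A` it sees of `W` only vertices of `NY`: its neighbourhood has
  -- at most |A| + |NY ∩ (W \ A)| + |X| + 1 ≤ 2 |A| ≤ |W| vertices. Any other new component loses `Y
  -- ∩ A` and gains at most `X` and `r`.
  by_cases hex : ∃ a ∈ Y ∩ A, a ∈ nbF n R P' v
  · obtain ⟨a, ha, hav⟩ := hex
    rw [Finset.mem_inter] at ha
    obtain ⟨-, c0, hc0, hR0⟩ := (mem_nbF hR).1 hav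
    have key : ∀ c, Conn R P' c0 c → c ∈ Y := by
      have hin : ∀ c, c ∉ P' → Conn R P r c → (∃ y ∈ Y, R y c) → c ∈ Y := by
        intro c hcP hcc hy
        by_contra hcY
        exact hcP ((hP' c).2 (Or.inr (Or.inl ((hX c).2 ⟨(hNY c).2 ⟨Or.inl hcc, hy⟩, hcc, hcY⟩))))
      intro c hcc
      induction hcc with
      | refl => exact hin _ (hc0.notMem hv) (hc.trans (hc0.mono hPP)) ⟨a, ha.1, hR.symm hR0⟩
      | @tail b c hb hbc ih =>
        exact hin _ hbc.2 (hc.trans (hc0.mono hPP) |>.trans (Conn.mono (hb.tail hbc) hPP))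
          ⟨b, ih, hbc.1⟩
    have hsub' : nbF n R P' v ⊆ (W \ ((W \ A) \ NY)) ∪ insert r X := by
      intro u hu
      rw [Finset.mem_union]
      refine (hsub u hu).imp_left fun hw => Finset.mem_sdiff.2 ⟨hw, fun hu' => ?_⟩
      rw [Finset.mem_sdiff] at hu'
      obtain ⟨-, c, hc1, hc2⟩ := (mem_nbF hR).1 hu
      exact hu'.2 ((hNY u).2 ⟨Or.inr hu'.1, c, key c ((hc0.symm hR hv).trans hc1), hc2⟩)
    have h4 := (Finset.card_le_card hsub').trans (Finset.card_union_le _ _)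
    have h5 : (W \ ((W \ A) \ NY)).card + ((W \ A) \ NY).card = W.card :=
      Finset.card_sdiff_add_card_eq_card (Finset.sdiff_subset.trans Finset.sdiff_subset)
    have h6 : ((W \ A) \ NY).card + (NY ∩ (W \ A)).card = (W \ A).card := by
      rw [Finset.inter_comm]
      exact Finset.card_sdiff_add_card_inter _ _
    have h7 := Finset.card_sdiff_add_card_eq_card hA
    omega
  · push Not at hex
    have hsub' : nbF n R P' v ⊆ (W \ (Y ∩ A)) ∪ insert r X := by
      intro u hu
      rw [Finset.mem_union]
      exact (hsub u hu).imp_left fun hw => Finset.mem_sdiff.2 ⟨hw, fun hu' => hex u hu' hu⟩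
    have h4 := (Finset.card_le_card hsub').trans (Finset.card_union_le _ _)
    have h5 := Finset.card_sdiff_add_card_eq_card (s := Y ∩ A) (t := W)
      (Finset.inter_subset_right.trans hA)
    omega

end Conn

end TutteTW

end

noncomputable section

namespace TutteTW

open Relation

/-! ### The search for a separator -/

/-- Prepares the matching problem for the set `A` of those vertices marked in array `6` that are
marked in array `8`; the size of `A` goes to register `25`. -/
def setupProg : Prog :=
  .seq (.setW 25 (.lit 0)) <|
  .forUp 3 (.reg 0) <|
    .ite (.not (.eq (.get 5 (.reg 3)) (.lit 0)))
      (.seq (.putW 9 (.reg 3) (.lit 1)) <| .seq (.putW 10 (.reg 3) (.lit 1)) <|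
        .seq (.putW 11 (.reg 3) (.add (.reg 3) (.lit 1)))
          (.putW 12 (.reg 3) (.add (.reg 3) (.lit 1))))
      (.seq (.putW 11 (.reg 3) (.lit 0)) <| .seq (.putW 12 (.reg 3) (.lit 0)) <|
        .ite (.not (.eq (.get 6 (.reg 3)) (.lit 0)))
          (.ite (.not (.eq (.get 8 (.reg 3)) (.lit 0)))
            (.seq (.putW 9 (.reg 3) (.lit 1)) <| .seq (.putW 10 (.reg 3) (.lit 0)) <|
              .setW 25 (.add (.reg 25) (.lit 1)))
            (.seq (.putW 9 (.reg 3) (.lit 0)) (.putW 10 (.reg 3) (.lit 1))))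
          (.seq (.putW 9 (.reg 3) (.lit 0)) (.putW 10 (.reg 3) (.lit 0))))

/-- The initial matching joins each vertex of the component on the left to its own copy on the
right, as reflexivity of `R` permits. Only the vertices of `A` are still free. -/
theorem setupProg_spec {M n : ℕ} {R : ℕ → ℕ → Prop} {s : State} (hM : n + 2 ≤ M)
    (hR : IsAdj n R) (hn : s.wreg 0 = n)
    (hd : ∀ v < n, s.warr 5 v ≠ 0 → s.warr 6 v = 0) :
    WP M setupProg (fun s' => Agree [3, 25] [9, 10, 11, 12] [] [] s s' ∧
      IsMatch n R (s'.warr 9) (s'.warr 10) (s'.warr 11) (s'.warr 12) ∧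
      (∀ v < n, s'.warr 9 v ≠ 0 ↔ s.warr 5 v ≠ 0 ∨ (s.warr 6 v ≠ 0 ∧ s.warr 8 v ≠ 0)) ∧
      (∀ v < n, s'.warr 10 v ≠ 0 ↔ s.warr 5 v ≠ 0 ∨ (s.warr 6 v ≠ 0 ∧ s.warr 8 v = 0)) ∧
      s'.wreg 25 = ((marked n (s.warr 6)).filter fun v => s.warr 8 v ≠ 0).card) s := by
  have hM2 : 2 ≤ M := by omega
  refine WP.agree _ _ _ _ (by decide) ?_
  refine WP.seq hM2 (WP.setW hM2 ?_)
  refine WP.forUp hM2 [25] [9, 10, 11, 12] [] [] (by decide) n (by omega)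
    (fun s' h => by simp [h.wreg, hn])
    (fun j s' => (∀ v < j, (s'.warr 9 v ≠ 0 ↔ s.warr 5 v ≠ 0 ∨ (s.warr 6 v ≠ 0 ∧ s.warr 8 v ≠ 0)) ∧
        (s'.warr 10 v ≠ 0 ↔ s.warr 5 v ≠ 0 ∨ (s.warr 6 v ≠ 0 ∧ s.warr 8 v = 0)) ∧
        s'.warr 11 v = (if s.warr 5 v = 0 then 0 else v + 1) ∧
        s'.warr 12 v = (if s.warr 5 v = 0 then 0 else v + 1)) ∧
      s'.wreg 25 = ((marked j (s.warr 6)).filter fun v => s.warr 8 v ≠ 0).card) ?_ ?_ ?_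
  · simp [marked]
  · rintro j s' hj hA hi ⟨hI, hI2⟩
    have e5 : s'.warr 5 = s.warr 5 := by simp [hA.warr]
    have e6 : s'.warr 6 = s.warr 6 := by simp [hA.warr]
    have e8 : s'.warr 8 = s.warr 8 := by simp [hA.warr]
    have hcard : ((marked (j + 1) (s.warr 6)).filter fun v => s.warr 8 v ≠ 0).card =
        ((marked j (s.warr 6)).filter fun v => s.warr 8 v ≠ 0).card +
          if s.warr 6 j ≠ 0 ∧ s.warr 8 j ≠ 0 then 1 else 0 := by
      simp only [marked, Finset.filter_filter]
      rw [Finset.range_add_one, Finset.filter_insert]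
      split_ifs
      · rw [Finset.card_insert_of_notMem (by simp)]
      · rfl
    rw [hcard, ← hI2]
    have hlt : ∀ v < j + 1, v < j ∨ v = j := fun v hv => Nat.lt_succ_iff_lt_or_eq.1 hv
    refine WP.ite hM2 ?_ ?_ <;> intro h5 <;> simp [e5, hi] at h5
    · refine WP.seq hM2 (WP.putW hM2 (WP.seq hM2 (WP.putW hM2 (WP.seq hM2 (WP.putW hM2
        (WP.putW hM2 ⟨fun v hv => ?_, ?_⟩))))))
      · rcases hlt v hv with h | rfl
        · simpa [hi, h.ne] using hI v h
        · simp [hi, h5]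
      · simp [hd j hj h5]
    · refine WP.seq hM2 (WP.putW hM2 (WP.seq hM2 (WP.putW hM2 (WP.ite hM2 ?_ ?_)))) <;> intro h6 <;>
        simp [e6, hi] at h6
      · refine WP.ite hM2 ?_ ?_ <;> intro h8 <;> simp [e8, hi] at h8
        · refine WP.seq hM2 (WP.putW hM2 (WP.seq hM2 (WP.putW hM2
            (WP.setW hM2 ⟨fun v hv => ?_, ?_⟩))))
          · rcases hlt v hv with h | rfl
            · simpa [hi, h.ne] using hI v h
            · simp [hi, h5, h6, h8]
          · simp [h6, h8]
        · refine WP.seq hM2 (WP.putW hM2 (WP.putW hM2 ⟨fun v hv => ?_, ?_⟩))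
          · rcases hlt v hv with h | rfl
            · simpa [hi, h.ne] using hI v h
            · simp [hi, h5, h6, h8]
          · simp [h8]
      · refine WP.seq hM2 (WP.putW hM2 (WP.putW hM2 ⟨fun v hv => ?_, ?_⟩))
        · rcases hlt v hv with h | rfl
          · simpa [hi, h.ne] using hI v h
          · simp [hi, h5, h6]
        · simp [h6]
  · rintro s' hA ⟨hI, hI2⟩
    refine ⟨⟨?_, ?_⟩, fun v hv => (hI v hv).1, fun v hv => (hI v hv).2.1, hI2⟩
    · intro x y hx hxy
      obtain ⟨-, -, h11, -⟩ := hI x hx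
      rw [h11] at hxy
      split_ifs at hxy with h5
      obtain rfl : x = y := by omega
      obtain ⟨h9, h10, -, h12⟩ := hI x hx
      exact ⟨h9.2 (Or.inl h5), h10.2 (Or.inl h5), hR.refl hx, by rw [h12, if_neg h5]⟩
    · intro y x hy hxy
      obtain ⟨-, -, h11, h12⟩ := hI y hy
      rw [h12] at hxy
      split_ifs at hxy with h5
      obtain rfl : y = x := by omega
      exact ⟨hy, by rw [h11, if_neg h5]⟩

/-- Searches for a set `A` of at most half of the vertices marked in array `6` that cannot be linked
to the others through the vertices marked in array `5`. -/
def sepProg : Prog :=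
  .seq (.setW 14 (.lit 2)) <| .seq powProg <| .seq (.setW 23 (.lit 0)) <|
  .forUp 16 (.reg 15) <| .ite (.eq (.reg 23) (.lit 0))
    (.seq digitsProg <| .seq setupProg <|
      .ite (.le (.add (.reg 25) (.reg 25)) (.reg 13)) matchProg .skip) .skip

/-- The set `A ∪ C` can be linked to `C ∪ (W \ A)`. -/
def Linked (R : ℕ → ℕ → Prop) (A C W : Finset ℕ) : Prop :=
  ∃ f : ℕ → ℕ, (∀ x ∈ A ∪ C, f x ∈ C ∪ (W \ A) ∧ R x (f x)) ∧ Set.InjOn f (A ∪ C : Finset ℕ)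

/-- The sets `Y` and `NY` violate Hall's condition for `A`. -/
structure IsViolation (R : ℕ → ℕ → Prop) (A C W Y NY : Finset ℕ) : Prop where
  sub : A ⊆ W
  card_le : 2 * A.card ≤ W.card
  left : Y ⊆ A ∪ C
  right : ∀ v, v ∈ NY ↔ v ∈ C ∪ (W \ A) ∧ ∃ u ∈ Y, R u v
  lt : NY.card < Y.card

/-- The binary digits of the counter select the subset `A` of `W`. As soon as a violation is found,
the remaining iterations are idle, so that the arrays `13` and `14` still hold it at the end. -/
theorem sepProg_spec {M n L : ℕ} {R : ℕ → ℕ → Prop} {s : State} (hM : n + L + 2 ≤ M)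
    (hR : IsAdj n R) (hs : HasArcs R n L s)
    (hd : ∀ v < n, s.warr 5 v ≠ 0 → s.warr 6 v = 0)
    (hl : IsEnum n (s.warr 6) (s.warr 7) (s.wreg 13)) (hM' : 2 ^ s.wreg 13 ≤ M) :
    WP M sepProg (fun s' => Agree [3, 4, 10, 14, 15, 16, 17, 18, 19, 20, 21, 22, 23, 25]
        [8, 9, 10, 11, 12, 13, 14, 15] [] [] s s' ∧
      (s'.wreg 23 = 0 → ∀ A ⊆ marked n (s.warr 6), 2 * A.card ≤ (marked n (s.warr 6)).card →
        Linked R A (marked n (s.warr 5)) (marked n (s.warr 6))) ∧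
      (s'.wreg 23 ≠ 0 → ∃ A, IsViolation R A (marked n (s.warr 5)) (marked n (s.warr 6))
        (marked n (s'.warr 13)) (marked n (s'.warr 14)))) s := by
  classical
  have hM2 : 2 ≤ M := by omega
  have hk : s.wreg 13 ≤ M := (Nat.lt_two_pow_self).le.trans hM'
  have hcard : s.wreg 13 = (marked n (s.warr 6)).card := hl.card_eq
  refine WP.agree _ _ _ _ (by decide) ?_
  refine WP.seq hM2 (WP.setW hM2 (WP.seq hM2 ?_))
  refine (powProg_spec (k := s.wreg 13) (p := 2) hM2 hk hM2 (by simp) (by simp)).mono ?_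
  rintro s1 ⟨hA1, h1⟩
  refine WP.seq hM2 (WP.setW hM2 ?_)
  let Aof : ℕ → Finset ℕ := fun x => (marked n (s.warr 6)).filter fun v =>
    ∃ t < s.wreg 13, s.warr 7 t = v ∧ x / 2 ^ t % 2 ≠ 0
  refine WP.forUp hM2 [3, 4, 10, 17, 18, 19, 20, 21, 22, 23, 25]
    [8, 9, 10, 11, 12, 13, 14, 15] [] [] (by decide) (2 ^ s.wreg 13) hM'
    (fun s' h => by simp [h.wreg, h1])
    (fun j s' => (s'.wreg 23 = 0 → ∀ x < j, 2 * (Aof x).card ≤ (marked n (s.warr 6)).card →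
        Linked R (Aof x) (marked n (s.warr 5)) (marked n (s.warr 6))) ∧
      (s'.wreg 23 ≠ 0 → ∃ A, IsViolation R A (marked n (s.warr 5)) (marked n (s.warr 6))
        (marked n (s'.warr 13)) (marked n (s'.warr 14)))) (by simp) ?_ ?_
  · rintro j s2 hj hA2 hi ⟨i1, i2⟩
    refine WP.ite hM2 ?_ ?_
    swap
    · intro hc
      simp only [Test.holds, WExpr.eval] at hc
      refine WP.skip hM2 ⟨fun h => absurd (by simpa using h) hc, fun h => ?_⟩
      simpa using i2 hc
    intro hc
    simp only [Test.holds, WExpr.eval] at hc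
    have e7 : s2.warr 7 = s.warr 7 := by simp [hA2.warr, hA1.warr]
    have e6 : s2.warr 6 = s.warr 6 := by simp [hA2.warr, hA1.warr]
    have e5 : s2.warr 5 = s.warr 5 := by simp [hA2.warr, hA1.warr]
    have e13 : s2.wreg 13 = s.wreg 13 := by simp [hA2.wreg, hA1.wreg]
    refine WP.seq hM2 ((digitsProg_spec (k := s.wreg 13) (p := 2) (x := j) hM2 hk (by omega)
      (by omega) e13 (by simp [hA2.wreg, hA1.wreg]) hi (by rw [e7]; exact hl.inj)).mono ?_)
    rintro s3 ⟨hA3, h3⟩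
    rw [e7] at h3
    have f5 : s3.warr 5 = s.warr 5 := by simp [hA3.warr, e5]
    have f6 : s3.warr 6 = s.warr 6 := by simp [hA3.warr, e6]
    have hn3 : s3.wreg 0 = n := by simp [hA3.wreg, hA2.wreg, hA1.wreg, hs.n_eq]
    have hAof : ∀ v, v ∈ Aof j ↔ v < n ∧ s.warr 6 v ≠ 0 ∧ s3.warr 8 v ≠ 0 := by
      intro v
      simp only [Aof, Finset.mem_filter, mem_marked]
      constructor
      · rintro ⟨⟨h1, h2⟩, t, ht, rfl, h⟩
        exact ⟨h1, h2, by rwa [h3 t ht]⟩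
      · rintro ⟨h1, h2, h⟩
        obtain ⟨t, ht, rfl⟩ := hl.surj v h1 h2
        exact ⟨⟨h1, h2⟩, t, ht, rfl, by rwa [← h3 t ht]⟩
    refine WP.seq hM2 ((setupProg_spec (M := M) (n := n) (R := R) (by omega) hR hn3
      (by rw [f5, f6]; exact hd)).mono ?_)
    rintro s4 ⟨hA4, hm, h9, h10, h25⟩
    rw [f5, f6] at h9 h10
    rw [f6] at h25
    have hfil : ((marked n (s.warr 6)).filter fun v => s3.warr 8 v ≠ 0) = Aof j := by
      ext v
      rw [hAof, Finset.mem_filter, mem_marked, and_assoc]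
    rw [hfil] at h25
    have hL : marked n (s4.warr 9) = Aof j ∪ marked n (s.warr 5) := by
      ext v
      rw [Finset.mem_union, hAof, mem_marked, mem_marked]
      constructor
      · rintro ⟨hv, h⟩
        exact ((h9 v hv).1 h).symm.imp (fun h => ⟨hv, h⟩) (fun h => ⟨hv, h⟩)
      · rintro (⟨hv, h⟩ | ⟨hv, h⟩)
        · exact ⟨hv, (h9 v hv).2 (Or.inr h)⟩
        · exact ⟨hv, (h9 v hv).2 (Or.inl h)⟩
    have hRt : marked n (s4.warr 10) = marked n (s.warr 5) ∪ (marked n (s.warr 6) \ Aof j) := by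
      ext v
      rw [Finset.mem_union, Finset.mem_sdiff, hAof, mem_marked, mem_marked, mem_marked]
      constructor
      · rintro ⟨hv, h⟩
        exact ((h10 v hv).1 h).imp (fun h => ⟨hv, h⟩) (fun h => ⟨⟨hv, h.1⟩, fun h' => h'.2.2 h.2⟩)
      · rintro (⟨hv, h⟩ | ⟨⟨hv, h⟩, h'⟩)
        · exact ⟨hv, (h10 v hv).2 (Or.inl h)⟩
        · refine ⟨hv, (h10 v hv).2 (Or.inr ⟨h, ?_⟩)⟩
          by_contra hcon
          exact h' ⟨hv, h, hcon⟩
    have g13 : s4.wreg 13 = s.wreg 13 := by simp [hA4.wreg, hA3.wreg, e13]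
    have g23 : s4.wreg 23 = 0 := by simp [hA4.wreg, hA3.wreg, hc]
    refine WP.ite hM2 ?_ ?_
    · intro hc'
      simp only [Test.holds, WExpr.eval, h25, g13] at hc'
      have hs4 : HasArcs R n L s4 := by
        refine ((((hs.of_agree (s' := s.setW 14 2) (ws := [14]) (was := []) (ns := []) (nas := [])
          ⟨?_, fun _ _ => rfl, fun _ _ => rfl, fun _ _ => rfl⟩ (by decide)).of_agree hA1
            (by decide)).of_agree (s' := s1.setW 23 0) (ws := [23]) (was := []) (ns := [])
              (nas := []) ⟨?_, fun _ _ => rfl, fun _ _ => rfl, fun _ _ => rfl⟩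
              (by decide)).of_agree hA2 (by decide)).of_agree hA3 (by decide) |>.of_agree hA4
                (by decide)
        · intro i hi; simp at hi; simp [hi]
        · intro i hi; simp at hi; simp [hi]
      refine (matchProg_spec hM hR hs4 hm).mono ?_
      rintro s5 ⟨hA5, h5, h5'⟩
      rw [hL, hRt] at h5
      rw [hL] at h5'
      rw [hRt] at h5'
      simp only [setW_wreg, Nat.reduceEqDiff, reduceIte, setW_warr]
      refine ⟨fun h0 x hx hx2 => ?_, fun h0 => ?_⟩
      · rcases Nat.lt_succ_iff_lt_or_eq.1 hx with h | rfl
        · exact i1 hc x h hx2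
        · exact h5 h0
      · obtain ⟨-, a, b, c⟩ := h5' h0
        exact ⟨Aof j, Finset.filter_subset _ _, by omega, a, b, c⟩
    · intro hc'
      simp only [Test.holds, WExpr.eval, h25, g13] at hc'
      refine WP.skip hM2 ⟨fun _ x hx hx2 => ?_, fun h0 => absurd (by simp [g23]) h0⟩
      rcases Nat.lt_succ_iff_lt_or_eq.1 hx with h | rfl
      · exact i1 hc x h hx2
      · omega
  · rintro s2 hA2 ⟨i1, i2⟩
    refine ⟨fun h0 A hA hA2 => ?_, i2⟩
    obtain ⟨x, hx, hx'⟩ := exists_digits (p := 2) (by omega) (s.wreg 13)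
      (fun t => if s.warr 7 t ∈ A then 1 else 0) (fun t _ => by split_ifs <;> omega)
    have : Aof x = A := by
      ext v
      simp only [Aof, Finset.mem_filter]
      constructor
      · rintro ⟨h1, t, ht, rfl, h⟩
        rw [hx' t ht] at h
        by_contra hcon
        simp [hcon] at h
      · intro h
        have hm := mem_marked.1 (hA h)
        obtain ⟨t, ht, rfl⟩ := hl.surj v hm.1 hm.2
        exact ⟨hA h, t, ht, rfl, by rw [hx' t ht]; simp [h]⟩
    rw [← this] at hA2 ⊢
    exact i1 h0 x hx hA2

end TutteTW

end

noncomputable section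

namespace TutteTW

open Relation

/-! ### The elimination order -/

/-- The vertices marked by `bl` have been put in order by `pos`, and every vertex had at most `w`
neighbours of its component when it was placed. -/
structure IsPlaced (n : ℕ) (R : ℕ → ℕ → Prop) (w : ℕ) (bl pos : ℕ → ℕ) (cnt : ℕ) : Prop where
  lt : ∀ u, bl u ≠ 0 → u < n
  pos_lt : ∀ u, bl u ≠ 0 → pos u < cnt
  inj : ∀ u v, bl u ≠ 0 → bl v ≠ 0 → pos u = pos v → u = v
  cnt_eq : cnt = (marked n bl).card
  width : ∀ v, bl v ≠ 0 → (nbF n R {u | bl u ≠ 0 ∧ pos u < pos v} v).card ≤ w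

/-- A later placement does not change which vertices precede an earlier one, so only the width at
`v` has to be checked. -/
theorem IsPlaced.place {n : ℕ} {R : ℕ → ℕ → Prop} {w : ℕ} {bl pos : ℕ → ℕ} {cnt : ℕ}
    (h : IsPlaced n R w bl pos cnt) {v : ℕ} (hv : v < n) (hb : bl v = 0)
    (hw : (nbF n R {u | bl u ≠ 0} v).card ≤ w) :
    IsPlaced n R w (Function.update bl v 1) (Function.update pos v cnt) (cnt + 1) := by
  have hne : ∀ u, bl u ≠ 0 → u ≠ v := fun u hu he => hu (he ▸ hb)
  have hcase : ∀ u, Function.update bl v 1 u ≠ 0 → u = v ∨ (u ≠ v ∧ bl u ≠ 0) := by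
    intro u hu
    by_cases huv : u = v
    · exact Or.inl huv
    · rw [Function.update_of_ne huv] at hu
      exact Or.inr ⟨huv, hu⟩
  have hset : ∀ k, k ≤ cnt → {u | Function.update bl v 1 u ≠ 0 ∧ Function.update pos v cnt u < k} =
      {u | bl u ≠ 0 ∧ pos u < k} := by
    intro k hk
    ext u
    by_cases huv : u = v
    · subst huv
      simp [hb, hk]
    · simp [huv]
  refine ⟨?_, ?_, ?_, ?_, ?_⟩
  · intro u hu
    rcases hcase u hu with rfl | ⟨_, h1⟩
    · exact hv
    · exact h.lt u h1
  · intro u hu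
    rcases hcase u hu with rfl | ⟨h0, h1⟩
    · simp
    · rw [Function.update_of_ne h0]
      have := h.pos_lt u h1
      omega
  · intro u u' hu hu'
    rcases hcase u hu with rfl | ⟨h0, h1⟩ <;> rcases hcase u' hu' with rfl | ⟨h0', h1'⟩
    · simp
    · rw [Function.update_of_ne h0', Function.update_self]
      have := h.pos_lt u' h1'
      omega
    · rw [Function.update_of_ne h0, Function.update_self]
      have := h.pos_lt u h1
      omega
    · rw [Function.update_of_ne h0, Function.update_of_ne h0']
      exact h.inj u u' h1 h1'
  · have : marked n (Function.update bl v 1) = insert v (marked n bl) := by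
      ext u
      rw [Finset.mem_insert, mem_marked, mem_marked]
      by_cases huv : u = v
      · subst huv; simp [hv]
      · simp [huv]
    rw [this, Finset.card_insert_of_notMem (by simp [mem_marked, hb]), h.cnt_eq]
  · intro u hu
    rcases hcase u hu with rfl | ⟨h0, h1⟩
    · rw [Function.update_self, hset cnt le_rfl]
      convert hw using 4
      ext x
      exact ⟨fun hx => hx.1, fun hx => ⟨hx, h.pos_lt x hx⟩⟩
    · rw [Function.update_of_ne h0, hset _ (h.pos_lt u h1).le]
      exact h.width u h1

/-- Places the vertices of the separator that was found, if any, and the vertex in register `12`. -/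
def placeProg : Prog :=
  .seq (.ite (.eq (.reg 23) (.lit 0)) .skip <|
    .forUp 3 (.reg 0) <|
      .ite (.and (.not (.eq (.get 14 (.reg 3)) (.lit 0)))
        (.and (.not (.eq (.get 5 (.reg 3)) (.lit 0))) (.eq (.get 13 (.reg 3)) (.lit 0))))
        (.seq (.putW 4 (.reg 3) (.lit 1)) <| .seq (.putW 16 (.reg 3) (.reg 24)) <|
          .setW 24 (.add (.reg 24) (.lit 1))) .skip) <|
  .ite (.eq (.get 4 (.reg 12)) (.lit 0))
    (.seq (.putW 4 (.reg 12) (.lit 1)) <| .seq (.putW 16 (.reg 12) (.reg 24)) <|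
          .setW 24 (.add (.reg 24) (.lit 1))) .skip

/-- Computes in array `16` an elimination order. -/
def orderProg : Prog :=
  .while (.not (.le (.reg 0) (.reg 24))) <|
    .seq (.forUp 3 (.reg 0) (.ite (.eq (.get 4 (.reg 3)) (.lit 0)) (.setW 12 (.reg 3)) .skip)) <|
    .seq compProg <| .seq listProg <| .seq sepProg placeProg

/-- While `X` is only partly placed, the sole available bound for a neighbourhood is its old size
plus the size of `X`. This is the reason for the slack `x` within `w`. -/
theorem placeProg_spec {M n r w x : ℕ} {R : ℕ → ℕ → Prop} {s : State} (hM : n + 2 ≤ M)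
    (hR : IsAdj n R) (hn : s.wreg 0 = n) (hr : s.wreg 12 = r) (hrn : r < n)
    (hpl : IsPlaced n R w (s.warr 4) (s.warr 16) (s.wreg 24)) (X : Finset ℕ)
    (hX : ∀ v, v ∈ X ↔ s.wreg 23 ≠ 0 ∧ v < n ∧ s.warr 14 v ≠ 0 ∧ s.warr 5 v ≠ 0 ∧ s.warr 13 v = 0)
    (hXb : ∀ v ∈ X, s.warr 4 v = 0) (hXc : X.card ≤ x)
    (hw : ∀ v < n, s.warr 4 v = 0 → (nbF n R {u | s.warr 4 u ≠ 0} v).card + x ≤ w) (hrb : s.warr 4 r = 0) :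
    WP M placeProg (fun s' => Agree [3, 24] [4, 16] [] [] s s' ∧
      IsPlaced n R w (s'.warr 4) (s'.warr 16) (s'.wreg 24) ∧
      ∀ v, s'.warr 4 v ≠ 0 ↔ s.warr 4 v ≠ 0 ∨ v ∈ X ∨ v = r) s := by
  have hM2 : 2 ≤ M := by omega
  refine WP.agree _ _ _ _ (by decide) ?_
  have hwid : ∀ bl : ℕ → ℕ, (∀ v, s.warr 4 v ≠ 0 → bl v ≠ 0) →
      (∀ v, bl v ≠ 0 → s.warr 4 v ≠ 0 ∨ v ∈ X) → ∀ v < n, s.warr 4 v = 0 →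
      (nbF n R {u | bl u ≠ 0} v).card ≤ w := by
    intro bl h1 h2 v hv hv4
    have := (Finset.card_le_card (nbF_subset_union (v := v) hR (P := {u | s.warr 4 u ≠ 0})
      (P' := {u | bl u ≠ 0}) h1 (X := X) h2)).trans (Finset.card_union_le _ _)
    have := hw v hv hv4
    omega
  refine WP.seq hM2 ?_
  have hfirst : WP M (.ite (.eq (.reg 23) (.lit 0)) .skip <|
    .forUp 3 (.reg 0) <|
      .ite (.and (.not (.eq (.get 14 (.reg 3)) (.lit 0)))
        (.and (.not (.eq (.get 5 (.reg 3)) (.lit 0))) (.eq (.get 13 (.reg 3)) (.lit 0))))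
        (.seq (.putW 4 (.reg 3) (.lit 1)) <| .seq (.putW 16 (.reg 3) (.reg 24)) <|
          .setW 24 (.add (.reg 24) (.lit 1))) .skip)
      (fun s' => Agree [3, 24] [4, 16] [] [] s s' ∧
        IsPlaced n R w (s'.warr 4) (s'.warr 16) (s'.wreg 24) ∧
        ∀ v, s'.warr 4 v ≠ 0 ↔ s.warr 4 v ≠ 0 ∨ v ∈ X) s := by
    refine WP.agree _ _ _ _ (by decide) ?_
    refine WP.ite hM2 ?_ ?_ <;> intro hc <;> simp only [Test.holds, WExpr.eval] at hc
    · refine WP.skip hM2 ⟨hpl, fun v => ?_⟩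
      simp [hX, hc]
    refine WP.forUp hM2 [24] [4, 16] [] [] (by decide) n (by omega)
      (fun s' h => by simp [h.wreg, hn])
      (fun j s' => IsPlaced n R w (s'.warr 4) (s'.warr 16) (s'.wreg 24) ∧
        ∀ v, s'.warr 4 v ≠ 0 ↔ s.warr 4 v ≠ 0 ∨ (v < j ∧ v ∈ X)) (by simpa using hpl) ?_ ?_
    · rintro j s1 hj hA hi ⟨h1, h2⟩
      have e14 : s1.warr 14 = s.warr 14 := by simp [hA.warr]
      have e13 : s1.warr 13 = s.warr 13 := by simp [hA.warr]
      have e5 : s1.warr 5 = s.warr 5 := by simp [hA.warr]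
      refine WP.ite hM2 ?_ ?_ <;> intro hc' <;>
        simp only [Test.holds, WExpr.eval, hi, e14, e13, e5] at hc'
      · have hjX : j ∈ X := (hX j).2 ⟨hc, hj, hc'⟩
        have hj4 : s1.warr 4 j = 0 := by
          by_contra hcon
          rcases (h2 j).1 hcon with h | h
          · exact h (hXb j hjX)
          · omega
        refine WP.seq hM2 (WP.putW hM2 (WP.seq hM2 (WP.putW hM2 (WP.setW hM2 ?_))))
        simp only [setW_warr, setW_wreg, putW_warr, WExpr.eval, putW_wreg, reduceIte,
          Nat.reduceEqDiff, hi]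
        refine ⟨h1.place hj hj4 (hwid _ (fun v hv => (h2 v).2 (Or.inl hv))
          (fun v hv => ((h2 v).1 hv).imp_right And.right) j hj (hXb j hjX)), fun v => ?_⟩
        by_cases hvj : v = j
        · subst hvj
          simp [hjX]
        · rw [Function.update_of_ne hvj, h2, show v < j + 1 ↔ v < j by omega]
      · refine WP.skip hM2 ?_
        simp only [setW_warr, setW_wreg, Nat.reduceEqDiff, reduceIte]
        refine ⟨h1, fun v => ?_⟩
        rw [h2]
        refine or_congr_right ⟨fun h => ⟨by omega, h.2⟩, fun h => ⟨?_, h.2⟩⟩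
        rcases Nat.lt_succ_iff_lt_or_eq.1 h.1 with h' | rfl
        · exact h'
        · exact absurd ((hX v).1 h.2).2.2 hc'
    · rintro s1 hA ⟨h1, h2⟩
      refine ⟨h1, fun v => ?_⟩
      rw [h2]
      exact or_congr_right ⟨fun h => h.2, fun h => ⟨((hX v).1 h).2.1, h⟩⟩
  refine hfirst.mono ?_
  rintro s1 ⟨hA, h1, h2⟩
  have e12 : s1.wreg 12 = r := by simp [hA.wreg, hr]
  refine WP.ite hM2 ?_ ?_ <;> intro hc <;> simp only [Test.holds, WExpr.eval, e12] at hc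
  · refine WP.seq hM2 (WP.putW hM2 (WP.seq hM2 (WP.putW hM2 (WP.setW hM2 ?_))))
    simp only [setW_warr, setW_wreg, putW_warr, WExpr.eval, putW_wreg, reduceIte,
      Nat.reduceEqDiff, e12]
    refine ⟨h1.place hrn hc (hwid _ (fun v hv => (h2 v).2 (Or.inl hv))
      (fun v hv => (h2 v).1 hv) r hrn hrb), fun v => ?_⟩
    by_cases hvr : v = r
    · subst hvr
      simp
    · rw [Function.update_of_ne hvr, h2]
      simp [hvr]
  · refine WP.skip hM2 ⟨h1, fun v => ?_⟩
    rw [h2]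
    constructor
    · rintro (h | h)
      · exact Or.inl h
      · exact Or.inr (Or.inl h)
    · rintro (h | h | rfl)
      · exact Or.inl h
      · exact Or.inr h
      · exact (h2 v).1 hc

/-- The invariant is that every component of unplaced vertices has at most `thr` placed neighbours.
In between, `X` adds at most `thr` more, whence the final width `2 * thr`. Each round places at
least the vertex `r`, so there are at most `n` rounds. -/
theorem orderProg_spec {M n L thr : ℕ} {R : ℕ → ℕ → Prop} {s : State} (hM : n + L + 2 ≤ M)
    (hM' : 2 ^ thr ≤ M) (hR : IsAdj n R) (hs : HasArcs R n L s)
    (h4 : ∀ v, s.warr 4 v = 0) (h24 : s.wreg 24 = 0)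
    (hU : ∀ W C : Finset ℕ, (∀ v ∈ W, v < n) → thr ≤ W.card → Disjoint C W →
      ∃ A ⊆ W, 2 * A.card ≤ W.card ∧ ¬ Linked R A C W) :
    WP M orderProg (fun s' => Agree [3, 4, 10, 12, 13, 14, 15, 16, 17, 18, 19, 20, 21, 22, 23, 24, 25]
        [4, 5, 6, 7, 8, 9, 10, 11, 12, 13, 14, 15, 16] [] [] s s' ∧
      (∀ v < n, s'.warr 16 v < n) ∧
      (∀ u < n, ∀ v < n, s'.warr 16 u = s'.warr 16 v → u = v) ∧
      ∀ v < n, (nbF n R {u | u < n ∧ s'.warr 16 u < s'.warr 16 v} v).card ≤ 2 * thr) s := by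
  classical
  have hM2 : 2 ≤ M := by omega
  refine WP.agree _ _ _ _ (by decide) ?_
  refine WP.whileDo hM2 [3, 4, 10, 12, 13, 14, 15, 16, 17, 18, 19, 20, 21, 22, 23, 24, 25]
        [4, 5, 6, 7, 8, 9, 10, 11, 12, 13, 14, 15, 16] [] [] (by decide)
    (fun s' => IsPlaced n R (2 * thr) (s'.warr 4) (s'.warr 16) (s'.wreg 24) ∧
      ∀ v < n, s'.warr 4 v = 0 → (nbF n R {u | s'.warr 4 u ≠ 0} v).card ≤ thr)
    (fun s' => n - s'.wreg 24) (by omega) ?_ ?_ ?_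
  · refine ⟨⟨fun u hu => absurd (h4 u) hu, fun u hu => absurd (h4 u) hu,
      fun u v hu => absurd (h4 u) hu, ?_, fun u hu => absurd (h4 u) hu⟩, fun v hv _ => ?_⟩
    · rw [h24]; symm; simp [marked, h4]
    · have : nbF n R {u | s.warr 4 u ≠ 0} v = ∅ := by
        rw [Finset.eq_empty_iff_forall_notMem]
        intro u hu
        exact ((mem_nbF hR).1 hu).1 (h4 u)
      simp [this]
  · rintro s1 hA1 ⟨i1, i2⟩ hc
    have hs1 := hs.of_agree hA1 (by decide)
    simp only [Test.holds, WExpr.eval, hs1.n_eq, not_le] at hc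
    have hex : ∃ v < n, s1.warr 4 v = 0 := by
      by_contra! hcon
      have : marked n (s1.warr 4) = Finset.range n := by
        ext v; rw [mem_marked, Finset.mem_range]
        exact ⟨fun h => h.1, fun h => ⟨h, hcon v h⟩⟩
      have h := i1.cnt_eq
      rw [this, Finset.card_range] at h
      omega
    refine WP.seq hM2 ?_
    refine WP.forUp hM2 [12] [] [] [] (by decide) n (by omega)
      (fun s' h => by simp [h.wreg, hs1.n_eq])
      (fun j s' => (∃ v < j, s1.warr 4 v = 0) → s'.wreg 12 < n ∧ s1.warr 4 (s'.wreg 12) = 0)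
      (by simp) ?_ ?_
    · intro j s2 hj hA2 hi hI
      have e4 : s2.warr 4 = s1.warr 4 := by simp [hA2.warr]
      refine WP.ite hM2 ?_ ?_ <;> intro hc' <;> simp only [Test.holds, WExpr.eval, e4, hi] at hc'
      · exact WP.setW hM2 fun _ => by simp [hi, hj, hc']
      · refine WP.skip hM2 ?_
        rintro ⟨v, hv, hv4⟩
        simp only [setW_wreg, Nat.reduceEqDiff, reduceIte]
        rcases Nat.lt_succ_iff_lt_or_eq.1 hv with h | rfl
        · exact hI ⟨v, h, hv4⟩
        · exact absurd hv4 hc'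
    intro s2 hA2 hI
    obtain ⟨hrn, hr4⟩ := hI hex
    obtain ⟨r, hr⟩ : ∃ r, s2.wreg 12 = r := ⟨_, rfl⟩
    rw [hr] at hrn hr4
    have e4 : s2.warr 4 = s1.warr 4 := by simp [hA2.warr]
    have hs2 := hs1.of_agree hA2 (by decide)
    refine WP.seq hM2 ((compProg_spec hM hR hs2 hr hrn).mono ?_)
    rw [e4]
    rintro s3 ⟨hA3, h5, h6⟩
    set P : Set ℕ := {u | s1.warr 4 u ≠ 0} with hP
    have hs3 := hs2.of_agree hA3 (by decide)
    refine WP.seq hM2 ((listProg_spec (M := M) (n := n) (by omega) hs3.n_eq).mono ?_)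
    rintro s4 ⟨hA4, hl⟩
    have hs4 := hs3.of_agree hA4 (by decide)
    have f5 : s4.warr 5 = s3.warr 5 := by simp [hA4.warr]
    have f6 : s4.warr 6 = s3.warr 6 := by simp [hA4.warr]
    have hrP : r ∉ P := fun h => h hr4
    have hWm : marked n (s3.warr 6) = nbF n R P r := by
      ext v
      rw [mem_marked]
      constructor
      · rintro ⟨hv, h⟩
        exact (mem_nbF hR).2 ((h6 v hv).1 h)
      · intro h
        have hn := (mem_nbF hR).1 h
        obtain ⟨c, -, hc⟩ := hn.2
        have hv := hR.lt (hR.symm hc)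
        exact ⟨hv, (h6 v hv).2 hn⟩
    have hCm : ∀ v, v ∈ marked n (s3.warr 5) ↔ Conn R P r v := by
      intro v
      rw [mem_marked]
      exact ⟨fun h => (h5 v h.1).1 h.2, fun h => ⟨h.lt hR hrn, (h5 v (h.lt hR hrn)).2 h⟩⟩
    have hk : s4.wreg 13 = (nbF n R P r).card := by rw [hl.card_eq, ← hWm]; rfl
    have hWle := i2 r hrn hr4
    have hd : ∀ v < n, s3.warr 5 v ≠ 0 → s3.warr 6 v = 0 := by
      intro v hv h
      by_contra hcon
      have h1 := (h5 v hv).1 h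
      exact h1.notMem hrP ((h6 v hv).1 hcon).1
    refine WP.seq hM2 ((sepProg_spec hM hR hs4 (by rw [f5, f6]; exact hd) (by rw [f6]; exact hl)
      ((Nat.pow_le_pow_right (by omega) (by omega)).trans hM')).mono ?_)
    rw [f5, f6, hWm]
    rintro s5 ⟨hA5, hno, hyes⟩
    have hs5 := hs4.of_agree hA5 (by decide)
    have g4 : s5.warr 4 = s1.warr 4 := by simp [hA5.warr, hA4.warr, hA3.warr, e4]
    have g5 : s5.warr 5 = s3.warr 5 := by simp [hA5.warr, f5]
    have g16 : s5.warr 16 = s1.warr 16 := by simp [hA5.warr, hA4.warr, hA3.warr, hA2.warr]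
    have g24 : s5.wreg 24 = s1.wreg 24 := by simp [hA5.wreg, hA4.wreg, hA3.wreg, hA2.wreg]
    have g12 : s5.wreg 12 = r := by simp [hA5.wreg, hA4.wreg, hA3.wreg, hr]
    let X : Finset ℕ := (Finset.range n).filter fun v =>
      s5.wreg 23 ≠ 0 ∧ s5.warr 14 v ≠ 0 ∧ s5.warr 5 v ≠ 0 ∧ s5.warr 13 v = 0
    have hXm : ∀ v, v ∈ X ↔ s5.wreg 23 ≠ 0 ∧ v < n ∧ s5.warr 14 v ≠ 0 ∧ s5.warr 5 v ≠ 0 ∧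
        s5.warr 13 v = 0 := by
      intro v; simp only [X, Finset.mem_filter, Finset.mem_range]; tauto
    have hXC : ∀ v ∈ X, Conn R P r v := by
      intro v hv
      obtain ⟨-, h1, -, h2, -⟩ := (hXm v).1 hv
      rw [g5] at h2
      exact (h5 v h1).1 h2
    have hmain : X.card ≤ thr ∧ ∀ P' : Set ℕ, (∀ v, v ∈ P' ↔ v ∈ P ∨ v ∈ X ∨ v = r) →
        ∀ v, v ∉ P' → Conn R P r v → (nbF n R P' v).card ≤ thr := by
      by_cases h23 : s5.wreg 23 = 0
      · have hX0 : X = ∅ := by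
          rw [Finset.eq_empty_iff_forall_notMem]
          intro v hv
          exact ((hXm v).1 hv).1 h23
        -- If all subsets can be linked, `hU` excludes a neighbourhood of size `thr`. Then `r` may
        -- be placed alone, since one more neighbour is still admissible.
        have hlt : (nbF n R P r).card < thr := by
          by_contra! hcon
          obtain ⟨A, a1, a2, a3⟩ := hU (nbF n R P r) (marked n (s3.warr 5))
            (fun v hv => by
              obtain ⟨-, c, -, hc⟩ := (mem_nbF hR).1 hv
              exact hR.lt (hR.symm hc)) hcon (by
              rw [Finset.disjoint_left]
              intro v hv hv'
              exact ((hCm v).1 hv).notMem hrP ((mem_nbF hR).1 hv').1)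
          exact a3 (hno h23 A a1 a2)
        refine ⟨by simp [hX0], fun P' hP' v _ hcv => ?_⟩
        have hsub : nbF n R P' v ⊆ insert r (nbF n R P r) := by
          intro u hu
          rw [Finset.mem_insert]
          rcases (hP' u).1 ((mem_nbF hR).1 hu).1 with h | h | h
          · exact Or.inr (nbF_conn_subset hR (fun x hx => (hP' x).2 (Or.inl hx)) hcv u hu h)
          · simp [hX0] at h
          · exact Or.inl h
        have := (Finset.card_le_card hsub).trans (Finset.card_insert_le _ _)
        omega
      · obtain ⟨A, hA⟩ := hyes h23
        have key : ∀ P' : Set ℕ, (∀ v, v ∈ P' ↔ v ∈ P ∨ v ∈ X ∨ v = r) →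
            X.card ≤ (nbF n R P r).card ∧ ∀ v, v ∉ P' → Conn R P r v →
              (nbF n R P' v).card ≤ (nbF n R P r).card := by
          intro P' hP'
          refine card_nbF_le_of_violation hR hrn hrP (A := A) hA.card_le ?_ hA.sub ?_ hA.lt
            (X := X) ?_ hP'
          · intro v hv
            exact (Finset.mem_union.1 (hA.left hv)).symm.imp_left (hCm v).1
          · intro v
            rw [hA.right, Finset.mem_union, hCm]
          · intro v
            rw [hXm, mem_marked, mem_marked, ← hCm, mem_marked, g5]
            constructor
            · rintro ⟨-, h1, h2, h3, h4⟩
              exact ⟨⟨h1, h2⟩, ⟨h1, h3⟩, fun h => h.2 h4⟩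
            · rintro ⟨⟨h1, h2⟩, ⟨-, h3⟩, h4⟩
              refine ⟨h23, h1, h2, h3, ?_⟩
              by_contra hcon
              exact h4 ⟨h1, hcon⟩
        exact ⟨(key {v | v ∈ P ∨ v ∈ X ∨ v = r} fun _ => Iff.rfl).1.trans hWle,
          fun P' hP' v hv hcv => ((key P' hP').2 v hv hcv).trans hWle⟩
    refine (placeProg_spec (M := M) (n := n) (R := R) (w := 2 * thr) (r := r) (x := thr)
      (by omega) hR hs5.n_eq g12 hrn (by rw [g4, g16, g24]; exact i1) X hXm ?_ hmain.1 ?_ ?_).mono ?_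
    · intro v hv
      rw [g4]
      have := (hXC v hv).notMem hrP
      simpa [hP] using this
    · intro v hv hv4
      rw [g4] at hv4 ⊢
      exact (Nat.add_le_add_right (i2 v hv hv4) thr).trans (by omega)
    · rw [g4]; exact hr4
    · rintro s6 ⟨hA6, h7, h8⟩
      rw [g4] at h8
      refine ⟨⟨h7, ?_⟩, ?_⟩
      · intro v hv hv4
        have hvP : v ∉ P := fun h => (h8 v).2 (Or.inl h) hv4
        by_cases hcv : Conn R P r v
        · exact hmain.2 _ h8 v (fun h => h hv4) hcv
        · refine (Finset.card_le_card (nbF_subset_of_not_conn hR (P := P) (r := r) ?_ ?_ hvP hcv)).trans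
            (i2 v hv (by simpa [hP] using hvP))
          · exact fun u hu => (h8 u).2 (Or.inl hu)
          · intro u hu
            rcases (h8 u).1 hu with h | h | rfl
            · exact Or.inl h
            · exact Or.inr (hXC u h)
            · exact Or.inr ReflTransGen.refl
      · have hlt : s1.wreg 24 < s6.wreg 24 := by
          rw [i1.cnt_eq, h7.cnt_eq]
          refine Finset.card_lt_card (Finset.ssubset_iff_of_subset ?_ |>.2 ⟨r, ?_, ?_⟩)
          · intro u hu
            rw [mem_marked] at hu ⊢
            exact ⟨hu.1, (h8 u).2 (Or.inl hu.2)⟩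
          · exact mem_marked.2 ⟨hrn, (h8 r).2 (Or.inr (Or.inr rfl))⟩
          · rw [mem_marked]; exact fun h => h.2 hr4
        omega
  · rintro s1 hA1 ⟨i1, i2⟩ hc
    have hs1 := hs.of_agree hA1 (by decide)
    simp only [Test.holds, WExpr.eval, hs1.n_eq, not_not] at hc
    have hall : marked n (s1.warr 4) = Finset.range n := by
      refine Finset.eq_of_subset_of_card_le (Finset.filter_subset _ _) ?_
      rw [Finset.card_range, ← i1.cnt_eq]
      exact hc
    have hall' : ∀ v < n, s1.warr 4 v ≠ 0 := fun v hv =>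
      (mem_marked.1 (hall ▸ Finset.mem_range.2 hv : v ∈ marked n (s1.warr 4))).2
    have hcnt : s1.wreg 24 = n := by rw [i1.cnt_eq, hall, Finset.card_range]
    refine ⟨fun v hv => hcnt ▸ i1.pos_lt v (hall' v hv),
      fun u hu v hv => i1.inj u v (hall' u hu) (hall' v hv), fun v hv => ?_⟩
    convert i1.width v (hall' v hv) using 4
    ext u
    exact and_congr_left fun _ => ⟨hall' u, i1.lt u⟩

end TutteTW

end

noncomputable section

namespace TutteTW

/-! ### Sums over colourings by elimination -/

/-- A graph on `{0, …, n - 1}` whose edges are given by numbers, together with an elimination of its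
vertices in decreasing order: `N i` is the neighbourhood of `i` at the time of its elimination, and
`par i` is `0` if it is empty, and its largest element plus one otherwise. -/
structure IsElim (n m : ℕ) (es et : ℕ → ℕ) (N : ℕ → Finset ℕ) (par : ℕ → ℕ) : Prop where
  lt : ∀ i < n, ∀ u ∈ N i, u < i
  edge_lt : ∀ e < m, es e < n ∧ et e < n
  edge_left : ∀ e < m, es e < et e → es e ∈ N (et e)
  edge_right : ∀ e < m, et e < es e → et e ∈ N (es e)
  par_zero : ∀ i < n, par i = 0 → N i = ∅
  par_mem : ∀ i < n, ∀ a, par i = a + 1 → a ∈ N i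
  par_sub : ∀ i < n, ∀ a, par i = a + 1 → ∀ u ∈ N i, u = a ∨ u ∈ N a

section Elim

variable (n m q : ℕ) (β : ℂ) (es et par : ℕ → ℕ)

/-- The weight of an edge in the Potts model. -/
def edgeWeight (e : ℕ) (c : ℕ → ℕ) : ℂ := if c (es e) = c (et e) then 1 + β else 1

/-- The message that the vertex `i` sends at its elimination. -/
def msg (i : ℕ) (c : ℕ → ℕ) : ℂ :=
  ∑ d ∈ Finset.range q,
    (∏ e ∈ Finset.range m, if max (es e) (et e) = i then
      edgeWeight β es et e (Function.update c i d) else 1) *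
    ∏ j ∈ (Finset.range n).attach, if _h : i < (j : ℕ) ∧ par j = i + 1 then
      msg j (Function.update c i d) else 1
termination_by n - i
decreasing_by
  have := Finset.mem_range.1 j.2
  omega

/-- The product of all weights and messages that belong to the vertex `i`. -/
def bucket (i : ℕ) (c : ℕ → ℕ) : ℂ :=
  (∏ e ∈ Finset.range m, if max (es e) (et e) = i then edgeWeight β es et e c else 1) *
    ∏ j ∈ Finset.range n, if par j = i + 1 then msg n m q β es et par j c else 1

variable {n m q β es et par} {N : ℕ → Finset ℕ}

/-- The guard `i < j` in `msg` is there for the recursion only; a vertex with parent `i` is larger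
than `i` anyway. -/
theorem msg_eq (h : IsElim n m es et N par) (i : ℕ) (c : ℕ → ℕ) :
    msg n m q β es et par i c =
      ∑ d ∈ Finset.range q, bucket n m q β es et par i (Function.update c i d) := by
  rw [msg]
  refine Finset.sum_congr rfl fun d _ => ?_
  unfold bucket
  congr 1
  rw [← Finset.prod_attach (Finset.range n)]
  refine Finset.prod_congr rfl fun j _ => ?_
  have hj := Finset.mem_range.1 j.2
  by_cases hp : par j = i + 1
  · have : i < (j : ℕ) := h.lt j hj i (h.par_mem j hj i hp)
    simp [hp, this]
  · simp [hp]

theorem edgeWeight_congr {e i : ℕ} (h : IsElim n m es et N par) (he : e < m)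
    (hi : max (es e) (et e) = i) {c c' : ℕ → ℕ} (hi' : c i = c' i) (hc : ∀ u ∈ N i, c u = c' u) :
    edgeWeight β es et e c = edgeWeight β es et e c' := by
  have h1 : c (es e) = c' (es e) ∧ c (et e) = c' (et e) := by
    rcases lt_trichotomy (es e) (et e) with hlt | heq | hlt
    · rw [max_eq_right hlt.le] at hi
      rw [hi]
      exact ⟨hc _ (hi ▸ h.edge_left e he hlt), hi'⟩
    · rw [heq, max_self] at hi
      rw [heq, hi]
      exact ⟨hi', hi'⟩
    · rw [max_eq_left hlt.le] at hi
      rw [hi]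
      exact ⟨hi', hc _ (hi ▸ h.edge_right e he hlt)⟩
  unfold edgeWeight
  rw [h1.1, h1.2]

/-- Descending induction on `i`: by `par_sub`, a vertex with parent `i` has its neighbourhood within
that of `i` and `i` itself, and the colour of `i` is summed out. -/
theorem msg_congr (h : IsElim n m es et N par) : ∀ k i, i < n → n - i ≤ k → ∀ c c' : ℕ → ℕ,
    (∀ u ∈ N i, c u = c' u) → msg n m q β es et par i c = msg n m q β es et par i c' := by
  intro k
  induction k with
  | zero => intro i hi hk; omega
  | succ k ih =>
    intro i hi hk c c' hc
    rw [msg_eq h, msg_eq h]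
    refine Finset.sum_congr rfl fun d _ => ?_
    have hc' : ∀ u ∈ N i, Function.update c i d u = Function.update c' i d u := by
      intro u hu
      have := (h.lt i hi u hu).ne
      rw [Function.update_of_ne this, Function.update_of_ne this, hc u hu]
    unfold bucket
    congr 1
    · refine Finset.prod_congr rfl fun e he => ?_
      split_ifs with hm
      · exact edgeWeight_congr h (Finset.mem_range.1 he) hm (by simp) hc'
      · rfl
    · refine Finset.prod_congr rfl fun j hj => ?_
      rw [Finset.mem_range] at hj
      split_ifs with hp
      · have hij := h.lt j hj i (h.par_mem j hj i hp)
        refine ih j hj (by omega) _ _ fun u hu => ?_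
        rcases h.par_sub j hj i hp u hu with rfl | hu
        · simp
        · exact hc' u hu
      · rfl

theorem bucket_congr (h : IsElim n m es et N par) {i : ℕ} {c c' : ℕ → ℕ} (hi : c i = c' i)
    (hc : ∀ u ∈ N i, c u = c' u) :
    bucket n m q β es et par i c = bucket n m q β es et par i c' := by
  unfold bucket
  congr 1
  · refine Finset.prod_congr rfl fun e he => ?_
    split_ifs with hm
    · exact edgeWeight_congr h (Finset.mem_range.1 he) hm hi hc
    · rfl
  · refine Finset.prod_congr rfl fun j hj => ?_
    rw [Finset.mem_range] at hj
    split_ifs with hp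
    · refine msg_congr h _ j hj le_rfl _ _ fun u hu => ?_
      rcases h.par_sub j hj i hp u hu with rfl | hu
      · exact hi
      · exact hc u hu
    · rfl

theorem edgeWeight_perm (σ : Equiv.Perm ℕ) (e : ℕ) (c : ℕ → ℕ) :
    edgeWeight β es et e (σ ∘ c) = edgeWeight β es et e c := by
  simp [edgeWeight]

/-- Weights only test colours for equality, and `σ` permutes the colours below `q`, over which the
sums run. -/
theorem msg_perm (h : IsElim n m es et N par) (σ : Equiv.Perm ℕ) (hσ : ∀ x, x < q ↔ σ x < q) :
    ∀ k i, i < n → n - i ≤ k → ∀ c : ℕ → ℕ,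
      msg n m q β es et par i (σ ∘ c) = msg n m q β es et par i c := by
  intro k
  induction k with
  | zero => intro i hi hk; omega
  | succ k ih =>
    intro i hi hk c
    rw [msg_eq h, msg_eq h]
    symm
    refine Finset.sum_bij (fun d _ => σ d) ?_ (fun _ _ _ _ he => σ.injective he) ?_ ?_
    · intro d hd
      rw [Finset.mem_range] at hd ⊢
      exact (hσ d).1 hd
    · intro d hd
      rw [Finset.mem_range] at hd
      exact ⟨σ.symm d, Finset.mem_range.2 ((hσ _).2 (by simpa using hd)), by simp⟩
    · intro d _
      have hu : Function.update (σ ∘ c) i (σ d) = σ ∘ Function.update c i d :=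
        (Function.comp_update σ c i d).symm
      rw [hu]
      unfold bucket
      congr 1
      · simp only [edgeWeight_perm]
      · refine Finset.prod_congr rfl fun j hj => ?_
        rw [Finset.mem_range] at hj
        split_ifs with hp
        · have hij := h.lt j hj i (h.par_mem j hj i hp)
          exact (ih j hj (by omega) _).symm
        · rfl

theorem bucket_perm (h : IsElim n m es et N par) (σ : Equiv.Perm ℕ) (hσ : ∀ x, x < q ↔ σ x < q)
    (i : ℕ) (c : ℕ → ℕ) :
    bucket n m q β es et par i (σ ∘ c) = bucket n m q β es et par i c := by
  unfold bucket
  congr 1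
  · simp only [edgeWeight_perm]
  · refine Finset.prod_congr rfl fun j hj => ?_
    rw [Finset.mem_range] at hj
    split_ifs with hp
    · exact msg_perm h σ hσ _ j hj le_rfl c
    · rfl

/-- By symmetry, all colours `d ≥ p` contribute the same as an unused colour `d₀ < p`. -/
theorem msg_eq_of_unused (h : IsElim n m es et N par) {i p d₀ : ℕ} {c : ℕ → ℕ} (hi : i < n)
    (hpq : p ≤ q) (hc : ∀ u ∈ N i, c u < p ∧ c u ≠ d₀) (hd₀ : d₀ < p) :
    msg n m q β es et par i c =
      ∑ d ∈ Finset.range p, bucket n m q β es et par i (Function.update c i d) +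
        ((q : ℂ) - p) * bucket n m q β es et par i (Function.update c i d₀) := by
  rw [msg_eq h, ← Finset.sum_range_add_sum_Ico _ hpq]
  congr 1
  have : ∀ d ∈ Finset.Ico p q, bucket n m q β es et par i (Function.update c i d) =
      bucket n m q β es et par i (Function.update c i d₀) := by
    intro d hd
    rw [Finset.mem_Ico] at hd
    -- The swap fixes the colours on `N i`, since these are below `p ≤ d` and different from `d₀`.
    rw [← bucket_perm h (Equiv.swap d d₀)]
    · refine bucket_congr h (by simp) fun u hu => ?_
      have hui := (h.lt i hi u hu).ne
      obtain ⟨h1, h2⟩ := hc u hu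
      rw [Function.comp_apply, Function.update_of_ne hui, Function.update_of_ne hui,
        Equiv.swap_apply_of_ne_of_ne (by omega) h2]
    · intro x
      rw [Equiv.swap_apply_def]
      split_ifs <;> omega
  rw [Finset.sum_congr rfl this, Finset.sum_const, Nat.card_Ico, nsmul_eq_mul, Nat.cast_sub hpq]

/-- The extension by zero of a colouring of the first `k` vertices. -/
def extZero {k q : ℕ} (σ : Fin k → Fin q) (u : ℕ) : ℕ := if h : u < k then σ ⟨u, h⟩ else 0

/-- The messages of the roots depend on no colour, so `c₀` is arbitrary. -/
theorem sum_prod_edgeWeight (h : IsElim n m es et N par) (c₀ : ℕ → ℕ) :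
    ∑ σ : Fin n → Fin q, ∏ e ∈ Finset.range m, edgeWeight β es et e (extZero σ) =
      ∏ i ∈ Finset.range n, if par i = 0 then msg n m q β es et par i c₀ else 1 := by
  -- What remains after the vertices `k, …, n - 1` have been summed out: the edges among the
  -- vertices below `k`, and the messages of eliminated vertices that are roots or have a parent
  -- below `k`. As `par` is shifted by one, the last condition reads `par j ≤ k`.
  let E : ℕ → (ℕ → ℕ) → ℂ := fun k c =>
    (∏ e ∈ Finset.range m, if max (es e) (et e) < k then edgeWeight β es et e c else 1) *
      ∏ j ∈ Finset.range n, if k ≤ j ∧ par j ≤ k then msg n m q β es et par j c else 1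
  have hpar : ∀ i < n, par i ≤ i := by
    intro i hi
    rcases hp : par i with _ | a
    · omega
    · have := h.lt i hi a (h.par_mem i hi a hp)
      omega
  -- Of the factors of `E (k + 1)` only those in the bucket of `k` see the colour of `k`; its sum is
  -- the message of `k`, which takes their place.
  have hE : ∀ k < n, ∀ c, ∑ d ∈ Finset.range q, E (k + 1) (Function.update c k d) = E k c := by
    intro k hk c
    have hsplit : ∀ d, E (k + 1) (Function.update c k d) =
        ((∏ e ∈ Finset.range m, if max (es e) (et e) < k then edgeWeight β es et e c else 1) *
          ∏ j ∈ Finset.range n, if k + 1 ≤ j ∧ par j ≤ k then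
            msg n m q β es et par j c else 1) *
        bucket n m q β es et par k (Function.update c k d) := by
      intro d
      unfold bucket
      rw [mul_mul_mul_comm]
      simp only [E]
      congr 1
      · rw [← Finset.prod_mul_distrib]
        refine Finset.prod_congr rfl fun e _ => ?_
        rcases lt_trichotomy (max (es e) (et e)) k with hlt | heq | hlt
        · rw [if_pos (by omega), if_pos hlt, if_neg hlt.ne, mul_one]
          unfold edgeWeight
          rw [Function.update_of_ne (by omega), Function.update_of_ne (by omega)]
        · rw [if_pos (by omega), if_neg (by omega), if_pos heq, one_mul]
        · rw [if_neg (by omega), if_neg (by omega), if_neg (by omega), one_mul]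
      · rw [← Finset.prod_mul_distrib]
        refine Finset.prod_congr rfl fun j hj => ?_
        rw [Finset.mem_range] at hj
        have hpj := hpar j hj
        by_cases h1 : par j = k + 1
        · rw [if_pos (by omega), if_neg (by omega), if_pos h1, one_mul]
        · rw [if_neg h1, mul_one]
          by_cases h2 : k + 1 ≤ j ∧ par j ≤ k
          · rw [if_pos (by omega), if_pos h2]
            refine msg_congr h _ j hj le_rfl _ _ fun u hu => ?_
            rw [Function.update_of_ne]
            rintro rfl
            rcases hp : par j with _ | a
            · rw [h.par_zero j hj hp] at hu
              simp at hu
            · rcases h.par_sub j hj a hp u hu with rfl | hu'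
              · omega
              · have := h.lt a (by omega) u hu'
                omega
          · rw [if_neg (by omega), if_neg h2]
    rw [Finset.sum_congr rfl fun d _ => hsplit d, ← Finset.mul_sum, ← msg_eq h]
    simp only [E]
    rw [mul_assoc]
    congr 1
    rw [mul_comm, ← Finset.mul_prod_erase _ _ (Finset.mem_range.2 hk),
      ← Finset.mul_prod_erase (Finset.range n) (fun j => if k ≤ j ∧ par j ≤ k then _ else _)
        (Finset.mem_range.2 hk), if_neg (by omega), one_mul, if_pos ⟨le_rfl, hpar k hk⟩]
    congr 1
    refine Finset.prod_congr rfl fun j hj => ?_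
    have := (Finset.mem_erase.1 hj).1
    have : k + 1 ≤ j ∧ par j ≤ k ↔ k ≤ j ∧ par j ≤ k := by omega
    simp only [this]
  have hT : ∀ k ≤ n, ∑ σ : Fin k → Fin q, E k (extZero σ) = E 0 (fun _ => 0) := by
    intro k
    induction k with
    | zero =>
      intro _
      rw [Fintype.sum_unique]
      rfl
    | succ k ih =>
      intro hk
      rw [← ih (by omega), ← (Fin.snocEquiv fun _ => Fin q).sum_comp, Fintype.sum_prod_type,
        Finset.sum_comm]
      refine Finset.sum_congr rfl fun σ _ => ?_
      rw [← hE k (by omega), ← Fin.sum_univ_eq_sum_range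
        (fun d => E (k + 1) (Function.update (extZero σ) k d))]
      refine Finset.sum_congr rfl fun d _ => ?_
      congr 1
      ext u
      simp only [extZero, Fin.snocEquiv_apply, Function.update_apply]
      by_cases h1 : u < k
      · have : (⟨u, by omega⟩ : Fin (k + 1)) = Fin.castSucc ⟨u, h1⟩ := rfl
        rw [dif_pos (by omega), if_neg (by omega), dif_pos h1, this, Fin.snoc_castSucc]
      · by_cases h2 : u = k
        · subst h2
          have : (⟨u, by omega⟩ : Fin (u + 1)) = Fin.last u := rfl
          rw [dif_pos (by omega), if_pos rfl, this, Fin.snoc_last]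
        · rw [dif_neg (by omega), if_neg h2, dif_neg h1]
  have h1 := hT n le_rfl
  have h2 : ∀ σ : Fin n → Fin q, E n (extZero σ) =
      ∏ e ∈ Finset.range m, edgeWeight β es et e (extZero σ) := by
    intro σ
    simp only [E]
    rw [Finset.prod_congr (s₁ := Finset.range m) rfl
      (fun e he => if_pos (max_lt_iff.2 (h.edge_lt e (Finset.mem_range.1 he)))),
      Finset.prod_eq_one (s := Finset.range n) (fun j hj => if_neg (by
        have := Finset.mem_range.1 hj; omega)), mul_one]
  simp only [h2] at h1
  rw [h1]
  simp only [E, Nat.not_lt_zero, if_false, Finset.prod_const_one, one_mul, Nat.zero_le, true_and,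
    Nat.le_zero]
  refine Finset.prod_congr rfl fun i hi => ?_
  rw [Finset.mem_range] at hi
  split_ifs with hp
  · refine msg_congr h _ i hi le_rfl _ _ fun u hu => ?_
    rw [h.par_zero i hi hp] at hu
    simp at hu
  · rfl

end Elim

end TutteTW

end

noncomputable section

namespace TutteTW

open Relation

/-! ### The Tutte polynomial and the Potts model -/

namespace MGraph

variable {n m : ℕ} (G : MGraph n m)

theorem spanning_adj {A : Finset (Fin m)} {u v : Fin n} : (G.spanning A).Adj u v ↔
    u ≠ v ∧ ((∃ e ∈ A, G.src e = u ∧ G.tgt e = v) ∨ ∃ e ∈ A, G.src e = v ∧ G.tgt e = u) :=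
  SimpleGraph.fromRel_adj _ _ _

theorem reachable_of_mem {A : Finset (Fin m)} {e : Fin m} (he : e ∈ A) :
    (G.spanning A).Reachable (G.src e) (G.tgt e) := by
  by_cases h : G.src e = G.tgt e
  · rw [h]
  · exact SimpleGraph.Adj.reachable (G.spanning_adj.2 ⟨h, Or.inl ⟨e, he, rfl, rfl⟩⟩)

/-- A function that is constant along the edges in `A` is constant on the components. -/
theorem eq_of_reachable {A : Finset (Fin m)} {α : Type*} {f : Fin n → α}
    (hf : ∀ e ∈ A, f (G.src e) = f (G.tgt e)) {u v : Fin n}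
    (h : (G.spanning A).Reachable u v) : f u = f v := by
  rw [SimpleGraph.reachable_iff_reflTransGen] at h
  induction h with
  | refl => rfl
  | tail _ h ih =>
    rw [ih]
    rcases (G.spanning_adj.1 h).2 with ⟨e, he, rfl, rfl⟩ | ⟨e, he, rfl, rfl⟩
    · exact hf e he
    · exact (hf e he).symm

/-- Functions that are constant along the edges in `A` are functions on components. -/
def constEquiv (A : Finset (Fin m)) (α : Type*) :
    {f : Fin n → α // ∀ e ∈ A, f (G.src e) = f (G.tgt e)} ≃
      ((G.spanning A).ConnectedComponent → α) where
  toFun f c := c.lift f.1 fun _ _ p _ => G.eq_of_reachable f.2 p.reachable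
  invFun g := ⟨fun v => g ((G.spanning A).connectedComponentMk v), fun e he =>
    congrArg g (SimpleGraph.ConnectedComponent.eq.2 (G.reachable_of_mem he))⟩
  left_inv f := by ext v; rfl
  right_inv g := by
    ext c
    induction c using SimpleGraph.ConnectedComponent.ind
    rfl

theorem numComp_le (A : Finset (Fin m)) : G.numComp A ≤ n := by
  have := Nat.card_le_card_of_surjective (G.spanning A).connectedComponentMk Quot.mk_surjective
  rwa [Nat.card_fin] at this

theorem numComp_univ_le (A : Finset (Fin m)) : G.numComp Finset.univ ≤ G.numComp A := by
  have hle : G.spanning A ≤ G.spanning Finset.univ := by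
    intro u v h
    rw [spanning_adj] at h ⊢
    refine ⟨h.1, h.2.imp ?_ ?_⟩ <;> rintro ⟨e, -, h⟩ <;> exact ⟨e, Finset.mem_univ e, h⟩
  refine Nat.card_le_card_of_surjective
    (SimpleGraph.ConnectedComponent.map (SimpleGraph.Hom.ofLE hle)) ?_
  intro c
  induction c using SimpleGraph.ConnectedComponent.ind with
  | h v => exact ⟨(G.spanning A).connectedComponentMk v, rfl⟩

/-- Rank plus nullity for the map that sends a function on the vertices to its differences along the
edges in `A`: the rank is at most |A|, and the kernel consists of functions on the components. This
makes the truncated exponent of y - 1 exact. -/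
theorem le_numComp_add_card (A : Finset (Fin m)) : n ≤ G.numComp A + A.card := by
  let f : (Fin n → ℚ) →ₗ[ℚ] (A → ℚ) :=
    { toFun := fun x e => x (G.src e) - x (G.tgt e)
      map_add' := fun x y => by ext e; simp only [Pi.add_apply]; ring
      map_smul' := fun c x => by ext e; simp [mul_sub] }
  let g : ((G.spanning A).ConnectedComponent → ℚ) →ₗ[ℚ] (Fin n → ℚ) :=
    { toFun := fun x v => x ((G.spanning A).connectedComponentMk v)
      map_add' := fun x y => rfl
      map_smul' := fun c x => rfl }
  have hker : LinearMap.ker f ≤ LinearMap.range g := by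
    intro x hx
    rw [LinearMap.mem_ker] at hx
    have hx' : ∀ e ∈ A, x (G.src e) = x (G.tgt e) := fun e he => by
      have := congrFun hx ⟨e, he⟩
      exact sub_eq_zero.1 this
    exact ⟨G.constEquiv A ℚ ⟨x, hx'⟩, rfl⟩
  have h1 := f.finrank_range_add_finrank_ker
  have h2 := Submodule.finrank_mono hker
  have h3 := g.finrank_range_le
  have h4 := Submodule.finrank_le (LinearMap.range f)
  have : Finite (G.spanning A).ConnectedComponent := Quot.finite _
  let _ := Fintype.ofFinite (G.spanning A).ConnectedComponent
  rw [Module.finrank_fintype_fun_eq_card] at h1 h3 h4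
  rw [Fintype.card_coe] at h4
  rw [← Nat.card_eq_fintype_card] at h3
  rw [Fintype.card_fin] at h1
  unfold numComp
  omega

/-- The expansion of Fortuin and Kasteleyn: multiply out the product over the edges, and count for
each `A` the colourings that are constant on its components. -/
theorem sum_colourings (q : ℕ) (β : ℂ) :
    ∑ σ : Fin n → Fin q, ∏ e, (if σ (G.src e) = σ (G.tgt e) then 1 + β else 1) =
      ∑ A : Finset (Fin m), (q : ℂ) ^ G.numComp A * β ^ A.card := by
  classical
  have h1 : ∀ σ : Fin n → Fin q, ∏ e, (if σ (G.src e) = σ (G.tgt e) then 1 + β else 1) =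
      ∑ A : Finset (Fin m), if ∀ e ∈ A, σ (G.src e) = σ (G.tgt e) then β ^ A.card else 0 := by
    intro σ
    have : ∀ e, (if σ (G.src e) = σ (G.tgt e) then 1 + β else 1) =
        1 + if σ (G.src e) = σ (G.tgt e) then β else 0 := by
      intro e; split_ifs <;> simp
    simp only [this]
    rw [Finset.prod_one_add, Finset.powerset_univ]
    refine Finset.sum_congr rfl fun A _ => ?_
    split_ifs with h
    · rw [Finset.prod_congr rfl fun e he => if_pos (h e he), Finset.prod_const]
    · push Not at h
      obtain ⟨e, he, h⟩ := h
      exact Finset.prod_eq_zero he (if_neg h)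
  simp only [h1]
  rw [Finset.sum_comm]
  refine Finset.sum_congr rfl fun A _ => ?_
  rw [← Finset.sum_filter, Finset.sum_const, nsmul_eq_mul]
  congr 1
  rw [← Fintype.card_subtype, ← Nat.card_eq_fintype_card, Nat.card_congr (G.constEquiv A (Fin q)),
    Nat.card_fun, Nat.card_eq_fintype_card, Fintype.card_fin]
  push_cast
  rfl

/-- With q = αβ, the two powers in the denominator do not depend on the edge set, so the identity
holds term by term. -/
theorem tutte_eq_sum_colourings {α β : ℕ} (hα : 0 < α) (hβ : 0 < β) :
    G.tutte (α + 1) (β + 1) =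
      (∑ σ : Fin n → Fin (α * β), ∏ e, (if σ (G.src e) = σ (G.tgt e) then 1 + (β : ℂ) else 1)) /
        (α : ℂ) ^ G.numComp Finset.univ / (β : ℂ) ^ n := by
  have hα' : (α : ℂ) ≠ 0 := Nat.cast_ne_zero.2 hα.ne'
  have hβ' : (β : ℂ) ≠ 0 := Nat.cast_ne_zero.2 hβ.ne'
  rw [sum_colourings, div_div, eq_div_iff (mul_ne_zero (pow_ne_zero _ hα') (pow_ne_zero _ hβ')),
    tutte, Finset.sum_mul]
  refine Finset.sum_congr rfl fun A _ => ?_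
  have h1 := G.numComp_univ_le A
  have h2 := G.le_numComp_add_card A
  rw [add_sub_cancel_right, add_sub_cancel_right, Nat.cast_mul, mul_pow]
  calc (α : ℂ) ^ (G.numComp A - G.numComp Finset.univ) * (β : ℂ) ^ (G.numComp A + A.card - n) *
        ((α : ℂ) ^ G.numComp Finset.univ * (β : ℂ) ^ n) =
      (α : ℂ) ^ (G.numComp A - G.numComp Finset.univ + G.numComp Finset.univ) *
        (β : ℂ) ^ (G.numComp A + A.card - n + n) := by ring
    _ = _ := by
      rw [Nat.sub_add_cancel h1, Nat.sub_add_cancel h2]; ring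

/-! ### Interpolation -/

theorem eval_eq_lagrange {k : ℕ} (f : Polynomial ℂ) (hf : f.natDegree ≤ k) (v : ℕ → ℂ)
    (hv : Function.Injective v) (a : ℂ) :
    f.eval a = ∑ i ∈ Finset.range (k + 1), f.eval (v i) *
      ∏ j ∈ Finset.range (k + 1), if j = i then 1 else (a - v j) / (v i - v j) := by
  have h := Lagrange.eq_interpolate (s := Finset.range (k + 1)) (v := v) (f := f) hv.injOn (by
    rw [Finset.card_range]
    exact (Polynomial.degree_le_of_natDegree_le hf).trans_lt (by exact_mod_cast Nat.lt_succ_self k))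
  conv_lhs => rw [h, Lagrange.interpolate_apply, Polynomial.eval_finsetSum]
  refine Finset.sum_congr rfl fun i hi => ?_
  rw [Polynomial.eval_mul, Polynomial.eval_C, Lagrange.basis, Polynomial.eval_prod]
  congr 1
  rw [← Finset.mul_prod_erase _ _ hi, if_pos rfl, one_mul]
  refine Finset.prod_congr rfl fun j hj => ?_
  rw [if_neg (Finset.mem_erase.1 hj).1]
  simp [Lagrange.basisDivisor, div_eq_inv_mul]

/-- The first exponent is at most k(A) ≤ n, and the second at most |A| ≤ m because k(A) ≤ n.
Interpolation is done in x and then in y. -/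
theorem tutte_eq_lagrange (v w : ℕ → ℂ) (hv : Function.Injective v) (hw : Function.Injective w)
    (a b : ℂ) :
    G.tutte a b = ∑ i ∈ Finset.range (n + 1), ∑ j ∈ Finset.range (m + 1), G.tutte (v i) (w j) *
      (∏ i' ∈ Finset.range (n + 1), if i' = i then 1 else (a - v i') / (v i - v i')) *
      ∏ j' ∈ Finset.range (m + 1), if j' = j then 1 else (b - w j') / (w j - w j') := by
  open Polynomial in
  have hx : ∀ y x : ℂ, G.tutte x y = (∑ A : Finset (Fin m),
      (X - 1) ^ (G.numComp A - G.numComp Finset.univ) *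
        C ((y - 1) ^ (G.numComp A + A.card - n)) : ℂ[X]).eval x := by
    intro y x
    simp [tutte, eval_finsetSum]
  have hy : ∀ x y : ℂ, G.tutte x y = (∑ A : Finset (Fin m),
      C ((x - 1) ^ (G.numComp A - G.numComp Finset.univ)) *
        (X - 1) ^ (G.numComp A + A.card - n) : ℂ[X]).eval y := by
    intro x y
    simp [tutte, eval_finsetSum]
  rw [hx b a, eval_eq_lagrange (k := n) _ ?_ v hv a]
  · refine Finset.sum_congr rfl fun i _ => ?_
    rw [← hx, hy (v i) b, eval_eq_lagrange (k := m) _ ?_ w hw b, Finset.sum_mul]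
    · refine Finset.sum_congr rfl fun j _ => ?_
      rw [← hy, mul_right_comm]
    · refine natDegree_sum_le_of_forall_le _ _ fun A _ => ?_
      refine (natDegree_C_mul_le _ _).trans ((natDegree_pow_le_of_le (m := 1) _ ?_).trans ?_)
      · exact (natDegree_X_sub_C_le (1 : ℂ))
      · have := G.numComp_le A
        have : A.card ≤ m := (Finset.card_le_univ A).trans (by simp)
        omega
  · refine natDegree_sum_le_of_forall_le _ _ fun A _ => ?_
    refine (natDegree_mul_C_le _ _).trans ((natDegree_pow_le_of_le (m := 1) _ ?_).trans ?_)
    · exact (natDegree_X_sub_C_le (1 : ℂ))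
    · have := G.numComp_le A
      omega

/-! ### Relabelling -/

/-- The graph with vertices renamed. -/
def relabel (σ : Equiv.Perm (Fin n)) : MGraph n m := ⟨fun e => σ (G.src e), fun e => σ (G.tgt e)⟩

theorem numComp_relabel (σ : Equiv.Perm (Fin n)) (A : Finset (Fin m)) :
    (G.relabel σ).numComp A = G.numComp A := by
  have e : (G.relabel σ).spanning A ≃g G.spanning A :=
    { toEquiv := σ.symm
      map_rel_iff' := by
        intro u v
        simp only [spanning_adj, relabel, ne_eq, EmbeddingLike.apply_eq_iff_eq,
          ← Equiv.eq_symm_apply] }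
  exact Nat.card_congr e.connectedComponentEquiv

theorem tutte_relabel (σ : Equiv.Perm (Fin n)) (a b : ℂ) :
    (G.relabel σ).tutte a b = G.tutte a b := by
  simp only [tutte, numComp_relabel]

theorem nadj_relabel (σ : Equiv.Perm (Fin n)) {u v : Fin n} :
    (G.relabel σ).nadj (σ u) (σ v) ↔ G.nadj u v := by
  simp only [nadj, relabel, Fin.is_lt, true_and, Fin.val_inj, EmbeddingLike.apply_eq_iff_eq]

/-! ### Elimination in a graph -/

/-- The neighbourhood of `i` at its elimination in decreasing order. -/
def elimNb (i : ℕ) : Finset ℕ := nbF n G.nadj {u | u < i} i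

theorem lt_of_mem_elimNb {i u : ℕ} (h : u ∈ G.elimNb i) : u < i :=
  ((mem_nbF G.isAdj_nadj).1 h).1

/-- The parent of `i` is the largest element `a` of its neighbourhood. The component of `i` among
the vertices not below `i` is adjacent to `a`, hence contained in the component of `a` among the
vertices not below `a`; so every smaller neighbour is inherited by `a`. -/
theorem isElim {es et par : ℕ → ℕ} (hes : ∀ e : Fin m, es e = G.src e)
    (het : ∀ e : Fin m, et e = G.tgt e) (h0 : ∀ i < n, par i = 0 → G.elimNb i = ∅)
    (h1 : ∀ i < n, ∀ a, par i = a + 1 → a ∈ G.elimNb i ∧ ∀ u ∈ G.elimNb i, u ≤ a) :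
    IsElim n m es et G.elimNb par := by
  have hR := G.isAdj_nadj
  have hedge : ∀ u v, G.nadj u v → u < v → u ∈ G.elimNb v := fun u v huv hlt =>
    (mem_nbF hR).2 ⟨hlt, v, ReflTransGen.refl, hR.symm huv⟩
  have hadj : ∀ e < m, G.nadj (es e) (et e) := by
    intro e he
    rw [hes ⟨e, he⟩, het ⟨e, he⟩]
    exact ⟨Fin.is_lt _, Fin.is_lt _, Or.inr ⟨⟨e, he⟩, Or.inl ⟨rfl, rfl⟩⟩⟩
  refine ⟨fun i _ u hu => G.lt_of_mem_elimNb hu, fun e he => ⟨(hadj e he).1, (hadj e he).2.1⟩,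
    fun e he => hedge _ _ (hadj e he), fun e he => hedge _ _ (hR.symm (hadj e he)), h0,
    fun i hi a ha => (h1 i hi a ha).1, fun i hi a ha u hu => ?_⟩
  obtain ⟨h2, h3⟩ := h1 i hi a ha
  rcases (h3 u hu).eq_or_lt with h | hlt
  · exact Or.inl h
  · right
    obtain ⟨ha', c, hc, hca⟩ := (mem_nbF hR).1 h2
    obtain ⟨-, c', hc', hcu⟩ := (mem_nbF hR).1 hu
    replace ha' : a < i := ha'
    have hmono : ∀ {x y}, Conn G.nadj {u | u < i} x y → Conn G.nadj {u | u < a} x y :=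
      fun h => h.mono fun z hz => lt_trans hz ha'
    refine (mem_nbF hR).2 ⟨hlt, c', ?_, hcu⟩
    have hi' : i ∉ {u | u < i} := lt_irrefl i
    refine Conn.trans (v := c) (ReflTransGen.single ⟨hR.symm hca, ?_⟩) ?_
    · have : ¬ c < i := hc.notMem hi'
      exact fun h => this (lt_trans h ha')
    · exact (hmono (hc.symm hR hi')).trans (hmono hc')

/-- Each component of the graph contains exactly one vertex with empty neighbourhood at its
elimination, namely its smallest one. Thus k(E) is found by counting roots. -/
theorem numComp_univ_eq {par : ℕ → ℕ} (h0 : ∀ i < n, par i = 0 ↔ G.elimNb i = ∅) :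
    G.numComp Finset.univ = ((Finset.range n).filter fun i => par i = 0).card := by
  have hR := G.isAdj_nadj
  set K := G.spanning Finset.univ
  have hKadj : ∀ u v : Fin n, K.Adj u v → G.nadj u v := by
    intro u v h
    refine ⟨u.2, v.2, Or.inr ?_⟩
    rcases (G.spanning_adj.1 h).2 with ⟨e, -, h1, h2⟩ | ⟨e, -, h1, h2⟩
    · exact ⟨e, Or.inl ⟨by rw [h1], by rw [h2]⟩⟩
    · exact ⟨e, Or.inr ⟨by rw [h1], by rw [h2]⟩⟩
  have hreach : ∀ u v : Fin n, G.nadj u v → K.Reachable u v := by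
    rintro u v ⟨-, -, h | ⟨e, ⟨h1, h2⟩ | ⟨h1, h2⟩⟩⟩
    · rw [Fin.ext h]
    · rw [← Fin.ext h1, ← Fin.ext h2]
      exact G.reachable_of_mem (Finset.mem_univ e)
    · rw [← Fin.ext h1, ← Fin.ext h2]
      exact (G.reachable_of_mem (Finset.mem_univ e)).symm
  have hconn : ∀ (P : Set ℕ) (u : Fin n) (v : ℕ), Conn G.nadj P u v → ∃ hv : v < n,
      K.Reachable u ⟨v, hv⟩ := by
    intro P u v h
    induction h with
    | refl => exact ⟨u.2, SimpleGraph.Reachable.refl _⟩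
    | @tail b c _ hbc ih =>
      obtain ⟨hb, ih⟩ := ih
      exact ⟨hbc.1.2.1, ih.trans (hreach ⟨b, hb⟩ ⟨c, hbc.1.2.1⟩ hbc.1)⟩
  have hroot : ∀ j u : Fin n, G.elimNb j = ∅ → K.Reachable j u → (j : ℕ) ≤ u := by
    intro j u hj h
    rw [SimpleGraph.reachable_iff_reflTransGen] at h
    have : Conn G.nadj {x | x < (j : ℕ)} j u := by
      induction h with
      | refl => exact ReflTransGen.refl
      | @tail b c _ hbc ih =>
        refine ih.tail ⟨hKadj _ _ hbc, fun hc => ?_⟩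
        have : (c : ℕ) ∈ G.elimNb j := (mem_nbF hR).2 ⟨hc, b, ih, hKadj _ _ hbc⟩
        simp [hj] at this
    exact not_lt.1 (this.notMem (lt_irrefl (j : ℕ)))
  let S := {i : Fin n // par i = 0}
  have hbij : Function.Bijective fun i : S => K.connectedComponentMk i.1 := by
    constructor
    · intro i j hij
      have hij' := SimpleGraph.ConnectedComponent.eq.1 hij
      have h1 := hroot _ _ ((h0 _ i.1.2).1 i.2) hij'
      have h2 := hroot _ _ ((h0 _ j.1.2).1 j.2) hij'.symm
      exact Subtype.ext (Fin.ext (le_antisymm h1 h2))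
    · intro c
      induction c using SimpleGraph.ConnectedComponent.ind with
      | h v =>
      classical
      obtain ⟨i, hi, hmin⟩ := Finset.exists_min_image
        (Finset.univ.filter fun u : Fin n => K.Reachable u v) id ⟨v, by simp⟩
      simp only [Finset.mem_filter, Finset.mem_univ, true_and, id] at hi hmin
      refine ⟨⟨i, (h0 _ i.2).2 ?_⟩, SimpleGraph.ConnectedComponent.eq.2 hi⟩
      rw [Finset.eq_empty_iff_forall_notMem]
      intro u hu
      obtain ⟨h1, c, h2, h3⟩ := (mem_nbF hR).1 hu
      obtain ⟨hc, h4⟩ := hconn _ _ _ h2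
      have h5 := h4.trans (hreach ⟨c, hc⟩ ⟨u, h3.2.1⟩ h3)
      have h6 : (i : ℕ) ≤ u := hmin ⟨u, h3.2.1⟩ (h5.symm.trans hi)
      have h7 : u < (i : ℕ) := h1
      omega
  unfold numComp
  rw [← Nat.card_congr (Equiv.ofBijective _ hbij), Nat.card_eq_fintype_card, Fintype.card_subtype,
    ← Finset.card_image_of_injective _ (Fin.val_injective (n := n))]
  congr 1
  ext i
  simp only [Finset.mem_image, Finset.mem_filter, Finset.mem_univ, true_and, Finset.mem_range]
  constructor
  · rintro ⟨a, h, rfl⟩; exact ⟨a.2, h⟩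
  · rintro ⟨h1, h2⟩; exact ⟨⟨i, h1⟩, h2, rfl⟩

end MGraph

end TutteTW

end

noncomputable section

namespace TutteTW

open Relation

/-! ### Preparation of the elimination -/

/-- The graph `G` is stored in the registers `0`, `1` and the word arrays `0`, `1`. -/
structure HasGraph {n m : ℕ} (G : MGraph n m) (s : State) : Prop where
  n_eq : s.wreg 0 = n
  m_eq : s.wreg 1 = m
  src : ∀ e : Fin m, s.warr 0 e = G.src e
  tgt : ∀ e : Fin m, s.warr 1 e = G.tgt e

theorem HasGraph.of_agree {n m : ℕ} {G : MGraph n m} {s s' : State} (h : HasGraph G s)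
    {ws was ns nas : List ℕ} (hA : Agree ws was ns nas s s')
    (hk : (0 ∉ ws ∧ 1 ∉ ws) ∧ 0 ∉ was ∧ 1 ∉ was) : HasGraph G s' := by
  refine ⟨(hA.wreg 0 hk.1.1).trans h.n_eq, (hA.wreg 1 hk.1.2).trans h.m_eq, ?_, ?_⟩
  · rw [hA.warr 0 hk.2.1]; exact h.src
  · rw [hA.warr 1 hk.2.2]; exact h.tgt

/-- Lists the arcs of the graph. -/
def arcsProg : Prog :=
  .seq (.setW 2 (.add (.reg 0) (.add (.reg 1) (.reg 1)))) <|
  .seq (.forUp 3 (.reg 1) <|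
    .seq (.putW 2 (.reg 3) (.get 0 (.reg 3))) <| .seq (.putW 3 (.reg 3) (.get 1 (.reg 3))) <|
    .seq (.putW 2 (.add (.reg 1) (.reg 3)) (.get 1 (.reg 3)))
      (.putW 3 (.add (.reg 1) (.reg 3)) (.get 0 (.reg 3)))) <|
  .forUp 3 (.reg 0) <|
    .seq (.putW 2 (.add (.add (.reg 1) (.reg 1)) (.reg 3)) (.reg 3))
      (.putW 3 (.add (.add (.reg 1) (.reg 1)) (.reg 3)) (.reg 3))

/-- Each edge is listed in both directions and each vertex with itself, in three consecutive blocks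
of lengths `m`, `m` and `n`. -/
theorem arcsProg_spec {M n m : ℕ} {G : MGraph n m} {s : State} (hM : n + m + 2 ≤ M)
    (hs : HasGraph G s) :
    WP M arcsProg (fun s' => Agree [2, 3] [2, 3] [] [] s s' ∧
      HasArcs G.nadj n (n + (m + m)) s') s := by
  have hM2 : 2 ≤ M := by omega
  refine WP.mono (WP.agree [2, 3] [2, 3] [] [] (by decide) (Q := fun s' =>
    s'.wreg 2 = n + (m + m) ∧ (∀ e < m, s'.warr 2 e = s.warr 0 e ∧ s'.warr 3 e = s.warr 1 e ∧
      s'.warr 2 (m + e) = s.warr 1 e ∧ s'.warr 3 (m + e) = s.warr 0 e) ∧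
      ∀ v < n, s'.warr 2 (m + m + v) = v ∧ s'.warr 3 (m + m + v) = v) ?_) ?_
  · refine WP.seq hM2 (WP.setW hM2 (WP.seq hM2 ?_))
    refine WP.forUp hM2 [] [2, 3] [] [] (by decide) m (by omega)
      (fun s' h => by simp [h.wreg, hs.m_eq])
      (fun j s' => ∀ e < j, s'.warr 2 e = s.warr 0 e ∧ s'.warr 3 e = s.warr 1 e ∧
      s'.warr 2 (m + e) = s.warr 1 e ∧ s'.warr 3 (m + e) = s.warr 0 e) (by simp) ?_ ?_
    · intro j s1 hj hA hi hI
      have e0 : s1.warr 0 = s.warr 0 := by simp [hA.warr]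
      have e1 : s1.warr 1 = s.warr 1 := by simp [hA.warr]
      have em : s1.wreg 1 = m := by simp [hA.wreg, hs.m_eq]
      refine WP.seq hM2 (WP.putW hM2 (WP.seq hM2 (WP.putW hM2 (WP.seq hM2 (WP.putW hM2
        (WP.putW hM2 ?_))))))
      intro e he
      simp only [setW_warr, putW_warr, WExpr.eval, putW_wreg, reduceIte, Nat.reduceEqDiff,
        OfNat.zero_ne_ofNat, OfNat.one_ne_ofNat, e0, e1, em, hi, Function.update_apply]
      rcases Nat.lt_succ_iff_lt_or_eq.1 he with h | rfl
      · have := hI e h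
        simpa [h.ne, show e ≠ m + j by omega, show m + e ≠ j by omega] using this
      · simp
        exact ⟨fun h => by omega, fun h => by omega⟩
    · intro s1 hA hI
      have e2 : s1.wreg 2 = n + (m + m) := by simp [hA.wreg, hs.n_eq, hs.m_eq]
      have em : s1.wreg 1 = m := by simp [hA.wreg, hs.m_eq]
      refine WP.forUp hM2 [] [2, 3] [] [] (by decide) n (by omega)
        (fun s' h => by simp [h.wreg, hA.wreg, hs.n_eq])
        (fun j s' => (∀ e < m, s'.warr 2 e = s.warr 0 e ∧ s'.warr 3 e = s.warr 1 e ∧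
            s'.warr 2 (m + e) = s.warr 1 e ∧ s'.warr 3 (m + e) = s.warr 0 e) ∧
          ∀ v < j, s'.warr 2 (m + m + v) = v ∧ s'.warr 3 (m + m + v) = v)
        ⟨by simpa using hI, by simp⟩ ?_ ?_
      · rintro j s2 hj hA2 hi ⟨i1, i2⟩
        have em : s2.wreg 1 = m := by simp [hA2.wreg, em]
        refine WP.seq hM2 (WP.putW hM2 (WP.putW hM2 ?_))
        simp only [setW_warr, putW_warr, WExpr.eval, putW_wreg, reduceIte, Nat.reduceEqDiff,
          em, hi, Function.update_apply]
        refine ⟨fun e he => ?_, fun v hv => ?_⟩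
        · simpa [show e ≠ m + m + j by omega, show m + e ≠ m + m + j by omega] using i1 e he
        · rcases Nat.lt_succ_iff_lt_or_eq.1 hv with h | rfl
          · simpa [h.ne] using i2 v h
          · simp
      · rintro s2 hA2 ⟨i1, i2⟩
        exact ⟨by simp [hA2.wreg, e2], i1, i2⟩
  · rintro s1 ⟨hA, h1, h2, h3⟩
    refine ⟨hA, by simp [hA.wreg, hs.n_eq], h1, fun u v => ?_⟩
    constructor
    · rintro ⟨hu, hv, rfl | ⟨e, ⟨rfl, rfl⟩ | ⟨rfl, rfl⟩⟩⟩
      · exact ⟨m + m + u, by omega, h3 u hu⟩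
      · have := h2 e e.2
        exact ⟨e, by omega, by rw [this.1, hs.src], by rw [this.2.1, hs.tgt]⟩
      · have := h2 e e.2
        exact ⟨m + e, by omega, by rw [this.2.2.1, hs.tgt], by rw [this.2.2.2, hs.src]⟩
    · rintro ⟨e, he, rfl, rfl⟩
      by_cases c1 : e < m
      · have := h2 e c1
        rw [this.1, this.2.1, hs.src ⟨e, c1⟩, hs.tgt ⟨e, c1⟩]
        exact ⟨Fin.is_lt _, Fin.is_lt _, Or.inr ⟨⟨e, c1⟩, Or.inl ⟨rfl, rfl⟩⟩⟩
      · by_cases c2 : e < m + m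
        · obtain ⟨f, rfl⟩ := Nat.exists_eq_add_of_le (not_lt.1 c1)
          have c1 : f < m := by omega
          have := h2 f c1
          rw [this.2.2.1, this.2.2.2, hs.src ⟨f, c1⟩, hs.tgt ⟨f, c1⟩]
          exact ⟨Fin.is_lt _, Fin.is_lt _, Or.inr ⟨⟨f, c1⟩, Or.inr ⟨rfl, rfl⟩⟩⟩
        · obtain ⟨f, rfl⟩ := Nat.exists_eq_add_of_le (not_lt.1 c2)
          have c1 : f < n := by omega
          have := h3 f c1
          rw [this.1, this.2]
          exact ⟨c1, c1, Or.inl rfl⟩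

/-- Renames the vertices according to array `16`. -/
def relabelProg : Prog :=
  .forUp 3 (.reg 1) <| .seq (.putW 0 (.reg 3) (.get 16 (.get 0 (.reg 3))))
    (.putW 1 (.reg 3) (.get 16 (.get 1 (.reg 3))))

theorem relabelProg_spec {M n m : ℕ} {G : MGraph n m} {s : State} (hM : m + 2 ≤ M)
    (hs : HasGraph G s) (σ : Equiv.Perm (Fin n)) (hσ : ∀ v : Fin n, s.warr 16 v = σ v) :
    WP M relabelProg (fun s' => Agree [3] [0, 1] [] [] s s' ∧ HasGraph (G.relabel σ) s') s := by
  have hM2 : 2 ≤ M := by omega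
  refine WP.mono (WP.agree [3] [0, 1] [] [] (by decide) (Q := fun s' =>
    ∀ e : Fin m, s'.warr 0 e = σ (G.src e) ∧ s'.warr 1 e = σ (G.tgt e)) ?_) ?_
  · refine WP.forUp hM2 [] [0, 1] [] [] (by decide) m (by omega)
      (fun s' h => by simp [h.wreg, hs.m_eq])
      (fun j s' => ∀ e : Fin m, s'.warr 0 e = (if (e : ℕ) < j then (σ (G.src e) : ℕ) else G.src e) ∧
        s'.warr 1 e = (if (e : ℕ) < j then (σ (G.tgt e) : ℕ) else G.tgt e)) ?_ ?_ ?_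
    · intro e
      simp [hs.src, hs.tgt]
    · intro j s1 hj hA hi hI
      have e16 : s1.warr 16 = s.warr 16 := by simp [hA.warr]
      refine WP.seq hM2 (WP.putW hM2 (WP.putW hM2 ?_))
      intro e
      have hj' := hI ⟨j, hj⟩
      simp only [lt_irrefl, if_false] at hj'
      simp only [setW_warr, putW_warr, WExpr.eval, putW_wreg, reduceIte,
        one_ne_zero, zero_ne_one, OfNat.ofNat_ne_zero, hi, e16, hj', hσ,
        Function.update_apply]
      rcases lt_trichotomy (e : ℕ) j with h | h | h
      · simpa [h.ne, h, Nat.lt_succ_of_lt h] using hI e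
      · obtain rfl : e = ⟨j, hj⟩ := Fin.ext h
        simp
      · simpa [h.ne', show ¬ (e : ℕ) < j by omega, show ¬ (e : ℕ) < j + 1 by omega] using hI e
    · intro s1 hA hI e
      simpa using hI e
  · rintro s1 ⟨hA, h⟩
    exact ⟨hA, by simp [hA.wreg, hs.n_eq], by simp [hA.wreg, hs.m_eq], fun e => (h e).1,
      fun e => (h e).2⟩

/-- The elimination of `G` in decreasing order is stored in the arrays `17`, `18`, `19`, and the
number `p` of colours in register `27`. -/
structure HasElim {n m : ℕ} (G : MGraph n m) (p : ℕ) (s : State) : Prop where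
  p_eq : s.wreg 27 = p
  row : ∀ i < n, s.warr 17 i = i * n
  nb : ∀ i < n, ∀ u < n, s.warr 18 (i * n + u) ≠ 0 ↔ u ∈ G.elimNb i
  par_zero : ∀ i < n, s.warr 19 i = 0 ↔ G.elimNb i = ∅
  par_succ : ∀ i < n, ∀ a, s.warr 19 i = a + 1 → a ∈ G.elimNb i ∧ ∀ u ∈ G.elimNb i, u ≤ a
  card : ∀ i < n, (G.elimNb i).card + 2 ≤ p

/-- Computes the neighbourhoods of the elimination of the vertices in decreasing order. -/
def elimProg : Prog :=
  .seq (.forUp 3 (.reg 0) (.putW 4 (.reg 3) (.lit 0))) <|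
  .seq (.setW 27 (.lit 2)) <| .seq (.setW 28 (.lit 0)) <|
  .forUp 26 (.reg 0) <|
    .seq (.setW 12 (.reg 26)) <| .seq compProg <| .seq listProg <|
    .seq (.ite (.le (.reg 27) (.add (.reg 13) (.lit 1))) (.setW 27 (.add (.reg 13) (.lit 2))) .skip) <|
    .seq (.setW 29 (.lit 0)) <|
    .seq (.forUp 3 (.reg 0) <| .seq (.putW 18 (.add (.reg 28) (.reg 3)) (.get 6 (.reg 3))) <|
      .ite (.eq (.get 6 (.reg 3)) (.lit 0)) .skip (.setW 29 (.add (.reg 3) (.lit 1)))) <|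
    .seq (.putW 17 (.reg 26) (.reg 28)) <| .seq (.putW 19 (.reg 26) (.reg 29)) <|
    .seq (.setW 28 (.add (.reg 28) (.reg 0))) (.putW 4 (.reg 26) (.lit 1))

theorem Conn.congr {n : ℕ} {R : ℕ → ℕ → Prop} (hR : IsAdj n R) {P P' : Set ℕ}
    (h : ∀ u < n, u ∈ P ↔ u ∈ P') {r v : ℕ} (hc : Conn R P r v) : Conn R P' r v :=
  ReflTransGen.mono (fun _ b hb => ⟨hb.1, fun hp => hb.2 ((h b (hR.lt (hR.symm hb.1))).2 hp)⟩) _ _ hc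

theorem mem_nb_iff {n m : ℕ} (G : MGraph n m) {P : Set ℕ} {i u : ℕ} (hu : u < n)
    (h : ∀ u < n, u ∈ P ↔ u < i) : u ∈ nb G.nadj P i ↔ u ∈ G.elimNb i := by
  unfold MGraph.elimNb
  rw [mem_nbF G.isAdj_nadj]
  have h' : ∀ u < n, u ∈ P ↔ u ∈ {u | u < i} := h
  constructor
  · rintro ⟨h1, c, h2, h3⟩
    exact ⟨(h' u hu).1 h1, c, h2.congr G.isAdj_nadj h', h3⟩
  · rintro ⟨h1, c, h2, h3⟩
    exact ⟨(h' u hu).2 h1, c, h2.congr G.isAdj_nadj (fun u hu => (h' u hu).symm), h3⟩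

/-- With exactly the vertices below `i` marked in array `4`, the component search at `i` finds
`elimNb i`. Register `29` is overwritten at each neighbour in increasing order and so ends at the
largest one plus one. Row offsets are accumulated in register `28`, for lack of multiplication. -/
theorem elimProg_spec {M n m L w : ℕ} {G : MGraph n m} {s : State} (hM : n + L + 2 ≤ M)
    (hs : HasArcs G.nadj n L s) (hw : ∀ i < n, (G.elimNb i).card ≤ w) :
    WP M elimProg (fun s' => Agree [3, 10, 12, 13, 26, 27, 28, 29] [4, 5, 6, 7, 17, 18, 19] [] [] s s' ∧
      ∃ p ≤ w + 2, 2 ≤ p ∧ HasElim G p s') s := by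
  have hM2 : 2 ≤ M := by omega
  refine WP.agree _ _ _ _ (by decide) ?_
  refine WP.seq hM2 ?_
  refine WP.forUp hM2 [] [4] [] [] (by decide) n (by omega)
    (fun s' h => by simp [h.wreg, hs.n_eq])
    (fun j s' => ∀ v < j, s'.warr 4 v = 0) (by simp) ?_ ?_
  · intro j s1 hj hA hi hI
    refine WP.putW hM2 fun v hv => ?_
    rcases Nat.lt_succ_iff_lt_or_eq.1 hv with h | rfl
    · simp [hi, h.ne, hI v h]
    · simp [hi]
  intro s1 hA1 h4
  have hs1 := hs.of_agree hA1 (by decide)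
  refine WP.seq hM2 (WP.setW hM2 (WP.seq hM2 (WP.setW hM2 ?_)))
  refine WP.forUp hM2 [3, 10, 12, 13, 27, 28, 29] [4, 5, 6, 7, 17, 18, 19] [] [] (by decide) n
    (by omega) (fun s' h => by simp [h.wreg, hs1.n_eq])
    (fun j s' => s'.wreg 28 = j * n ∧ (∀ v < n, s'.warr 4 v ≠ 0 ↔ v < j) ∧
      2 ≤ s'.wreg 27 ∧ s'.wreg 27 ≤ w + 2 ∧
      ∀ i < j, s'.warr 17 i = i * n ∧ (∀ u < n, s'.warr 18 (i * n + u) ≠ 0 ↔ u ∈ G.elimNb i) ∧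
        (s'.warr 19 i = 0 ↔ G.elimNb i = ∅) ∧
        (∀ a, s'.warr 19 i = a + 1 → a ∈ G.elimNb i ∧ ∀ u ∈ G.elimNb i, u ≤ a) ∧
        (G.elimNb i).card + 2 ≤ s'.wreg 27) ?_ ?_ ?_
  · refine ⟨by simp, ?_, by simp, by simp, by simp⟩
    simpa using h4
  · rintro j s2 hj hA2 hi ⟨i1, i2, i3, i4, i5⟩
    have hs2 : HasArcs G.nadj n L s2 := by
      refine ⟨by simp [hA2.wreg, hs1.n_eq], by simp [hA2.wreg, hs1.L_eq], ?_⟩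
      simpa [hA2.warr] using hs1.iff
    refine WP.seq hM2 (WP.setW hM2 (WP.seq hM2 ?_))
    have hs2' : HasArcs G.nadj n L (s2.setW 12 j) :=
      ⟨by simp [hs2.n_eq], by simp [hs2.L_eq], by simpa using hs2.iff⟩
    simp only [WExpr.eval, hi]
    refine (compProg_spec (r := j) hM G.isAdj_nadj hs2' (by simp) hj).mono ?_
    rintro s3 ⟨hA3, -, h6⟩
    have hn3 : s3.wreg 0 = n := by simp [hA3.wreg, hs2.n_eq]
    refine WP.seq hM2 ((listProg_spec (M := M) (n := n) (by omega) hn3).mono ?_)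
    rintro s4 ⟨hA4, hl⟩
    have e6 : s4.warr 6 = s3.warr 6 := by simp [hA4.warr]
    have e28 : s4.wreg 28 = j * n := by simp [hA4.wreg, hA3.wreg, i1]
    have e27 : s4.wreg 27 = s2.wreg 27 := by simp [hA4.wreg, hA3.wreg]
    have e26 : s4.wreg 26 = j := by simp [hA4.wreg, hA3.wreg, hi]
    have e17 : s4.warr 17 = s2.warr 17 := by simp [hA4.warr, hA3.warr]
    have e18 : s4.warr 18 = s2.warr 18 := by simp [hA4.warr, hA3.warr]
    have e19 : s4.warr 19 = s2.warr 19 := by simp [hA4.warr, hA3.warr]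
    have e4 : s4.warr 4 = s2.warr 4 := by simp [hA4.warr, hA3.warr]
    have en : s4.wreg 0 = n := by simp [hA4.wreg, hn3]
    have h6' : ∀ v < n, s3.warr 6 v ≠ 0 ↔ v ∈ G.elimNb j := by
      intro v hv
      rw [h6 v hv]
      exact mem_nb_iff G hv (by simpa using i2)
    have hk : s4.wreg 13 = (G.elimNb j).card := by
      rw [hl.card_eq]
      congr 1
      ext v
      rw [Finset.mem_filter, Finset.mem_range]
      exact ⟨fun h => (h6' v h.1).1 h.2, fun h =>
        have hv := (G.lt_of_mem_elimNb h).trans hj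
        ⟨hv, (h6' v hv).2 h⟩⟩
    have hkw := hw j hj
    refine WP.seq hM2 (WP.mono (Q := fun s' => Agree [27] [] [] [] s4 s' ∧
      s2.wreg 27 ≤ s'.wreg 27 ∧ s'.wreg 27 ≤ w + 2 ∧ (G.elimNb j).card + 2 ≤ s'.wreg 27) ?_ ?_)
    · refine WP.agree _ _ _ _ (by decide) (WP.ite hM2 ?_ ?_) <;> intro hc <;>
        simp only [Test.holds, WExpr.eval, hk, e27] at hc
      · refine WP.setW hM2 ?_
        simp only [WExpr.eval, setW_wreg, reduceIte, hk]
        omega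
      · refine WP.skip hM2 ?_
        rw [e27]
        omega
    rintro s5 ⟨hA5, h27, h27', h27''⟩
    refine WP.seq hM2 (WP.setW hM2 (WP.seq hM2 ?_))
    have f6 : s5.warr 6 = s3.warr 6 := by simp [hA5.warr, e6]
    have f18 : s5.warr 18 = s2.warr 18 := by simp [hA5.warr, e18]
    have f28 : s5.wreg 28 = j * n := by simp [hA5.wreg, e28]
    refine WP.forUp hM2 [29] [18] [] [] (by decide) n
      (by omega) (fun s' h => by simp [h.wreg, hA5.wreg, en])
      (fun k s' => (∀ x < j * n, s'.warr 18 x = s2.warr 18 x) ∧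
        (∀ u < k, s'.warr 18 (j * n + u) = s3.warr 6 u) ∧
        (s'.wreg 29 = 0 → ∀ u < k, s3.warr 6 u = 0) ∧
        ∀ a, s'.wreg 29 = a + 1 → a < k ∧ s3.warr 6 a ≠ 0 ∧ ∀ u < k, s3.warr 6 u ≠ 0 → u ≤ a)
        ?_ ?_ ?_
    · simp [f18]
    · rintro k s6 hk hA6 hi6 ⟨k1, k2, k3, k4⟩
      have g6 : s6.warr 6 = s3.warr 6 := by simp [hA6.warr, f6]
      have g28 : s6.wreg 28 = j * n := by simp [hA6.wreg, f28]
      have k1' : ∀ x < j * n, Function.update (s6.warr 18) (j * n + k) (s3.warr 6 k) x =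
          s2.warr 18 x := by
        intro x hx
        rw [Function.update_of_ne (by omega), k1 x hx]
      have k2' : ∀ u < k + 1, Function.update (s6.warr 18) (j * n + k) (s3.warr 6 k) (j * n + u) =
          s3.warr 6 u := by
        intro u hu
        rcases Nat.lt_succ_iff_lt_or_eq.1 hu with h | rfl
        · rw [Function.update_of_ne (by omega), k2 u h]
        · simp
      refine WP.seq hM2 (WP.putW hM2 (WP.ite hM2 ?_ ?_)) <;> intro hc <;>
        simp [hi6, g6] at hc
      · refine WP.skip hM2 ?_
        simp only [setW_warr, putW_warr, WExpr.eval, putW_wreg, setW_wreg, reduceIte,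
          Nat.reduceEqDiff, hi6, g6, g28]
        refine ⟨k1', k2', ?_, ?_⟩
        · intro h0 u hu
          rcases Nat.lt_succ_iff_lt_or_eq.1 hu with h | rfl
          · exact k3 h0 u h
          · exact hc
        · intro a ha
          obtain ⟨q1, q2, q3⟩ := k4 a ha
          refine ⟨by omega, q2, fun u hu hu' => ?_⟩
          rcases Nat.lt_succ_iff_lt_or_eq.1 hu with h | rfl
          · exact q3 u h hu'
          · exact absurd hc hu'
      · refine WP.setW hM2 ?_
        simp only [setW_warr, putW_warr, WExpr.eval, putW_wreg, setW_wreg, reduceIte,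
          Nat.reduceEqDiff, hi6, g6, g28]
        refine ⟨k1', k2', fun h => h.elim, ?_⟩
        intro a ha
        have hka : k = a := by omega
        rw [← hka]
        exact ⟨Nat.lt_succ_self k, hc, fun u hu _ => Nat.lt_succ_iff.1 hu⟩
    rintro s6 hA6 ⟨k1, k2, k3, k4⟩
    have g4 : s6.warr 4 = s2.warr 4 := by simp [hA6.warr, hA5.warr, e4]
    have g17 : s6.warr 17 = s2.warr 17 := by simp [hA6.warr, hA5.warr, e17]
    have g19 : s6.warr 19 = s2.warr 19 := by simp [hA6.warr, hA5.warr, e19]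
    have g26 : s6.wreg 26 = j := by simp [hA6.wreg, hA5.wreg, e26]
    have g27 : s6.wreg 27 = s5.wreg 27 := by simp [hA6.wreg]
    have g28 : s6.wreg 28 = j * n := by simp [hA6.wreg, f28]
    have g0 : s6.wreg 0 = n := by simp [hA6.wreg, hA5.wreg, en]
    refine WP.seq hM2 (WP.putW hM2 (WP.seq hM2 (WP.putW hM2 (WP.seq hM2 (WP.setW hM2
      (WP.putW hM2 ?_))))))
    simp only [setW_warr, putW_warr, WExpr.eval, putW_wreg, setW_wreg, reduceIte,
          Nat.reduceEqDiff, g26, g28, g0, g27, g4, g17, g19, Function.update_apply]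
    refine ⟨by ring, ?_, by omega, by omega, ?_⟩
    · intro v hv
      split_ifs with h
      · simp [h]
      · rw [i2 v hv]; omega
    · intro i hij
      rcases Nat.lt_succ_iff_lt_or_eq.1 hij with h | rfl
      · obtain ⟨q1, q2, q3, q4, q5⟩ := i5 i h
        rw [if_neg h.ne, if_neg h.ne]
        refine ⟨q1, fun u hu => ?_, q3, q4, by omega⟩
        rw [k1, q2 u hu]
        -- Row `i` ends before row `j` begins, so writing row `j` leaves it intact.
        have : (i + 1) * n ≤ j * n := Nat.mul_le_mul_right n h
        rw [add_mul] at this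
        omega
      · rw [if_pos rfl, if_pos rfl]
        have hsub : ∀ u ∈ G.elimNb i, u < n ∧ s3.warr 6 u ≠ 0 := fun u hu =>
          have hun := (G.lt_of_mem_elimNb hu).trans hj
          ⟨hun, (h6' u hun).2 hu⟩
        refine ⟨rfl, fun u hu => by rw [k2 u hu, h6' u hu], ?_, ?_, h27''⟩
        · constructor
          · intro h0
            rw [Finset.eq_empty_iff_forall_notMem]
            intro u hu
            exact (hsub u hu).2 (k3 h0 u (hsub u hu).1)
          · intro h0
            by_contra hne
            obtain ⟨a, ha⟩ := Nat.exists_eq_succ_of_ne_zero hne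
            obtain ⟨q1, q2, -⟩ := k4 a ha
            have := (h6' a q1).1 q2
            simp [h0] at this
        · intro a ha
          obtain ⟨q1, q2, q3⟩ := k4 a ha
          exact ⟨(h6' a q1).1 q2, fun u hu => q3 u (hsub u hu).1 (hsub u hu).2⟩
  · rintro s2 hA2 ⟨i1, i2, i3, i4, i5⟩
    exact ⟨s2.wreg 27, i4, i3, rfl, fun i hi => (i5 i hi).1, fun i hi => (i5 i hi).2.1,
      fun i hi => (i5 i hi).2.2.1, fun i hi => (i5 i hi).2.2.2.1, fun i hi => (i5 i hi).2.2.2.2⟩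

end TutteTW

end

noncomputable section

namespace TutteTW

/-! ### The dynamic program -/

/-- The data of an elimination with neighbourhoods `N`, stored in memory. -/
structure Env (n m p : ℕ) (es et par : ℕ → ℕ) (N : ℕ → Finset ℕ) (s : State) : Prop where
  n_eq : s.wreg 0 = n
  m_eq : s.wreg 1 = m
  p_eq : s.wreg 27 = p
  src : s.warr 0 = es
  tgt : s.warr 1 = et
  par : s.warr 19 = par
  row : ∀ i < n, s.warr 17 i = i * n
  nb : ∀ i < n, ∀ u < n, s.warr 18 (i * n + u) ≠ 0 ↔ u ∈ N i

theorem Env.of_agree {n m p : ℕ} {es et par : ℕ → ℕ} {N : ℕ → Finset ℕ} {s s' : State}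
    (h : Env n m p es et par N s) {ws was ns nas : List ℕ} (hA : Agree ws was ns nas s s')
    (hk : (0 ∉ ws ∧ 1 ∉ ws ∧ 27 ∉ ws) ∧ 0 ∉ was ∧ 1 ∉ was ∧ 17 ∉ was ∧ 18 ∉ was ∧ 19 ∉ was) :
    Env n m p es et par N s' := by
  obtain ⟨⟨a, b, c⟩, d, e, f, g, k⟩ := hk
  refine ⟨(hA.wreg _ a).trans h.n_eq, (hA.wreg _ b).trans h.m_eq, (hA.wreg _ c).trans h.p_eq,
    (hA.warr _ d).trans h.src, (hA.warr _ e).trans h.tgt, (hA.warr _ k).trans h.par, ?_, ?_⟩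
  · rw [hA.warr _ f]; exact h.row
  · rw [hA.warr _ g]; exact h.nb

section
variable {n m p : ℕ} {es et par : ℕ → ℕ} {N : ℕ → Finset ℕ} {s : State}

theorem Env.setN (h : Env n m p es et par N s) (i : ℕ) (z : ℂ) :
    Env n m p es et par N (s.setN i z) :=
  ⟨h.n_eq, h.m_eq, h.p_eq, h.src, h.tgt, h.par, h.row, h.nb⟩

theorem Env.setW (h : Env n m p es et par N s) (i v : ℕ) (hi : i ≠ 0 ∧ i ≠ 1 ∧ i ≠ 27) :
    Env n m p es et par N (s.setW i v) := by
  refine h.of_agree (ws := [i]) (was := []) (ns := []) (nas := []) ⟨fun j hj => ?_, fun _ _ => rfl,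
    fun _ _ => rfl, fun _ _ => rfl⟩ ⟨?_, by decide⟩
  · rw [setW_wreg, if_neg (fun h => hj (by simp [h]))]
  · simp [hi.1.symm, hi.2.1.symm, hi.2.2.symm]

theorem Env.putW (h : Env n m p es et par N s) (A i v : ℕ)
    (hA : A ≠ 0 ∧ A ≠ 1 ∧ A ≠ 17 ∧ A ≠ 18 ∧ A ≠ 19) : Env n m p es et par N (s.putW A i v) := by
  refine h.of_agree (ws := []) (was := [A]) (ns := []) (nas := []) ⟨fun _ _ => rfl, fun j hj => ?_,
    fun _ _ => rfl, fun _ _ => rfl⟩ ⟨by decide, ?_⟩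
  · rw [putW_warr, if_neg (fun h => hj (by simp [h]))]
  · simp [hA.1.symm, hA.2.1.symm, hA.2.2.1.symm, hA.2.2.2.1.symm, hA.2.2.2.2.symm]

end

/-- The address of the message of `j` for the colouring `c` (with `k = n`). -/
def key (p : ℕ) (N : ℕ → Finset ℕ) (j : ℕ) (c : ℕ → ℕ) : ℕ → ℕ
  | 0 => j
  | k + 1 => key p N j c k * p + if k ∈ N j then c k else 0

/-! ### Addresses of messages -/

section Key

variable {p : ℕ} {N : ℕ → Finset ℕ}

theorem key_congr {j : ℕ} {c c' : ℕ → ℕ} (h : ∀ u ∈ N j, c u = c' u) (k : ℕ) :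
    key p N j c k = key p N j c' k := by
  induction k with
  | zero => rfl
  | succ k ih =>
    rw [key, key, ih]
    congr 1
    split_ifs with hk
    · exact h k hk
    · rfl

/-- An address is a number in base `p` with leading part `j` and one digit for every vertex, zero
outside of `N j`. Addresses may be huge, but at most `p` to the power |N j| of them occur for `j`,
so few cells are ever used. -/
theorem key_inj {j j' : ℕ} {c c' : ℕ → ℕ} (hp : 0 < p) (hc : ∀ u ∈ N j, c u < p)
    (hc' : ∀ u ∈ N j', c' u < p) : ∀ k, key p N j c k = key p N j' c' k →
      j = j' ∧ ∀ u < k, (if u ∈ N j then c u else 0) = if u ∈ N j' then c' u else 0 := by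
  intro k
  induction k with
  | zero => exact fun h => ⟨h, by simp⟩
  | succ k ih =>
    intro h
    rw [key, key] at h
    have h1 : (if k ∈ N j then c k else 0) < p := by
      split_ifs with hk
      exacts [hc k hk, hp]
    have h2 : (if k ∈ N j' then c' k else 0) < p := by
      split_ifs with hk
      exacts [hc' k hk, hp]
    have h3 := congrArg (· % p) h
    simp only [Nat.mul_add_mod_self_right, Nat.mod_eq_of_lt h1, Nat.mod_eq_of_lt h2] at h3
    rw [h3] at h
    obtain ⟨g1, g2⟩ := ih (Nat.eq_of_mul_eq_mul_right hp (Nat.add_right_cancel h))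
    refine ⟨g1, fun u hu => ?_⟩
    rcases Nat.lt_succ_iff_lt_or_eq.1 hu with hu | rfl
    · exact g2 u hu
    · exact h3

end Key

/-- Computes in register `37` the address of the message of the vertex in register `37` for the
colouring in array `8`. -/
def keyProg : Prog :=
  .seq (.setW 41 (.get 17 (.reg 37))) <|
  .forUp 38 (.reg 0) <|
    .seq (.setW 39 (.reg 37)) <| .seq (.setW 37 (.lit 0)) <|
    .seq (.forUp 40 (.reg 27) (.setW 37 (.add (.reg 37) (.reg 39)))) <|
    .ite (.eq (.get 18 (.add (.reg 41) (.reg 38))) (.lit 0)) .skip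
      (.setW 37 (.add (.reg 37) (.get 8 (.reg 38))))

/-- Computes in number register `5` the product of the weights and messages belonging to the vertex
in register `31`, for the colouring in array `8`. -/
def prodProg : Prog :=
  .seq (.setN 5 (.lit 1)) <|
  .seq (.forUp 36 (.reg 1) <|
    .ite (.and (.eq (.add (.get 0 (.reg 36)) (.sub (.get 1 (.reg 36)) (.get 0 (.reg 36)))) (.reg 31))
        (.eq (.get 8 (.get 0 (.reg 36))) (.get 8 (.get 1 (.reg 36)))))
      (.setN 5 (.mul (.reg 5) (.add (.lit 1) (.reg 3)))) .skip) <|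
  .forUp 36 (.reg 0) <|
    .ite (.eq (.get 19 (.reg 36)) (.add (.reg 31) (.lit 1)))
      (.seq (.setW 37 (.reg 36)) <| .seq keyProg (.setN 5 (.mul (.reg 5) (.get 0 (.reg 37))))) .skip

/-- Finds a colour, in register `34`, that does not occur on the vertices listed in array `7`. -/
def unusedProg : Prog :=
  .forUp 35 (.reg 27) <|
    .seq (.setW 42 (.lit 0)) <|
    .seq (.forUp 36 (.reg 13) <|
      .ite (.eq (.get 8 (.get 7 (.reg 36))) (.reg 35)) (.setW 42 (.lit 1)) .skip) <|
    .ite (.eq (.reg 42) (.lit 0)) (.setW 34 (.reg 35)) .skip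

/-- Computes the message of the vertex in register `31` for the colouring in array `8`. -/
def cellProg : Prog :=
  .seq unusedProg <| .seq (.setN 4 (.lit 0)) <|
  .seq (.forUp 35 (.reg 27) <|
    .seq (.putW 8 (.reg 31) (.reg 35)) <| .seq prodProg <|
    .seq (.setN 4 (.add (.reg 4) (.reg 5))) <|
    .ite (.eq (.reg 35) (.reg 34)) (.setN 4 (.add (.reg 4) (.mul (.reg 8) (.reg 5)))) .skip) <|
  .seq (.setW 37 (.reg 31)) <| .seq keyProg (.putN 0 (.reg 37) (.reg 4))

/-- Computes all messages of the vertex in register `31`. -/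
def vertexProg : Prog :=
  .seq (.setW 32 (.get 17 (.reg 31))) <|
  .seq (.forUp 3 (.reg 0) (.putW 6 (.reg 3) (.get 18 (.add (.reg 32) (.reg 3))))) <|
  .seq listProg <| .seq (.setW 14 (.reg 27)) <| .seq powProg <|
  .forUp 16 (.reg 15) (.seq digitsProg cellProg)

/-! ### Filling the tables of messages -/

section Spec

variable {M n m p q : ℕ} {β : ℂ} {es et par : ℕ → ℕ} {N : ℕ → Finset ℕ} {s : State}

theorem keyProg_spec {j : ℕ} (hMn : n + m + 2 ≤ M) (hMp : p ≤ M) (hs : Env n m p es et par N s)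
    (hj : j < n) (h37 : s.wreg 37 = j) :
    WP M keyProg (fun s' => Agree [37, 38, 39, 40, 41] [] [] [] s s' ∧
      s'.wreg 37 = key p N j (s.warr 8) n) s := by
  have hM2 : 2 ≤ M := by omega
  refine WP.agree _ _ _ _ (by decide) ?_
  refine WP.seq hM2 (WP.setW hM2 ?_)
  refine WP.forUp hM2 [37, 39, 40] [] [] [] (by decide) n (by omega)
    (fun s' h => by simp [h.wreg, hs.n_eq])
    (fun k s' => s'.wreg 37 = key p N j (s.warr 8) k) (by simp [key, h37]) ?_ (fun _ _ h => h)
  intro k s1 hk hA hi hI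
  refine WP.seq hM2 (WP.setW hM2 (WP.seq hM2 (WP.setW hM2 (WP.seq hM2 ?_))))
  refine WP.forUp hM2 [37] [] [] [] (by decide) p hMp
    (fun s' h => by simp [h.wreg, hA.wreg, hs.p_eq])
    (fun x s' => s'.wreg 37 = key p N j (s.warr 8) k * x) (by simp) ?_ ?_
  · intro x s2 hx hA2 hi2 hI2
    refine WP.setW hM2 ?_
    simp [hI2, hA2.wreg, hI]
    ring
  · intro s2 hA2 hI2
    have e1 : s2.warr 18 (s2.wreg 41 + s2.wreg 38) = s.warr 18 (j * n + k) := by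
      simp [hA2.warr, hA.warr, hA2.wreg, hA.wreg, hi, h37, hs.row j hj]
    have e8 : s2.warr 8 = s.warr 8 := by simp [hA2.warr, hA.warr]
    have e38 : s2.wreg 38 = k := by simp [hA2.wreg, hi]
    have hnb := hs.nb j hj k hk
    refine WP.ite hM2 ?_ ?_ <;> intro hc <;> simp only [Test.holds, WExpr.eval, e1] at hc
    · refine WP.skip hM2 ?_
      have : k ∉ N j := fun h => hnb.2 h hc
      simp [key, hI2, this]
    · refine WP.setW hM2 ?_
      simp [key, hI2, hnb.1 hc, e8, e38]

/-- The messages of the vertices `j ≥ i` are stored in `T`. -/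
def Table (n m p q : ℕ) (β : ℂ) (es et par : ℕ → ℕ) (N : ℕ → Finset ℕ) (i : ℕ) (T : ℕ → ℂ) : Prop :=
  ∀ j < n, i ≤ j → ∀ c : ℕ → ℕ, (∀ u ∈ N j, c u < p) →
    T (key p N j c n) = msg n m q β es et par j c

theorem prodProg_spec {i : ℕ} (hMn : n + m + 2 ≤ M) (hMp : p ≤ M) (hs : Env n m p es et par N s)
    (h : IsElim n m es et N par) (hT : Table n m p q β es et par N (i + 1) (s.narr 0))
    (h31 : s.wreg 31 = i) (h3 : s.nreg 3 = β)
    (hc : ∀ u ∈ N i, s.warr 8 u < p) (hci : s.warr 8 i < p) :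
    WP M prodProg (fun s' => Agree [36, 37, 38, 39, 40, 41] [] [5] [] s s' ∧
      s'.nreg 5 = bucket n m q β es et par i (s.warr 8)) s := by
  have hM2 : 2 ≤ M := by omega
  refine WP.agree _ _ _ _ (by decide) ?_
  refine WP.seq hM2 (WP.setN hM2 (WP.seq hM2 ?_))
  refine WP.forUp hM2 [] [] [5] [] (by decide) m (by omega)
    (fun s' h => by simp [h.wreg, hs.m_eq])
    (fun k s' => s'.nreg 5 = ∏ e ∈ Finset.range k, if max (es e) (et e) = i then
      edgeWeight β es et e (s.warr 8) else 1) (by simp) ?_ ?_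
  · intro k s1 hk hA hi hI
    have e0 : s1.warr 0 = es := by simp [hA.warr, hs.src]
    have e1 : s1.warr 1 = et := by simp [hA.warr, hs.tgt]
    have e8 : s1.warr 8 = s.warr 8 := by simp [hA.warr]
    have e31 : s1.wreg 31 = i := by simp [hA.wreg, h31]
    have e3 : s1.nreg 3 = β := by simp [hA.nreg, h3]
    -- Truncated subtraction provides the maximum, by which an edge is assigned to its larger end.
    have hmax : es k + (et k - es k) = max (es k) (et k) := by omega
    refine WP.ite hM2 ?_ ?_ <;> intro hc <;>
      simp only [Test.holds, WExpr.eval, e0, e1, e8, e31, hi, hmax] at hc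
    · refine WP.setN hM2 ?_
      simp [Finset.prod_range_succ, hI, hc, edgeWeight, e3]
    · refine WP.skip hM2 ?_
      simp only [setW_nreg, Finset.prod_range_succ, hI, edgeWeight]
      split_ifs with g1 g2
      · exact absurd ⟨g1, g2⟩ hc
      · simp
      · simp
  · intro s1 hA1 hI1
    refine WP.forUp hM2 [37, 38, 39, 40, 41] [] [5] [] (by decide) n (by omega)
      (fun s' h => by simp [h.wreg, hA1.wreg, hs.n_eq])
      (fun k s' => s'.nreg 5 = (∏ e ∈ Finset.range m, if max (es e) (et e) = i then
        edgeWeight β es et e (s.warr 8) else 1) * ∏ j ∈ Finset.range k,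
          if par j = i + 1 then msg n m q β es et par j (s.warr 8) else 1) (by simp [hI1]) ?_
      (fun _ _ h => h)
    intro k s2 hk hA2 hi hI
    have hs2 := ((hs.setN 5 _).of_agree hA1 (by decide)).of_agree hA2 (by decide)
    have e31 : s2.wreg 31 = i := by simp [hA2.wreg, hA1.wreg, h31]
    have e8 : s2.warr 8 = s.warr 8 := by simp [hA2.warr, hA1.warr]
    have eT : s2.narr 0 = s.narr 0 := by simp [hA2.narr, hA1.narr]
    refine WP.ite hM2 ?_ ?_ <;> intro hp <;>
      simp only [Test.holds, WExpr.eval, hs2.par, e31, hi] at hp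
    · refine WP.seq hM2 (WP.setW hM2 (WP.seq hM2 ?_))
      simp only [WExpr.eval, hi]
      refine (keyProg_spec hMn hMp (hs2.setW 37 k (by decide)) hk (by simp)).mono ?_
      rintro s3 ⟨hA3, h37⟩
      refine WP.setN hM2 ?_
      have hij := h.lt k hk i (h.par_mem k hk i hp)
      have hck : ∀ u ∈ N k, s.warr 8 u < p := by
        intro u hu
        rcases h.par_sub k hk i hp u hu with rfl | hu
        exacts [hci, hc u hu]
      simp [Finset.prod_range_succ, hA3.nreg, hA3.narr, hI, h37, e8, eT, hT k hk hij _ hck, hp]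
      ring
    · refine WP.skip hM2 ?_
      simp [Finset.prod_range_succ, hI, hp]

theorem unusedProg_spec {i : ℕ} (hMn : n + m + 2 ≤ M) (hMp : p ≤ M) (hs : Env n m p es et par N s)
    (hi : i < n) (hN : ∀ u ∈ N i, u < n) (hcard : (N i).card < p)
    (hl : IsEnum n (fun u => s.warr 18 (i * n + u)) (s.warr 7) (s.wreg 13)) :
    WP M unusedProg (fun s' => Agree [34, 35, 36, 42] [] [] [] s s' ∧
      s'.wreg 34 < p ∧ ∀ u ∈ N i, s.warr 8 u ≠ s'.wreg 34) s := by
  have hM2 : 2 ≤ M := by omega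
  have hk : s.wreg 13 ≤ M := by
    have := hl.card_eq.trans_le (Finset.card_filter_le _ _)
    rw [Finset.card_range] at this
    omega
  have hiff : ∀ d, (∀ u ∈ N i, s.warr 8 u ≠ d) ↔ ∀ t < s.wreg 13, s.warr 8 (s.warr 7 t) ≠ d := by
    refine fun d => ⟨fun h t ht => h _ ((hs.nb i hi _ (hl.lt t ht)).1 (hl.mem t ht)), ?_⟩
    intro h u hu
    obtain ⟨t, ht, rfl⟩ := hl.surj u (hN u hu) ((hs.nb i hi u (hN u hu)).2 hu)
    exact h t ht
  obtain ⟨d, hd, hdu⟩ : ∃ d < p, ∀ u ∈ N i, s.warr 8 u ≠ d := by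
    by_contra! hcon
    have : Finset.range p ⊆ (N i).image (s.warr 8) := by
      intro d hd
      obtain ⟨u, hu, he⟩ := hcon d (Finset.mem_range.1 hd)
      exact Finset.mem_image.2 ⟨u, hu, he⟩
    have := (Finset.card_le_card this).trans Finset.card_image_le
    rw [Finset.card_range] at this
    omega
  refine WP.agree _ _ _ _ (by decide) ?_
  refine WP.forUp hM2 [34, 36, 42] [] [] [] (by decide) p hMp
    (fun s' h => by simp [h.wreg, hs.p_eq])
    (fun k s' => ∀ d < k, (∀ u ∈ N i, s.warr 8 u ≠ d) →
      s'.wreg 34 < p ∧ ∀ u ∈ N i, s.warr 8 u ≠ s'.wreg 34) (by simp) ?_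
      (fun s' _ h => h d hd hdu)
  intro k s1 hkp hA1 hi1 hI1
  have e8 : s1.warr 8 = s.warr 8 := by simp [hA1.warr]
  have e7 : s1.warr 7 = s.warr 7 := by simp [hA1.warr]
  refine WP.seq hM2 (WP.setW hM2 (WP.seq hM2 ?_))
  refine WP.forUp hM2 [42] [] [] [] (by decide) (s.wreg 13) hk
    (fun s' h => by simp [h.wreg, hA1.wreg])
    (fun x s' => s'.wreg 42 = 0 ↔ ∀ t < x, s.warr 8 (s.warr 7 t) ≠ k) (by simp) ?_ ?_
  · intro x s2 hx hA2 hi2 hI2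
    have f8 : s2.warr 8 = s.warr 8 := by simp [hA2.warr, e8]
    have f7 : s2.warr 7 = s.warr 7 := by simp [hA2.warr, e7]
    have f35 : s2.wreg 35 = k := by simp [hA2.wreg, hi1]
    refine WP.ite hM2 ?_ ?_ <;> intro hc <;>
      simp only [Test.holds, WExpr.eval, f8, f7, hi2, f35] at hc
    · refine WP.setW hM2 ?_
      simp only [WExpr.eval, setW_wreg, reduceIte, Nat.reduceEqDiff, one_ne_zero, false_iff]
      exact fun h => h x (Nat.lt_succ_self x) hc
    · refine WP.skip hM2 ?_
      simp only [setW_wreg, Nat.reduceEqDiff, reduceIte, hI2]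
      refine ⟨fun h t ht => ?_, fun h t ht => h t (by omega)⟩
      rcases Nat.lt_succ_iff_lt_or_eq.1 ht with ht | rfl
      exacts [h t ht, hc]
  · intro s2 hA2 hI2
    have f35 : s2.wreg 35 = k := by simp [hA2.wreg, hi1]
    have f34 : s2.wreg 34 = s1.wreg 34 := by simp [hA2.wreg]
    rw [← hiff] at hI2
    refine WP.ite hM2 ?_ ?_ <;> intro hc <;>
      simp only [Test.holds, WExpr.eval, hI2] at hc
    · refine WP.setW hM2 ?_
      simp only [WExpr.eval, setW_wreg, reduceIte, Nat.reduceEqDiff, f35]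
      exact fun _ _ _ => ⟨hkp, hc⟩
    · refine WP.skip hM2 ?_
      simp only [setW_wreg, Nat.reduceEqDiff, reduceIte, f34]
      intro d hd hdu
      rcases Nat.lt_succ_iff_lt_or_eq.1 hd with hd | rfl
      exacts [hI1 d hd hdu, absurd hdu hc]

/-- The sum is that of `msg_eq_of_unused`: the unused colour `d₀` is counted once like all colours
below `p` and once more with the weight q - p from number register `8`. The loop overwrites the
colour of `i` itself, which is harmless for the address, as `i` is not in `N i`. -/
theorem cellProg_spec {i : ℕ} (hMn : n + m + 2 ≤ M) (hMp : p ≤ M) (hs : Env n m p es et par N s)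
    (h : IsElim n m es et N par) (hT : Table n m p q β es et par N (i + 1) (s.narr 0))
    (hi : i < n) (hcard : (N i).card < p) (hpq : p ≤ q)
    (hl : IsEnum n (fun u => s.warr 18 (i * n + u)) (s.warr 7) (s.wreg 13))
    (h31 : s.wreg 31 = i) (h3 : s.nreg 3 = β) (h8 : s.nreg 8 = (q : ℂ) - p)
    (hc : ∀ u ∈ N i, s.warr 8 u < p) :
    WP M cellProg (fun s' => Agree [34, 35, 36, 37, 38, 39, 40, 41, 42] [8] [4, 5] [0] s s' ∧
      s'.narr 0 = Function.update (s.narr 0) (key p N i (s.warr 8) n)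
        (msg n m q β es et par i (s.warr 8))) s := by
  have hM2 : 2 ≤ M := by omega
  refine WP.agree _ _ _ _ (by decide) ?_
  have hlt := h.lt i hi
  refine WP.seq hM2 ((unusedProg_spec hMn hMp hs hi (fun u hu => (hlt u hu).trans hi) hcard hl).mono
    ?_)
  rintro s1 ⟨hA1, hd0, hdu⟩
  set d₀ := s1.wreg 34 with hd₀
  have hs1 := hs.of_agree hA1 (by decide)
  refine WP.seq hM2 (WP.setN hM2 (WP.seq hM2 ?_))
  refine WP.forUp hM2 [36, 37, 38, 39, 40, 41] [8] [4, 5] [] (by decide) p hMp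
    (fun s' h => by simp [h.wreg, hs1.p_eq])
    (fun k s' => (∀ u ∈ N i, s'.warr 8 u = s.warr 8 u) ∧ s'.nreg 4 =
      ∑ d ∈ Finset.range k, bucket n m q β es et par i (Function.update (s.warr 8) i d) +
        if d₀ < k then ((q : ℂ) - p) * bucket n m q β es et par i (Function.update (s.warr 8) i d₀)
        else 0) ⟨by simp [hA1.warr], by simp⟩ ?_ ?_
  · rintro k s2 hk hA2 hi2 ⟨i1, i2⟩
    have hs2 := (hs1.setN 4 _).of_agree hA2 (by decide)
    have e31 : s2.wreg 31 = i := by simp [hA2.wreg, hA1.wreg, h31]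
    refine WP.seq hM2 (WP.putW hM2 (WP.seq hM2 ?_))
    simp only [WExpr.eval, e31, hi2]
    have e8 : (s2.putW 8 i k).warr 8 = Function.update (s2.warr 8) i k := by simp
    have eT : (s2.putW 8 i k).narr 0 = s.narr 0 := by simp [hA2.narr, hA1.narr]
    have hN : ∀ u ∈ N i, Function.update (s2.warr 8) i k u = s.warr 8 u := fun u hu => by
      rw [Function.update_of_ne (hlt u hu).ne, i1 u hu]
    refine (prodProg_spec (β := β) (q := q) hMn hMp (hs2.putW 8 i k (by decide)) h (by rwa [eT]) ?_ ?_ ?_ ?_).mono ?_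
    · simp [e31]
    · simp [hA2.nreg, hA1.nreg, h3]
    · intro u hu
      rw [e8, hN u hu]
      exact hc u hu
    · simpa [e8] using hk
    rintro s3 ⟨hA3, h5⟩
    have hb : bucket n m q β es et par i ((s2.putW 8 i k).warr 8) =
        bucket n m q β es et par i (Function.update (s.warr 8) i k) := by
      refine bucket_congr h (by simp) fun u hu => ?_
      rw [e8, hN u hu, Function.update_of_ne (hlt u hu).ne]
    rw [hb] at h5
    have f8 : s3.warr 8 = Function.update (s2.warr 8) i k := by rw [hA3.warr 8 (by decide), e8]
    have f4 : s3.nreg 4 = s2.nreg 4 := by simp [hA3.nreg]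
    have f35 : s3.wreg 35 = k := by simp [hA3.wreg, hi2]
    have f34 : s3.wreg 34 = d₀ := by simp [hA3.wreg, hA2.wreg, hd₀]
    have f88 : s3.nreg 8 = (q : ℂ) - p := by simp [hA3.nreg, hA2.nreg, hA1.nreg, h8]
    refine WP.seq hM2 (WP.setN hM2 (WP.ite hM2 ?_ ?_)) <;> intro hc <;>
      simp only [Test.holds, WExpr.eval, setN_wreg, f35, f34] at hc
    · refine WP.setN hM2 ⟨?_, ?_⟩
      · simpa [f8] using hN
      · simp [f4, i2, h5, f88, Finset.sum_range_succ, ← hc]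
    · refine WP.skip hM2 ⟨?_, ?_⟩
      · simpa [f8] using hN
      · have : d₀ < k + 1 ↔ d₀ < k := by omega
        simp [f4, i2, h5, Finset.sum_range_succ, this]
        ring
  · rintro s2 hA2 ⟨i1, i2⟩
    have hs2 := (hs1.setN 4 _).of_agree hA2 (by decide)
    have e31 : s2.wreg 31 = i := by simp [hA2.wreg, hA1.wreg, h31]
    have eT : s2.narr 0 = s.narr 0 := by simp [hA2.narr, hA1.narr]
    rw [if_pos hd0, ← msg_eq_of_unused h hi hpq (fun u hu => ⟨hc u hu, hdu u hu⟩) hd0] at i2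
    refine WP.seq hM2 (WP.setW hM2 (WP.seq hM2 ?_))
    simp only [WExpr.eval, e31]
    refine (keyProg_spec hMn hMp (hs2.setW 37 i (by decide)) hi (by simp)).mono ?_
    rintro s3 ⟨hA3, h37⟩
    refine WP.putN hM2 ?_
    have := key_congr (p := p) i1 n
    simp [hA3.narr, hA3.nreg, h37, eT, i2, this]

/-- The counter runs through all colourings of `N i` with `p` colours. Messages depend on the
colouring only within `N i`, so this fills every cell that `Table` asks for. -/
theorem vertexProg_spec {i : ℕ} (hMn : n + m + 2 ≤ M) (hMp : p ^ p ≤ M)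
    (hs : Env n m p es et par N s)
    (h : IsElim n m es et N par) (hT : Table n m p q β es et par N (i + 1) (s.narr 0))
    (hi : i < n) (hcard : (N i).card < p) (hpq : p ≤ q)
    (h31 : s.wreg 31 = i) (h3 : s.nreg 3 = β) (h8 : s.nreg 8 = (q : ℂ) - p) :
    WP M vertexProg (fun s' => Agree [3, 4, 13, 14, 15, 16, 17, 32, 34, 35, 36, 37, 38, 39, 40, 41, 42]
      [6, 7, 8] [4, 5] [0] s s' ∧ Table n m p q β es et par N i (s'.narr 0)) s := by
  have hM2 : 2 ≤ M := by omega
  have hp : 0 < p := by omega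
  have hMp' : p ≤ M := (Nat.le_self_pow hp.ne' p).trans hMp
  refine WP.agree _ _ _ _ (by decide) ?_
  have hlt := h.lt i hi
  refine WP.seq hM2 (WP.setW hM2 (WP.seq hM2 ?_))
  refine WP.forUp hM2 [] [6] [] [] (by decide) n (by omega)
    (fun s' h => by simp [h.wreg, hs.n_eq])
    (fun k s' => ∀ u < k, s'.warr 6 u = s.warr 18 (i * n + u)) (by simp) ?_ ?_
  · intro k s1 hk hA1 hi1 hI1
    have e32 : s1.wreg 32 = i * n := by simp [hA1.wreg, h31, hs.row i hi]
    have e18 : s1.warr 18 = s.warr 18 := by simp [hA1.warr]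
    refine WP.putW hM2 fun u hu => ?_
    simp only [setW_warr, putW_warr, WExpr.eval, reduceIte, hi1, e32, e18, Function.update_apply]
    split_ifs with h
    · rw [h]
    · exact hI1 u (by omega)
  intro s1 hA1 h6
  have hs1 := (hs.setW 32 _ (by decide)).of_agree hA1 (by decide)
  refine WP.seq hM2 ((listProg_spec (M := M) (by omega) hs1.n_eq).mono ?_)
  rintro s2 ⟨hA2, hl⟩
  have hs2 := hs1.of_agree hA2 (by decide)
  have e18 : s2.warr 18 = s.warr 18 := by simp [hA2.warr, hA1.warr]
  replace hl : IsEnum n (fun u => s2.warr 18 (i * n + u)) (s2.warr 7) (s2.wreg 13) :=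
    ⟨hl.lt, fun t ht => by
      have := hl.mem t ht
      rwa [h6 _ (hl.lt t ht), ← e18] at this,
      hl.inj, fun v hv hne => hl.surj v hv (by rwa [h6 v hv, ← e18])⟩
  set k := s2.wreg 13 with hk
  set l := s2.warr 7 with hl7
  have hkp : k ≤ p := by
    refine (hl.card_eq.trans_le (Finset.card_le_card (t := N i) ?_)).trans hcard.le
    intro u hu
    rw [Finset.mem_filter, Finset.mem_range] at hu
    exact (hs2.nb i hi u hu.1).1 hu.2
  have hpk : p ^ k ≤ M := (Nat.pow_le_pow_right hp hkp).trans hMp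
  refine WP.seq hM2 (WP.setW hM2 (WP.seq hM2 ?_))
  have hs3 := hs2.setW 14 p (by decide)
  simp only [WExpr.eval, hs2.p_eq]
  refine (powProg_spec (k := k) (p := p) hM2 (hkp.trans hMp') hMp' (by simp [hk]) (by simp)).mono ?_
  rintro s4 ⟨hA4, h15⟩
  have hs4 := hs3.of_agree hA4 (by decide)
  have e13 : s4.wreg 13 = k := by simp [hA4.wreg, hk]
  have e14 : s4.wreg 14 = p := by simp [hA4.wreg]
  have e31 : s4.wreg 31 = i := by simp [hA4.wreg, hA2.wreg, hA1.wreg, h31]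
  have e7 : s4.warr 7 = l := by simp [hA4.warr, hl7]
  have f18 : s4.warr 18 = s2.warr 18 := by simp [hA4.warr]
  have e3 : s4.nreg 3 = β := by simp [hA4.nreg, hA2.nreg, hA1.nreg, h3]
  have e8 : s4.nreg 8 = (q : ℂ) - p := by simp [hA4.nreg, hA2.nreg, hA1.nreg, h8]
  have eT : s4.narr 0 = s.narr 0 := by simp [hA4.narr, hA2.narr, hA1.narr]
  refine WP.forUp hM2 [3, 4, 17, 34, 35, 36, 37, 38, 39, 40, 41, 42] [8] [4, 5] [0] (by decide)
    (p ^ k) hpk (fun s' h => by simp [h.wreg, h15])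
    (fun x s' => Table n m p q β es et par N (i + 1) (s'.narr 0) ∧
      ∀ c : ℕ → ℕ, (∀ u ∈ N i, c u < p) → (∃ y < x, ∀ t < k, y / p ^ t % p = c (l t)) →
        s'.narr 0 (key p N i c n) = msg n m q β es et par i c) ⟨by rwa [setW_narr, eT], by simp⟩ ?_ ?_
  · rintro x s5 hx hA5 hi5 ⟨i1, i2⟩
    have hs5 := hs4.of_agree hA5 (by decide)
    have g7 : s5.warr 7 = l := by simp [hA5.warr, e7]
    have g13 : s5.wreg 13 = k := by simp [hA5.wreg, e13]
    refine WP.seq hM2 ?_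
    refine (digitsProg_spec (k := k) (p := p) (x := x) hM2 (hkp.trans hMp') (by omega) hp
      g13 (by simp [hA5.wreg, e14]) hi5 (by rw [g7]; exact hl.inj)).mono ?_
    rintro s6 ⟨hA6, h6⟩
    rw [g7] at h6
    have hs6 := hs5.of_agree hA6 (by decide)
    have j13 : s6.wreg 13 = k := by simp [hA6.wreg, g13]
    have j7 : s6.warr 7 = l := by simp [hA6.warr, g7]
    have j18 : s6.warr 18 = s2.warr 18 := by simp [hA6.warr, hA5.warr, f18]
    have jT : s6.narr 0 = s5.narr 0 := by simp [hA6.narr]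
    have hlN : ∀ t < k, l t ∈ N i := fun t ht =>
      (hs2.nb i hi _ (hl.lt t ht)).1 (hl.mem t ht)
    have hsurj : ∀ u ∈ N i, ∃ t < k, l t = u := fun u hu =>
      hl.surj u ((hlt u hu).trans hi) ((hs2.nb i hi u ((hlt u hu).trans hi)).2 hu)
    have hcol : ∀ u ∈ N i, s6.warr 8 u < p := by
      intro u hu
      obtain ⟨t, ht, rfl⟩ := hsurj u hu
      rw [h6 t ht]
      exact Nat.mod_lt _ hp
    refine (cellProg_spec (β := β) (q := q) hMn hMp' hs6 h (by rwa [jT]) hi hcard hpq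
      (by rw [j18, j7, j13]; exact hl) (by simp [hA6.wreg, hA5.wreg, e31])
      (by simp [hA6.nreg, hA5.nreg, e3]) (by simp [hA6.nreg, hA5.nreg, e8]) hcol).mono ?_
    rintro s7 ⟨-, h7⟩
    simp only [setW_narr, h7, jT]
    -- No cell that is already filled gets overwritten, be it for a larger vertex or for a colouring
    -- that differs on `N i`.
    have hne : ∀ j c, (∀ u ∈ N j, c u < p) → (j = i → ∃ u ∈ N i, c u ≠ s6.warr 8 u) →
        key p N j c n ≠ key p N i (s6.warr 8) n := by
      intro j c hc hcon he
      obtain ⟨rfl, hd⟩ := key_inj hp hc hcol n he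
      obtain ⟨u, hu, hne⟩ := hcon rfl
      have := hd u ((hlt u hu).trans hi)
      rw [if_pos hu, if_pos hu] at this
      exact hne this
    refine ⟨fun j hj hij c hc => ?_, ?_⟩
    · rw [Function.update_of_ne (hne j c hc (by omega))]
      exact i1 j hj hij c hc
    · rintro c hc ⟨y, hy, hyc⟩
      by_cases hcc : ∀ u ∈ N i, c u = s6.warr 8 u
      · rw [key_congr hcc, Function.update_self]
        exact (msg_congr h _ i hi le_rfl _ _ hcc).symm
      · push Not at hcc
        rw [Function.update_of_ne (hne i c hc fun _ => hcc)]
        refine i2 c hc ⟨y, ?_, hyc⟩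
        rcases Nat.lt_succ_iff_lt_or_eq.1 hy with hy | rfl
        · exact hy
        · obtain ⟨u, hu, hne⟩ := hcc
          obtain ⟨t, ht, rfl⟩ := hsurj u hu
          rw [h6 t ht, hyc t ht] at hne
          exact absurd rfl hne
  · rintro s5 hA5 ⟨i1, i2⟩ j hj hij c hc
    rcases hij.eq_or_lt with rfl | hij
    · exact i2 c hc (exists_digits hp k (fun t => c (l t)) fun t ht =>
        hc _ ((hs2.nb i hi _ (hl.lt t ht)).1 (hl.mem t ht)))
    · exact i1 j hj hij c hc

end Spec

/-- Computes in number register `7` the value of the Tutte polynomial at `(α + 1, β + 1)`, where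
`α` and `β` are in the number registers `2` and `3`. -/
def dpProg : Prog :=
  .seq (.setN 6 (.lit 0)) <| .seq (.forUp 3 (.reg 27) (.setN 6 (.add (.reg 6) (.lit 1)))) <|
  .seq (.setN 8 (.sub (.mul (.reg 2) (.reg 3)) (.reg 6))) <|
  .seq (.forUp 30 (.reg 0) <|
    .seq (.setW 31 (.sub (.sub (.reg 0) (.lit 1)) (.reg 30))) vertexProg) <|
  .seq (.setN 7 (.lit 1)) <|
  .forUp 36 (.reg 0) <|
    .seq (.setN 7 (.div (.reg 7) (.reg 3))) <|
    .ite (.eq (.get 19 (.reg 36)) (.lit 0))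
      (.seq (.setW 37 (.reg 36)) <| .seq keyProg
        (.setN 7 (.div (.mul (.reg 7) (.get 0 (.reg 37))) (.reg 2)))) .skip

/-- Vertices are treated in decreasing order, so the messages needed at a vertex are present. The
final loop multiplies the messages of the roots and divides by β at every vertex and by α at every
root, which accounts for both powers in the denominator. -/
theorem dpProg_spec {M n m p α β : ℕ} {es et par : ℕ → ℕ} {N : ℕ → Finset ℕ} {s : State}
    (hMn : n + m + 2 ≤ M) (hMp : p ^ p ≤ M) (hs : Env n m p es et par N s)
    (h : IsElim n m es et N par) (hcard : ∀ i < n, (N i).card < p) (hp : 0 < p) (hpq : p ≤ α * β)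
    (h2 : s.nreg 2 = α) (h3 : s.nreg 3 = β) :
    WP M dpProg (fun s' => Agree [3, 4, 13, 14, 15, 16, 17, 30, 31, 32, 34, 35, 36, 37, 38, 39, 40, 41,
      42] [6, 7, 8] [4, 5, 6, 7, 8] [0] s s' ∧
      s'.nreg 7 = (∑ σ : Fin n → Fin (α * β), ∏ e ∈ Finset.range m, edgeWeight β es et e (extZero σ)) /
        (α : ℂ) ^ ((Finset.range n).filter (par · = 0)).card / (β : ℂ) ^ n) s := by
  have hM2 : 2 ≤ M := by omega
  have hMp' : p ≤ M := (Nat.le_self_pow hp.ne' p).trans hMp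
  refine WP.agree _ _ _ _ (by decide) ?_
  refine WP.seq hM2 (WP.setN hM2 (WP.seq hM2 ?_))
  -- A word cannot be converted into a number, so `p` is transferred to number register `6` by
  -- counting.
  refine WP.forUp hM2 [] [] [6] [] (by decide) p hMp' (fun s' h => by simp [h.wreg, hs.p_eq])
    (fun k s' => s'.nreg 6 = k) (by simp) ?_ ?_
  · intro k s1 hk hA1 hi1 hI1
    refine WP.setN hM2 ?_
    simp [hI1]
  intro s1 hA1 h6
  have hs1 := (hs.setN 6 _).of_agree hA1 (by decide)
  refine WP.seq hM2 (WP.setN hM2 (WP.seq hM2 ?_))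
  have e8 : NExpr.eval s1 (.sub (.mul (.reg 2) (.reg 3)) (.reg 6)) = ((α * β : ℕ) : ℂ) - p := by
    simp [hA1.nreg, h2, h3, h6]
  rw [e8]
  refine WP.forUp hM2 [3, 4, 13, 14, 15, 16, 17, 31, 32, 34, 35, 36, 37, 38, 39, 40, 41, 42]
    [6, 7, 8] [4, 5] [0] (by decide) n (by omega) (fun s' h => by simp [h.wreg, hs1.n_eq])
    (fun k s' => Table n m p (α * β) β es et par N (n - k) (s'.narr 0))
    (fun j hj hnj => absurd hj (by omega)) ?_ ?_
  · intro k s2 hk hA2 hi2 hI2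
    have hs2 := (hs1.setN 8 _).of_agree hA2 (by decide)
    refine WP.seq hM2 (WP.setW hM2 ?_)
    simp only [WExpr.eval, hs2.n_eq, hi2]
    refine (vertexProg_spec (β := β) (q := α * β) (i := n - 1 - k) hMn hMp (hs2.setW 31 _ (by decide)) h ?_ (by omega)
      (hcard _ (by omega)) hpq (by simp) ?_ ?_).mono ?_
    · rw [setW_narr, show n - 1 - k + 1 = n - k by omega]
      exact hI2
    · simp [hA2.nreg, hA1.nreg, h3]
    · simp [hA2.nreg]
    · rintro s3 ⟨-, h3⟩
      rw [setW_narr, show n - (k + 1) = n - 1 - k by omega]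
      exact h3
  intro s2 hA2 hT
  rw [Nat.sub_self] at hT
  have hs2 := (hs1.setN 8 _).of_agree hA2 (by decide)
  refine WP.seq hM2 (WP.setN hM2 ?_)
  rw [sum_prod_edgeWeight h (s2.warr 8)]
  refine WP.forUp hM2 [37, 38, 39, 40, 41] [] [7] [] (by decide) n (by omega)
    (fun s' h => by simp [h.wreg, hs2.n_eq])
    (fun k s' => s'.nreg 7 = (∏ i ∈ Finset.range k,
        if par i = 0 then msg n m (α * β) β es et par i (s2.warr 8) else 1) /
      (α : ℂ) ^ ((Finset.range k).filter (par · = 0)).card / (β : ℂ) ^ k) (by simp) ?_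
    (fun _ _ h => h)
  intro k s3 hk hA3 hi3 hI3
  have hs3 := (hs2.setN 7 _).of_agree hA3 (by decide)
  have e8 : s3.warr 8 = s2.warr 8 := by simp [hA3.warr]
  have eT : s3.narr 0 = s2.narr 0 := by simp [hA3.narr]
  have g2 : s3.nreg 2 = α := by simp [hA3.nreg, hA2.nreg, hA1.nreg, h2]
  have g3 : s3.nreg 3 = β := by simp [hA3.nreg, hA2.nreg, hA1.nreg, h3]
  have hcardk : ((Finset.range (k + 1)).filter (par · = 0)).card =
      ((Finset.range k).filter (par · = 0)).card + if par k = 0 then 1 else 0 := by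
    rw [Finset.range_add_one, Finset.filter_insert]
    split_ifs with h0
    · rw [Finset.card_insert_of_notMem (by simp)]
    · rfl
  refine WP.seq hM2 (WP.setN hM2 (WP.ite hM2 ?_ ?_)) <;> intro hc <;>
    simp only [Test.holds, WExpr.eval, setN_warr, setN_wreg, hs3.par, hi3] at hc
  · refine WP.seq hM2 (WP.setW hM2 (WP.seq hM2 ?_))
    simp only [WExpr.eval, setN_wreg, hi3]
    refine (keyProg_spec hMn hMp' ((hs3.setN 7 _).setW 37 k (by decide)) hk (by simp)).mono ?_
    rintro s4 ⟨hA4, h37⟩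
    refine WP.setN hM2 ?_
    -- At a root the neighbourhood is empty, so whatever is left in array `8` serves as a colouring.
    have hkey := hT k hk (Nat.zero_le _) (s2.warr 8) (by simp [h.par_zero k hk hc])
    simp only [setW_warr, setN_warr, e8] at h37
    simp [hA4.nreg, hA4.narr, h37, eT, hkey, hI3, g2, g3, Finset.prod_range_succ, hcardk, hc,
      pow_succ, div_eq_mul_inv]
    ring
  · refine WP.skip hM2 ?_
    simp [hI3, g3, Finset.prod_range_succ, hcardk, hc, pow_succ, div_eq_mul_inv]
    ring

end TutteTW

end

noncomputable section

namespace TutteTW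

/-! ### The interpolation program -/

/-- Multiplies number register `7` by the Lagrange basis polynomial for the nodes
`st, st + 1, …` that belongs to register `i`, evaluated at number register `x`. The node is
the successor of number register `r`. -/
def lagrangeProg (e : WExpr) (i x r : ℕ) (st : NExpr) : Prog :=
  .seq (.setN 11 st) <| .forUp 36 e <|
    .seq (.ite (.eq (.reg 36) (.reg i)) .skip
      (.setN 7 (.mul (.reg 7)
        (.div (.sub (.reg x) (.reg 11)) (.sub (.add (.reg r) (.lit 1)) (.reg 11))))))
    (.setN 11 (.add (.reg 11) (.lit 1)))

theorem lagrangeProg_spec {M N k i x r : ℕ} {e : WExpr} {st : NExpr} {s : State} (hM2 : 2 ≤ M)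
    (hN : N ≤ M) (he : ∀ s' : State, (∀ j, j ≠ 36 → s'.wreg j = s.wreg j) → e.eval s' = N)
    (hi : s.wreg i = k) (hi' : i ≠ 36) (hx : x ≠ 7 ∧ x ≠ 11) (hr : r ≠ 7 ∧ r ≠ 11) :
    WP M (lagrangeProg e i x r st) (fun s' => Agree [36] [] [7, 11] [] s s' ∧
      s'.nreg 7 = s.nreg 7 * ∏ j ∈ Finset.range N, if j = k then 1 else
        (s.nreg x - (st.eval s + j)) / (s.nreg r + 1 - (st.eval s + j))) s := by
  refine WP.agree _ _ _ _ (by simp [lagrangeProg, Prog.within, Prog.within_forUp]) ?_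
  refine WP.seq hM2 (WP.setN hM2 ?_)
  refine WP.mono (Q := fun s' => s'.nreg 11 = st.eval s + (N : ℂ) ∧
    s'.nreg 7 = s.nreg 7 * ∏ j ∈ Finset.range N, if j = k then 1 else
        (s.nreg x - (st.eval s + j)) / (s.nreg r + 1 - (st.eval s + j))) ?_ (fun _ h => h.2)
  refine WP.forUp hM2 [] [] [7, 11] [] ⟨rfl, by decide⟩ N hN
    (fun s' h => he s' fun j hj => (h.wreg j (by simpa using hj)).trans rfl)
    (fun l s' => s'.nreg 11 = st.eval s + (l : ℂ) ∧
      s'.nreg 7 = s.nreg 7 * ∏ j ∈ Finset.range l, if j = k then 1 else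
        (s.nreg x - (st.eval s + j)) / (s.nreg r + 1 - (st.eval s + j))) (by simp) ?_
    (fun _ _ h => h)
  rintro l s1 hl hA h36 ⟨i1, i2⟩
  have ei : s1.wreg i = k := (hA.wreg i (by simpa using hi')).trans hi
  have ex : s1.nreg x = s.nreg x := (hA.nreg x (by simp [hx])).trans (by simp [hx.2])
  have er : s1.nreg r = s.nreg r := (hA.nreg r (by simp [hr])).trans (by simp [hr.2])
  refine WP.seq hM2 (WP.ite hM2 ?_ ?_) <;> intro hc <;>
    simp only [Test.holds, WExpr.eval, h36, ei] at hc
  · refine WP.skip hM2 (WP.setN hM2 ?_)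
    simp [i1, i2, Finset.prod_range_succ, hc]
    ring
  · refine WP.setN hM2 (WP.setN hM2 ?_)
    simp [i1, i2, Finset.prod_range_succ, hc, ex, er]
    exact ⟨by ring, by ring⟩

/-- Computes the value of the Tutte polynomial at the point in the number registers `0` and `1`
from its values at integral points. -/
def interpProg : Prog :=
  .seq (.setN 10 (.lit 2)) <| .seq (.forUp 3 (.reg 0) (.setN 10 (.add (.reg 10) (.lit 1)))) <|
  .seq (.setN 9 (.lit 0)) <| .seq (.setN 2 (.reg 10)) <|
  .seq (.forUp 43 (.add (.reg 0) (.lit 1)) <|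
    .seq (.setN 3 (.lit 1)) <|
    .seq (.forUp 44 (.add (.reg 1) (.lit 1)) <|
      .seq dpProg <|
      .seq (lagrangeProg (.add (.reg 0) (.lit 1)) 43 0 2 (.add (.reg 10) (.lit 1))) <|
      .seq (lagrangeProg (.add (.reg 1) (.lit 1)) 44 1 3 (.lit 2)) <|
      .seq (.setN 9 (.add (.reg 9) (.reg 7))) (.setN 3 (.add (.reg 3) (.lit 1)))) <|
    .setN 2 (.add (.reg 2) (.lit 1))) <|
  .setN 0 (.reg 9)

/-- `p ≤ α` and `0 < β` ensure that at least `p` of the αβ colours exist, as the symmetry argument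
requires. -/
theorem dpProg_tutte {M n m p α β : ℕ} {G : MGraph n m} {par : ℕ → ℕ} {es et : ℕ → ℕ} {s : State}
    (hMn : n + m + 2 ≤ M) (hMp : p ^ p ≤ M) (hs : Env n m p es et par G.elimNb s)
    (hes : ∀ e : Fin m, es e = G.src e) (het : ∀ e : Fin m, et e = G.tgt e)
    (h0 : ∀ i < n, par i = 0 ↔ G.elimNb i = ∅)
    (h1 : ∀ i < n, ∀ a, par i = a + 1 → a ∈ G.elimNb i ∧ ∀ u ∈ G.elimNb i, u ≤ a)
    (hcard : ∀ i < n, (G.elimNb i).card < p) (hp : 0 < p) (hpα : p ≤ α) (hβ : 0 < β)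
    (h2 : s.nreg 2 = α) (h3 : s.nreg 3 = β) :
    WP M dpProg (fun s' => Agree [3, 4, 13, 14, 15, 16, 17, 30, 31, 32, 34, 35, 36, 37, 38, 39, 40, 41,
      42] [6, 7, 8] [4, 5, 6, 7, 8] [0] s s' ∧ s'.nreg 7 = G.tutte (α + 1) (β + 1)) s := by
  refine (dpProg_spec hMn hMp hs (G.isElim hes het (fun i hi => (h0 i hi).1) h1) hcard hp
    (hpα.trans (Nat.le_mul_of_pos_right _ hβ)) h2 h3).mono ?_
  rintro s1 ⟨hA, h7⟩
  refine ⟨hA, ?_⟩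
  rw [h7, G.tutte_eq_sum_colourings (by omega) hβ, G.numComp_univ_eq h0]
  congr 2
  refine Finset.sum_congr rfl fun σ _ => ?_
  rw [← Fin.prod_univ_eq_prod_range (fun e => edgeWeight β es et e (extZero σ))]
  refine Finset.prod_congr rfl fun e _ => ?_
  unfold edgeWeight
  rw [hes, het]
  simp [extZero, Fin.val_inj]

theorem interpProg_spec {M n m p : ℕ} {G : MGraph n m} {s : State}
    (hMn : n + m + 2 ≤ M) (hMp : p ^ p ≤ M) (hG : HasGraph G s) (hE : HasElim G p s) (hp : 0 < p)
    (hpn : p ≤ n + 2) :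
    WP M interpProg (fun s' => s'.nreg 0 = G.tutte (s.nreg 0) (s.nreg 1)) s := by
  have hM2 : 2 ≤ M := by omega
  set a := s.nreg 0
  set b := s.nreg 1
  -- The nodes correspond to α = n + 2 + i and β = j + 1. Starting α at n + 2 guarantees `p ≤ α`,
  -- because `p ≤ n + 2`.
  set v : ℕ → ℂ := fun i => ((n + 2 + i : ℕ) : ℂ) + 1 with hv
  set w : ℕ → ℂ := fun j => ((j + 1 : ℕ) : ℂ) + 1 with hw
  have hvi : Function.Injective v := by
    intro i j h
    have := Nat.cast_injective (add_right_cancel h)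
    omega
  have hwi : Function.Injective w := by
    intro i j h
    have := Nat.cast_injective (add_right_cancel h)
    omega
  rw [G.tutte_eq_lagrange v w hvi hwi a b]
  set term : ℕ → ℕ → ℂ := fun i j => G.tutte (v i) (w j) *
      (∏ i' ∈ Finset.range (n + 1), if i' = i then 1 else (a - v i') / (v i - v i')) *
      ∏ j' ∈ Finset.range (m + 1), if j' = j then 1 else (b - w j') / (w j - w j') with hterm
  have hs : Env n m p (s.warr 0) (s.warr 1) (s.warr 19) G.elimNb s :=
    ⟨hG.n_eq, hG.m_eq, hE.p_eq, rfl, rfl, rfl, hE.row, hE.nb⟩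
  refine WP.seq hM2 (WP.setN hM2 (WP.seq hM2 ?_))
  refine WP.forUp hM2 [] [] [10] [] (by decide) n (by omega) (fun s' h => by simp [h.wreg, hs.n_eq])
    (fun k s' => s'.nreg 10 = ((k + 2 : ℕ) : ℂ)) (by simp) ?_ ?_
  · intro k s1 hk hA1 hi1 hI1
    refine WP.setN hM2 ?_
    simp [hI1]
    ring
  intro s1 hA1 h10
  have hs1 := (hs.setN 10 _).of_agree hA1 (by decide)
  have a1 : s1.nreg 0 = a := by simp [hA1.nreg, a]
  have b1 : s1.nreg 1 = b := by simp [hA1.nreg, b]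
  refine WP.seq hM2 (WP.setN hM2 (WP.seq hM2 (WP.setN hM2 (WP.seq hM2 ?_))))
  refine WP.forUp hM2 [3, 4, 13, 14, 15, 16, 17, 30, 31, 32, 34, 35, 36, 37, 38, 39, 40, 41, 42, 44]
    [6, 7, 8] [2, 3, 4, 5, 6, 7, 8, 9, 11] [0] (by decide) (n + 1) (by omega)
    (fun s' h => by simp [h.wreg, hs1.n_eq])
    (fun i s' => s'.nreg 2 = ((n + 2 + i : ℕ) : ℂ) ∧ s'.nreg 9 =
      ∑ i ∈ Finset.range i, ∑ j ∈ Finset.range (m + 1), term i j) (by simp [h10]) ?_ ?_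
  · rintro i s2 hi hA2 hi2 ⟨i1, i2⟩
    have hs2 := ((hs1.setN 9 _).setN 2 _).of_agree hA2 (by decide)
    refine WP.seq hM2 (WP.setN hM2 (WP.seq hM2 ?_))
    refine WP.forUp hM2 [3, 4, 13, 14, 15, 16, 17, 30, 31, 32, 34, 35, 36, 37, 38, 39, 40, 41, 42]
      [6, 7, 8] [3, 4, 5, 6, 7, 8, 9, 11] [0] (by decide) (m + 1) (by omega)
      (fun s' h => by simp [h.wreg, hs2.m_eq])
      (fun j s' => s'.nreg 3 = ((j + 1 : ℕ) : ℂ) ∧ s'.nreg 9 =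
        ∑ i ∈ Finset.range i, ∑ j ∈ Finset.range (m + 1), term i j +
        ∑ j ∈ Finset.range j, term i j) (by simp [i2]) ?_ ?_
    · rintro j s3 hj hA3 hi3 ⟨j1, j2⟩
      have hs3 := (hs2.setN 3 _).of_agree hA3 (by decide)
      refine WP.seq hM2 ((dpProg_tutte (α := n + 2 + i) (β := j + 1) hMn hMp hs3 hG.src hG.tgt
        hE.par_zero hE.par_succ (fun i hi => by have := hE.card i hi; omega) hp (by omega)
        (Nat.succ_pos j) (by simp [hA3.nreg, i1]) j1).mono ?_)
      rintro s4 ⟨hA4, h7⟩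
      have hs4 := hs3.of_agree hA4 (by decide)
      refine WP.seq hM2 ((lagrangeProg_spec (N := n + 1) (k := i) hM2 (by omega)
        (fun s' h => by simp [h, hs4.n_eq]) (by simp [hA4.wreg, hA3.wreg, hi2]) (by decide)
        (by decide) (by decide)).mono ?_)
      rintro s5 ⟨hA5, h7'⟩
      have hs5 := hs4.of_agree hA5 (by decide)
      refine WP.seq hM2 ((lagrangeProg_spec (N := m + 1) (k := j) hM2 (by omega)
        (fun s' h => by simp [h, hs5.m_eq]) (by simp [hA5.wreg, hA4.wreg, hi3]) (by decide)
        (by decide) (by decide)).mono ?_)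
      rintro s6 ⟨hA6, h7''⟩
      have hsum : s6.nreg 7 = term i j := by
        rw [h7'', h7', h7, hterm]
        have e0 : s4.nreg 0 = a := by simp [hA4.nreg, hA3.nreg, hA2.nreg, a1]
        have e1 : s5.nreg 1 = b := by simp [hA5.nreg, hA4.nreg, hA3.nreg, hA2.nreg, b1]
        have e2 : s4.nreg 2 = ((n + 2 + i : ℕ) : ℂ) := by simp [hA4.nreg, hA3.nreg, i1]
        have e3 : s5.nreg 3 = ((j + 1 : ℕ) : ℂ) := by simp [hA5.nreg, hA4.nreg, j1]
        have e10 : s4.nreg 10 = ((n + 2 : ℕ) : ℂ) := by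
          simp [hA4.nreg, hA3.nreg, hA2.nreg, h10]
        simp only [NExpr.eval, e0, e1, e2, e3, e10, hv, hw]
        congr 1
        · congr 1
          refine Finset.prod_congr rfl fun i' _ => ?_
          have : ((n + 2 : ℕ) : ℂ) + (1 : ℕ) + i' = ((n + 2 + i' : ℕ) : ℂ) + 1 := by push_cast; ring
          rw [this]
        · refine Finset.prod_congr rfl fun j' _ => ?_
          have : ((2 : ℕ) : ℂ) + j' = ((j' + 1 : ℕ) : ℂ) + 1 := by push_cast; ring
          rw [this]
      refine WP.seq hM2 (WP.setN hM2 (WP.setN hM2 ?_))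
      have e3 : s6.nreg 3 = ((j + 1 : ℕ) : ℂ) := by simp [hA6.nreg, hA5.nreg, hA4.nreg, j1]
      have e9 : s6.nreg 9 = s3.nreg 9 := by simp [hA6.nreg, hA5.nreg, hA4.nreg]
      refine ⟨by simp [e3], ?_⟩
      simp [e9, j2, hsum, Finset.sum_range_succ (term i), add_assoc]
    · rintro s3 hA3 ⟨j1, j2⟩
      refine WP.setN hM2 ⟨?_, ?_⟩
      · simp [hA3.nreg, i1, add_assoc]
      · simp [j2, Finset.sum_range_succ (fun i => ∑ j ∈ Finset.range (m + 1), term i j)]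
  · rintro s2 hA2 ⟨-, i2⟩
    refine WP.setN hM2 ?_
    simpa using i2

end TutteTW

end

noncomputable section

namespace TutteTW

open Relation

/-! ### The complete program -/

namespace MGraph

variable {n m : ℕ}

/-- Renaming by position turns "placed before" into "smaller than". Paths in the renamed graph are
pulled back vertex by vertex, and renaming maps the old neighbourhood onto a set containing the new
one. -/
theorem card_elimNb_relabel_le (G : MGraph n m) (σ : Equiv.Perm (Fin n)) {pos : ℕ → ℕ}
    (hpos : ∀ v : Fin n, pos v = σ v) {w : ℕ}
    (hw : ∀ v < n, (nbF n G.nadj {u | u < n ∧ pos u < pos v} v).card ≤ w) {i : ℕ} (hi : i < n) :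
    ((G.relabel σ).elimNb i).card ≤ w := by
  have hR := G.isAdj_nadj
  have hR' := (G.relabel σ).isAdj_nadj
  obtain ⟨v, hv⟩ := σ.surjective ⟨i, hi⟩
  have hvi : pos v = i := by rw [hpos, hv]
  have hadj : ∀ x : Fin n, ∀ d, (G.relabel σ).nadj (pos x) d →
      ∃ y : Fin n, pos y = d ∧ G.nadj x y := by
    intro x d h
    obtain ⟨y, hy⟩ := σ.surjective ⟨d, hR'.lt (hR'.symm h)⟩
    have hyd : pos y = d := by rw [hpos, hy]
    rw [← hyd, hpos, hpos, nadj_relabel] at h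
    exact ⟨y, hyd, h⟩
  have hconn : ∀ c, Conn (G.relabel σ).nadj {u | u < i} i c →
      ∃ y : Fin n, pos y = c ∧ Conn G.nadj {u | u < n ∧ pos u < pos v} v y := by
    intro c h
    induction h with
    | refl => exact ⟨v, hvi, ReflTransGen.refl⟩
    | tail _ hbc ih =>
      obtain ⟨x, rfl, hx⟩ := ih
      obtain ⟨y, rfl, hy⟩ := hadj x _ hbc.1
      refine ⟨y, rfl, ReflTransGen.tail hx ⟨hy, fun h => hbc.2 ?_⟩⟩
      have := h.2
      rwa [hvi] at this
  refine le_trans ?_ (hw v v.2)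
  refine (Finset.card_le_card fun u hu => ?_).trans (Finset.card_image_le (f := pos))
  obtain ⟨hui, c, hc, hcu⟩ := (mem_nbF hR').1 hu
  obtain ⟨x, rfl, hx⟩ := hconn c hc
  obtain ⟨y, rfl, hy⟩ := hadj x u hcu
  refine Finset.mem_image.2 ⟨y, (mem_nbF hR).2 ⟨⟨y.2, ?_⟩, x, hx, hy⟩, rfl⟩
  rw [hvi]
  exact hui

theorem IsSimple.edges_le {G : MGraph n m} (h : G.IsSimple) : m ≤ n * n := by
  have : Function.Injective fun e => (G.src e, G.tgt e) := by
    intro e e' he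
    refine h.2 ?_
    simp only [Prod.mk.injEq] at he
    simp only [he.1, he.2]
  simpa using Fintype.card_le_of_injective _ this

end MGraph

/-- Computes the value of the Tutte polynomial. -/
def tutteProg : Prog :=
  .seq arcsProg <| .seq orderProg <| .seq relabelProg <| .seq arcsProg <| .seq elimProg interpProg

theorem hasGraph_initState {n m : ℕ} (G : MGraph n m) (a b : ℂ) : HasGraph G (initState G a b) := by
  refine ⟨rfl, rfl, fun e => ?_, fun e => ?_⟩ <;> simp [initState]

theorem tutteProg_spec {M n m : ℕ} (G : MGraph n m) (a b : ℂ) (hM : 2 * (n + m + 1) ≤ M)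
    (hM' : (8 * G.treewidth + 10) ^ (8 * G.treewidth + 10) ≤ M) :
    WP M tutteProg (fun s => s.nreg 0 = G.tutte a b) (initState G a b) := by
  have hM2 : 2 ≤ M := by omega
  set s := initState G a b
  have hs := hasGraph_initState G a b
  set thr := 4 * G.treewidth + 4 with hthr
  have hthrM : 2 ^ thr ≤ M := by
    refine le_trans ?_ hM'
    calc 2 ^ thr ≤ 2 ^ (8 * G.treewidth + 10) := Nat.pow_le_pow_right (by omega) (by omega)
      _ ≤ _ := Nat.pow_le_pow_left (by omega) _
  refine WP.seq hM2 ((arcsProg_spec (M := M) (by omega) hs).mono ?_)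
  rintro s1 ⟨hA1, ha1⟩
  have hs1 := hs.of_agree hA1 (by decide)
  refine WP.seq hM2 ((orderProg_spec (M := M) (thr := thr) (by omega) hthrM G.isAdj_nadj ha1 ?_ ?_
    ?_).mono ?_)
  · intro v
    simp [hA1.warr, initState]
  · simp [hA1.wreg, initState]
  · intro W C hW hcard hCW
    obtain ⟨A, h1, h2, h3⟩ := G.exists_unlinked W C hW hcard
    refine ⟨A, h1, h2, ?_⟩
    rintro ⟨f, hf, hf'⟩
    exact h3 ⟨f, hf, hf', hCW⟩
  rintro s2 ⟨hA2, hlt, hinj, hwidth⟩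
  have hs2 := hs1.of_agree hA2 (by decide)
  let σ : Equiv.Perm (Fin n) := Equiv.ofBijective
    (fun v : Fin n => (⟨s2.warr 16 v, hlt v v.2⟩ : Fin n)) (Finite.injective_iff_bijective.1 (by
      intro u v h
      exact Fin.ext (hinj u u.2 v v.2 (congrArg Fin.val h))))
  have hσ : ∀ v : Fin n, s2.warr 16 v = σ v := fun v => rfl
  refine WP.seq hM2 ((relabelProg_spec (M := M) (by omega) hs2 σ hσ).mono ?_)
  rintro s3 ⟨hA3, hs3⟩
  refine WP.seq hM2 ((arcsProg_spec (M := M) (by omega) hs3).mono ?_)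
  rintro s4 ⟨hA4, ha4⟩
  have hs4 := hs3.of_agree hA4 (by decide)
  -- Both bounds are needed: `2 * thr` gives `p ≤ 8 * G.treewidth + 10` and with it the running
  -- time, while `n` gives `p ≤ n + 2` for the interpolation nodes.
  refine WP.seq hM2 ((elimProg_spec (M := M) (w := min (2 * thr) n) (by omega) ha4 ?_).mono ?_)
  · intro i hi
    refine le_min (G.card_elimNb_relabel_le σ hσ hwidth hi) ?_
    refine (Finset.card_le_card (t := Finset.range n) fun u hu => ?_).trans (by simp)
    exact Finset.mem_range.2 (((G.relabel σ).lt_of_mem_elimNb hu).trans hi)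
  rintro s5 ⟨hA5, p, hpw, hp2, hE⟩
  have hs5 := hs4.of_agree hA5 (by decide)
  have hpM : p ^ p ≤ M := by
    refine le_trans ?_ hM'
    calc p ^ p ≤ (8 * G.treewidth + 10) ^ p := Nat.pow_le_pow_left (by omega) _
      _ ≤ _ := Nat.pow_le_pow_right (by omega) (by omega)
  refine (interpProg_spec (M := M) (by omega) hpM hs5 hE (by omega) (by omega)).mono ?_
  intro s6 h6
  have e0 : s5.nreg 0 = a := by simp [hA5.nreg, hA4.nreg, hA3.nreg, hA2.nreg, hA1.nreg, initState]
  have e1 : s5.nreg 1 = b := by simp [hA5.nreg, hA4.nreg, hA3.nreg, hA2.nreg, hA1.nreg, initState]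
  rw [h6, e0, e1, G.tutte_relabel]

/-- For w ≤ 1 the factor w^(Cw) is 1, so the constant alone has to suffice; here 18 = 8 + 10. For w
≥ 2 one has 8w + 10 ≤ 16w ≤ w^5 and 8w + 10 ≤ 13w, and 65 = 5 · 13. -/
theorem pow_bound (D w : ℕ) : 2 ^ D * ((8 * w + 10) ^ (8 * w + 10)) ^ D ≤
    (65 * D + 2 ^ D * 18 ^ (18 * D)) * w ^ ((65 * D + 2 ^ D * 18 ^ (18 * D)) * w) := by
  set C := 65 * D + 2 ^ D * 18 ^ (18 * D)
  have hC1 : 2 ^ D * 18 ^ (18 * D) ≤ C := Nat.le_add_left _ _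
  have hC2 : 65 * D ≤ C := Nat.le_add_right _ _
  rw [← pow_mul]
  rcases Nat.lt_or_ge w 2 with hw | hw
  · have : w ^ (C * w) = 1 := by interval_cases w <;> simp
    rw [this, mul_one]
    refine le_trans (Nat.mul_le_mul_left _ ?_) hC1
    calc (8 * w + 10) ^ ((8 * w + 10) * D) ≤ 18 ^ ((8 * w + 10) * D) :=
        Nat.pow_le_pow_left (by omega) _
      _ ≤ 18 ^ (18 * D) := Nat.pow_le_pow_right (by omega) (Nat.mul_le_mul_right _ (by omega))
  · refine Nat.mul_le_mul ?_ ?_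
    · exact le_trans (Nat.le_mul_of_pos_right _ (by positivity)) hC1
    · have h1 : 8 * w + 10 ≤ w ^ 5 := by
        have : 2 ^ 4 ≤ w ^ 4 := Nat.pow_le_pow_left hw 4
        calc 8 * w + 10 ≤ 2 ^ 4 * w := by omega
          _ ≤ w ^ 4 * w := Nat.mul_le_mul_right _ this
          _ = w ^ 5 := by ring
      calc (8 * w + 10) ^ ((8 * w + 10) * D) ≤ (w ^ 5) ^ ((8 * w + 10) * D) :=
          Nat.pow_le_pow_left h1 _
        _ = w ^ (5 * ((8 * w + 10) * D)) := (pow_mul _ _ _).symm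
        _ ≤ w ^ (C * w) := Nat.pow_le_pow_right (by omega) ?_
      calc 5 * ((8 * w + 10) * D) ≤ 5 * ((13 * w) * D) :=
          Nat.mul_le_mul_left _ (Nat.mul_le_mul_right _ (by omega))
        _ = 65 * D * w := by ring
        _ ≤ C * w := Nat.mul_le_mul_right _ hC2

end TutteTW

end

theorem mainTheorem6 :
    ∃ (p : TutteTW.Prog) (C : ℕ), ∀ (n m : ℕ) (G : TutteTW.MGraph n m) (a b : ℂ),
      ∃ t : ℕ, TutteTW.Outputs p G a b t (G.tutte a b) ∧
        t ≤ C * G.treewidth ^ (C * G.treewidth) * (n + m + 1) ^ C ∧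
        (G.IsSimple → t ≤ C * G.treewidth ^ (C * G.treewidth) * (n + 1) ^ C) := by
  obtain ⟨D, hD⟩ : ∃ D, D = TutteTW.tutteProg.deg := ⟨_, rfl⟩
  obtain ⟨C, hC⟩ : ∃ C, C = 65 * D + 2 ^ D * 18 ^ (18 * D) := ⟨_, rfl⟩
  have hDC : 2 * D ≤ C := by
    rw [hC]
    exact le_trans (by omega) (Nat.le_add_right _ _)
  refine ⟨TutteTW.tutteProg, C, fun n m G a b => ?_⟩
  set w := G.treewidth with hw
  have hK : 1 ≤ (8 * w + 10) ^ (8 * w + 10) := Nat.one_le_pow _ _ (by omega)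
  -- The product dominates each of its factors, so it meets both requirements on `M`.
  obtain ⟨t, s, h1, h2, h3⟩ := TutteTW.tutteProg_spec
    (M := 2 * (n + m + 1) * (8 * w + 10) ^ (8 * w + 10)) G a b (Nat.le_mul_of_pos_right _ hK)
    (Nat.le_mul_of_pos_left _ (by omega))
  rw [← hD, mul_pow, mul_pow, mul_right_comm] at h2
  have hb := TutteTW.pow_bound D w
  rw [← hC] at hb
  replace h2 := h2.trans (Nat.mul_le_mul_right _ hb)
  refine ⟨t, ⟨s, h1, h3⟩, h2.trans (Nat.mul_le_mul_left _ ?_), fun hS => h2.trans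
    (Nat.mul_le_mul_left _ ?_)⟩
  · exact Nat.pow_le_pow_right (by omega) (by omega)
  · have hm := hS.edges_le
    -- A simple graph has m ≤ n², so n + m + 1 ≤ (n + 1)².
    calc (n + m + 1) ^ D ≤ ((n + 1) ^ 2) ^ D := Nat.pow_le_pow_left (by nlinarith) _
      _ = (n + 1) ^ (2 * D) := (pow_mul _ _ _).symm
      _ ≤ (n + 1) ^ C := Nat.pow_le_pow_right (by omega) hDC
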